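/- Let $B_1\subset\mathbb R^2$ be the open unit disc. For $\delta\in[0,1]$ let $\mathcal A_\delta$ be the set of pairs $(u,w)$ of real functions on $[0,1]$ such that the radially symmetric displacements $$U(x)=\tfrac12\,u(|x|)\,\frac{x}{|x|},\qquad W(x)=w(|x|)\qquad(x\in B_1)$$ satisfy $U\in W^{1,2}(B_1;\mathbb R^2)$ and $W\in W^{2,2}(B_1)$, and such that $w(0)=0$ and $w(1)=1-\delta$, where $w$ denotes its continuous representative on $[0,1]$. For $h>0$ and $(u,w)\in\mathcal A_\delta$ define the energy $$E_h(u,w)=\int_0^1\left[\frac{u^2}{r}+r\,\bigl(u'+w'^2-4r^2\bigr)^2+h^2\left(r\,w''^2+\frac{w'^2}{r}\right)\right]dr,$$ where $u',w',w''$ are weak derivatives on $(0,1)$. **Theorem.** There is a numerical constant $C>0$ such that for all $h\in(0,1/2]$ and all $\delta\in[0,1]$ the minimum of $E_h$ over $\mathcal A_\delta$ is attained and $$\frac1C\left(h^2+\delta^{3/2}h^{3/2}\right)\le\min_{\mathcal A_\delta}E_h\le C\left(h^2+\delta^{3/2}h^{3/2}\right).$$ -/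

import Mathlib

open MeasureTheory Set
open scoped ENNReal ContDiff

noncomputable section

/-- The Euclidean plane. -/
abbrev Plane : Type := EuclideanSpace ℝ (Fin 2)

/-- `g` is the weak (distributional) derivative of `f` on the open set `Ω` in the direction `v`:
`∫_Ω f ∂_v φ = - ∫_Ω g φ` for every test function `φ ∈ C_c^∞(Ω)`, where `f` and `g` are locally
integrable on `Ω`. For a function of one real variable take `v = 1`. -/
def HasWeakDirDeriv {E : Type*} [NormedAddCommGroup E] [NormedSpace ℝ E] [MeasureSpace E]
    (Ω : Set E) (v : E) (f g : E → ℝ) : Prop :=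
  LocallyIntegrableOn f Ω volume ∧ LocallyIntegrableOn g Ω volume ∧
    ∀ φ : E → ℝ, ContDiff ℝ ∞ φ → HasCompactSupport φ → tsupport φ ⊆ Ω →
      ∫ x in Ω, f x * fderiv ℝ φ x v = -∫ x in Ω, g x * φ x

/-- The Sobolev space `W^{k,2}(Ω)` of an open set `Ω` of the plane: `f ∈ L²(Ω)`, and (for `k ≥ 1`)
the weak partial derivatives of `f` exist and belong to `W^{k-1,2}(Ω)`. -/
def MemSobolevTwo : ℕ → Set Plane → (Plane → ℝ) → Prop
  | 0, Ω, f => MemLp f 2 (volume.restrict Ω)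
  | k + 1, Ω, f => MemLp f 2 (volume.restrict Ω) ∧
      ∀ j : Fin 2, ∃ g : Plane → ℝ,
        HasWeakDirDeriv Ω (EuclideanSpace.single j 1) f g ∧ MemSobolevTwo k Ω g

/-- The open unit disc `B₁`. -/
def unitDisc : Set Plane := Metric.ball 0 1

/-- The radial in-plane displacement `U(x) = ½ u(|x|) x / |x|`. -/
def inPlane (u : ℝ → ℝ) (x : Plane) : Plane := (1 / 2 * u ‖x‖) • (‖x‖⁻¹ • x)

/-- The radial out-of-plane displacement `W(x) = w(|x|)`. -/
def outOfPlane (w : ℝ → ℝ) (x : Plane) : ℝ := w ‖x‖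

/-- The admissible class: `U ∈ W^{1,2}(B₁; ℝ²)`, `W ∈ W^{2,2}(B₁)`, `w(0) = 0`, `w(1) = 1 - δ`.
The two point values are those of the continuous representative of `w` on `[0,1]`, so `w` is
required to be that representative. -/
def admissible (δ : ℝ) : Set ((ℝ → ℝ) × (ℝ → ℝ)) :=
  {p | (∀ i : Fin 2, MemSobolevTwo 1 unitDisc (fun x => inPlane p.1 x i)) ∧
    MemSobolevTwo 2 unitDisc (outOfPlane p.2) ∧
    ContinuousOn p.2 (Icc 0 1) ∧ p.2 0 = 0 ∧ p.2 1 = 1 - δ}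

open Classical in
/-- The weak derivative on `(0,1)` of a function of one variable (unique up to null sets; the zero
function if there is none, which does not occur for the profiles of admissible pairs). -/
def weakDeriv (f : ℝ → ℝ) : ℝ → ℝ :=
  if hf : ∃ g : ℝ → ℝ, HasWeakDirDeriv (Ioo (0 : ℝ) 1) 1 f g then hf.choose else 0

/-- The energy
`E_h(u,w) = ∫₀¹ u²/r + r (u' + w'² - 4r²)² + h² (r w''² + w'²/r) dr`.
The integrand is nonnegative, so the integral is taken with values in `[0,∞]`. -/
def energy (h : ℝ) (p : (ℝ → ℝ) × (ℝ → ℝ)) : ℝ≥0∞ :=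
  ∫⁻ r in Ioo (0 : ℝ) 1, ENNReal.ofReal
    (p.1 r ^ 2 / r
      + r * (weakDeriv p.1 r + weakDeriv p.2 r ^ 2 - 4 * r ^ 2) ^ 2
      + h ^ 2 * (r * weakDeriv (weakDeriv p.2) r ^ 2 + weakDeriv p.2 r ^ 2 / r))

end

/-!
Write `v = w'`, `ℓ = √h` and `x = √δ`, so that the claim reads `min E ~ ℓ⁴ + x³ ℓ³`.

*Reduction to one dimension.* In polar coordinates, testing the weak derivatives of a radial
Sobolev function against suitable radial vector fields shows that its profile is weakly
differentiable on `(0,1)` (`hasWeakDirDeriv_angularAverage`); conversely `f(r) a(t)` is weakly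
differentiable on the whole disc if `f` is bounded, because a point does not matter for integration
by parts along rays (`hasWeakDirDeriv_polar`). Hence admissible pairs of finite energy are the same
as locally absolutely continuous functions `u`, `v` on `(0,1]` of finite energy with
`∫₀¹ v = 1 - δ` (`exists_profile_of_admissible`, `Profile.admissible`).

*Existence.* The direct method: for a minimizing sequence `√r v'` and `√r (u' + v² - 4r²)` converge
weakly in `L²` along a subsequence. Since `∫ v²/r + r v'²` controls the supremum of `v`, the slopes
are uniformly bounded, and they converge pointwise on `(0,1]`; so the nonlinear constraint and the
boundary condition survive in the limit, and the energy is lower semicontinuous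
(`exists_limit_profile`).

*Upper bound.* The paraboloid `w' = 2r` is reflected to `w' = -2r` inside a radius `R ≈ √(δ/2)`,
with a transition layer of width `ℓ` (`exists_profile_energy_le`). The layer profile `ψ` is chosen
such that `1 - ψ²` is an explicit derivative `χ'`, and `u` follows `χ`, so that the membrane strain
almost cancels; `R` is adjusted by the intermediate value theorem to satisfy the boundary condition
exactly (`exists_ridge_radius`). The layer costs `R³ ℓ³`, the rest costs the bending `ℓ⁴`.

*Lower bound.* At two points at distance of order one `u` is at most of order `√E`; if the membrane
strain is small as well, then `v²` is close to `4r²` in the mean, which costs bending energy `h²`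
(`EnergyBound.sq_le_energy`). By the same argument on an interval of length `ℓ` next to a zero of
`v` at radius `r₀`, such a zero costs `r₀³ ℓ³` (`EnergyBound.ne_zero_of_energy_lt`). If the energy
is well below `x³ ℓ³`, then `v` has a constant sign beyond the radius `x/8`, and there `|v|` is
close to `2r` in the mean (`EnergyBound.integral_sub_abs_le`), while the disc of radius of order
`x/8` contributes only little to `∫ v` (`EnergyBound.integral_abs_v_le`). So `∫ v` is larger than `1 - δ`
or negative, a contradiction (`EnergyBound.ridge_le_energy`).
-/


/-! ### Primitives of locally integrable functions -/

/-- `f` is a primitive of `g` on `I`: `g` is integrable between any two points of `I`, and `f` is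
the integral of `g` there. On compact intervals this is absolute continuity with derivative `g`. -/
def PrimitiveOn (I : Set ℝ) (f g : ℝ → ℝ) : Prop :=
  ∀ a ∈ I, ∀ b ∈ I, IntervalIntegrable g volume a b ∧ f b - f a = ∫ s in a..b, g s

namespace PrimitiveOn

variable {I J : Set ℝ} {f f' g g' : ℝ → ℝ} {a b : ℝ}

theorem mono (hf : PrimitiveOn I f f') (h : J ⊆ I) : PrimitiveOn J f f' :=
  fun a ha b hb => hf a (h ha) b (h hb)

theorem intervalIntegrable (hf : PrimitiveOn I f f') (ha : a ∈ I) (hb : b ∈ I) :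
    IntervalIntegrable f' volume a b := (hf a ha b hb).1

theorem integral_eq (hf : PrimitiveOn I f f') (ha : a ∈ I) (hb : b ∈ I) :
    ∫ s in a..b, f' s = f b - f a := (hf a ha b hb).2.symm

theorem eq_add_integral (hI : I.OrdConnected) (hf : PrimitiveOn I f f') (ha : a ∈ I) (hb : b ∈ I)
    {x : ℝ} (hx : x ∈ uIcc a b) : f x = f a + ∫ s in a..x, f' s := by
  rw [hf.integral_eq ha (hI.uIcc_subset ha hb hx)]; ring

theorem continuousOn_uIcc (hI : I.OrdConnected) (hf : PrimitiveOn I f f') (ha : a ∈ I)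
    (hb : b ∈ I) : ContinuousOn f (uIcc a b) := by
  have h : ContinuousOn (fun x => f a + ∫ s in a..x, f' s) (uIcc a b) :=
    continuousOn_const.add (intervalIntegral.continuousOn_primitive_interval'
      (hf.intervalIntegrable ha hb) left_mem_uIcc)
  exact h.congr fun x hx => hf.eq_add_integral hI ha hb hx

theorem continuousOn_Icc (hI : I.OrdConnected) (hf : PrimitiveOn I f f') (ha : a ∈ I)
    (hb : b ∈ I) : ContinuousOn f (Icc a b) :=
  (hf.continuousOn_uIcc hI ha hb).mono Icc_subset_uIcc

theorem continuousOn_Ioc (hf : PrimitiveOn (Ioc 0 1) f f') : ContinuousOn f (Ioc 0 1) := by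
  intro x hx
  have h := hf.continuousOn_Icc ordConnected_Ioc (a := x / 2) (b := 1)
    ⟨by linarith [hx.1], by linarith [hx.1, hx.2]⟩ ⟨one_pos, le_rfl⟩
  refine (h x ⟨by linarith [hx.1], hx.2⟩).mono_of_mem_nhdsWithin ?_
  have : Ioi (x / 2) ∈ nhdsWithin x (Ioc 0 1) :=
    mem_nhdsWithin_of_mem_nhds (Ioi_mem_nhds (by linarith [hx.1]))
  filter_upwards [this, self_mem_nhdsWithin] with y hy hy'
  exact ⟨le_of_lt hy, hy'.2⟩

theorem aestronglyMeasurable (hf : PrimitiveOn (Ioc 0 1) f f') :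
    AEStronglyMeasurable f (volume.restrict (Ioo 0 1)) :=
  ((hf.continuousOn_Ioc).mono Ioo_subset_Ioc_self).aestronglyMeasurable measurableSet_Ioo

theorem aestronglyMeasurable_deriv (hf : PrimitiveOn (Ioc 0 1) f f') :
    AEStronglyMeasurable f' (volume.restrict (Ioo 0 1)) := by
  have h : Ioo (0 : ℝ) 1 ⊆ ⋃ n : ℕ, Ioc (1 / ((n : ℝ) + 1)) 1 := by
    intro x hx
    obtain ⟨n, hn⟩ := exists_nat_one_div_lt hx.1
    exact mem_iUnion.2 ⟨n, hn, hx.2.le⟩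
  refine AEStronglyMeasurable.mono_set h (AEStronglyMeasurable.iUnion fun n => ?_)
  have hn : (1 / ((n : ℝ) + 1)) ≤ 1 := by
    rw [div_le_one (by positivity)]; linarith [Nat.cast_nonneg (α := ℝ) n]
  have := (hf.intervalIntegrable (a := 1 / ((n : ℝ) + 1)) (b := 1) ⟨by positivity, hn⟩
    ⟨one_pos, le_rfl⟩).1
  exact this.aestronglyMeasurable

theorem add (hf : PrimitiveOn I f f') (hg : PrimitiveOn I g g') :
    PrimitiveOn I (fun x => f x + g x) (fun x => f' x + g' x) := by
  intro a ha b hb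
  have h1 := hf a ha b hb
  have h2 := hg a ha b hb
  refine ⟨h1.1.add h2.1, ?_⟩
  rw [intervalIntegral.integral_add h1.1 h2.1, ← h1.2, ← h2.2]; ring

theorem const_mul (hf : PrimitiveOn I f f') (c : ℝ) :
    PrimitiveOn I (fun x => c * f x) (fun x => c * f' x) := by
  intro a ha b hb
  have h1 := hf a ha b hb
  refine ⟨h1.1.const_mul c, ?_⟩
  rw [intervalIntegral.integral_const_mul, ← h1.2]; ring

theorem neg (hf : PrimitiveOn I f f') : PrimitiveOn I (fun x => -f x) (fun x => -f' x) := by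
  simpa using hf.const_mul (-1)

/-- The continuous representative of a primitive between two points of `I`: an absolutely
continuous function with the right derivative almost everywhere. -/
theorem exists_absolutelyContinuous (hI : I.OrdConnected) (hf : PrimitiveOn I f f') (ha : a ∈ I)
    (hb : b ∈ I) : ∃ F : ℝ → ℝ, AbsolutelyContinuousOnInterval F a b ∧
      (∀ x ∈ uIcc a b, F x = f x) ∧ ∀ᵐ x, x ∈ uIcc a b → HasDerivAt F (f' x) x := by
  have hi := hf.intervalIntegrable ha hb
  refine ⟨fun x => f a + ∫ s in a..x, f' s, ?_, fun x hx =>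
    (hf.eq_add_integral hI ha hb hx).symm, ?_⟩
  · exact (LipschitzOnWith.absolutelyContinuousOnInterval
      (K := 0) (LipschitzWith.const (f a)).lipschitzOnWith).fun_add
      (hi.absolutelyContinuousOnInterval_intervalIntegral left_mem_uIcc)
  · filter_upwards [hi.ae_hasDerivAt_integral] with x hx hx'
    exact (hx hx' a left_mem_uIcc).const_add _

theorem mul (hI : I.OrdConnected) (hf : PrimitiveOn I f f') (hg : PrimitiveOn I g g') :
    PrimitiveOn I (fun x => f x * g x) (fun x => f' x * g x + f x * g' x) := by
  intro a ha b hb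
  refine ⟨((hf.intervalIntegrable ha hb).mul_continuousOn (hg.continuousOn_uIcc hI ha hb)).add
    ((hg.intervalIntegrable ha hb).continuousOn_mul (hf.continuousOn_uIcc hI ha hb)), ?_⟩
  obtain ⟨F, hF, hFf, hF'⟩ := hf.exists_absolutelyContinuous hI ha hb
  obtain ⟨G, hG, hGg, hG'⟩ := hg.exists_absolutelyContinuous hI ha hb
  have := hF.integral_deriv_mul_eq_sub hG
  rw [hFf _ left_mem_uIcc, hFf _ right_mem_uIcc, hGg _ left_mem_uIcc, hGg _ right_mem_uIcc] at this
  rw [← this]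
  apply intervalIntegral.integral_congr_ae
  filter_upwards [hF', hG'] with x h1 h2 h3
  have h4 := uIoc_subset_uIcc h3
  rw [(h1 h4).deriv, (h2 h4).deriv, hFf x h4, hGg x h4]

theorem of_hasDerivAt (hI : I.OrdConnected) (h : ∀ x ∈ I, HasDerivAt f (f' x) x)
    (hc : ContinuousOn f' I) : PrimitiveOn I f f' := by
  intro a ha b hb
  have hs := hI.uIcc_subset ha hb
  have hi : IntervalIntegrable f' volume a b := (hc.mono hs).intervalIntegrable
  exact ⟨hi, (intervalIntegral.integral_eq_sub_of_hasDerivAt (fun x hx => h x (hs hx)) hi).symm⟩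

/-- The reciprocal of a positive primitive is a primitive: `1/x` is Lipschitz away from `0`. -/
theorem inv (hI : I.OrdConnected) (hf : PrimitiveOn I f f') (hpos : ∀ x ∈ I, 0 < f x) :
    PrimitiveOn I (fun x => (f x)⁻¹) (fun x => -f' x / f x ^ 2) := by
  intro a ha b hb
  have hs := hI.uIcc_subset ha hb
  have hc := hf.continuousOn_uIcc hI ha hb
  have hne : ∀ x ∈ uIcc a b, f x ^ 2 ≠ 0 := fun x hx => (pow_pos (hpos x (hs hx)) 2).ne'
  refine ⟨?_, ?_⟩
  · simp only [div_eq_mul_inv]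
    exact (hf.neg.intervalIntegrable ha hb).mul_continuousOn ((hc.pow 2).inv₀ hne)
  obtain ⟨F, hF, hFf, hF'⟩ := hf.exists_absolutelyContinuous hI ha hb
  obtain ⟨x₀, hx₀, hmin⟩ := isCompact_uIcc.exists_isMinOn nonempty_uIcc hc
  set m := f x₀ with hm
  have hm0 : 0 < m := hpos _ (hs hx₀)
  have hFm : ∀ x ∈ uIcc a b, m ≤ F x := fun x hx => by rw [hFf x hx]; exact hmin hx
  have hG : AbsolutelyContinuousOnInterval (fun x => (F x)⁻¹) a b := by
    rw [absolutelyContinuousOnInterval_iff] at hF ⊢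
    intro ε hε
    obtain ⟨δ, hδ, h⟩ := hF (ε * m ^ 2) (by positivity)
    refine ⟨δ, hδ, fun E hE hE' => ?_⟩
    have h1 := h E hE hE'
    have h2 : ∑ i ∈ Finset.range E.1, dist (F (E.2 i).1)⁻¹ (F (E.2 i).2)⁻¹ ≤
        ∑ i ∈ Finset.range E.1, dist (F (E.2 i).1) (F (E.2 i).2) / m ^ 2 := by
      refine Finset.sum_le_sum fun i hi => ?_
      have p := hFm _ (hE.1 i hi).1
      have q := hFm _ (hE.1 i hi).2
      have p0 := hm0.trans_le p
      have q0 := hm0.trans_le q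
      rw [Real.dist_eq, Real.dist_eq, inv_sub_inv p0.ne' q0.ne', abs_div,
        abs_of_pos (mul_pos p0 q0), abs_sub_comm]
      refine div_le_div_of_nonneg_left (abs_nonneg _) (by positivity) ?_
      rw [sq]; exact mul_le_mul p q hm0.le p0.le
    refine h2.trans_lt ?_
    rw [← Finset.sum_div, div_lt_iff₀ (by positivity)]
    exact h1
  have := hG.integral_deriv_eq_sub
  rw [hFf _ left_mem_uIcc, hFf _ right_mem_uIcc] at this
  rw [← this]
  apply intervalIntegral.integral_congr_ae
  filter_upwards [hF'] with x h1 h3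
  have h4 := uIoc_subset_uIcc h3
  have h5 : HasDerivAt (fun x => (F x)⁻¹) (-f' x / F x ^ 2) x :=
    (h1 h4).inv (hm0.trans_le (hFm x h4)).ne'
  rw [h5.deriv, hFf x h4]

end PrimitiveOn

/-! ### Weak derivatives on an interval -/

theorem HasWeakDirDeriv.congr {E : Type*} [NormedAddCommGroup E] [NormedSpace ℝ E]
    [MeasureSpace E] {Ω : Set E} {v : E} {f g f₂ g₂ : E → ℝ}
    (h : HasWeakDirDeriv Ω v f g) (hf : f =ᵐ[volume.restrict Ω] f₂)
    (hg : g =ᵐ[volume.restrict Ω] g₂) : HasWeakDirDeriv Ω v f₂ g₂ := by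
  refine ⟨?_, ?_, fun φ h1 h2 h3 => ?_⟩
  · intro x hx
    obtain ⟨s, hs, hi⟩ := h.1 x hx
    refine ⟨s ∩ Ω, Filter.inter_mem hs self_mem_nhdsWithin, ?_⟩
    refine (hi.mono_set inter_subset_left).congr ?_
    exact ae_restrict_of_ae_restrict_of_subset inter_subset_right hf
  · intro x hx
    obtain ⟨s, hs, hi⟩ := h.2.1 x hx
    refine ⟨s ∩ Ω, Filter.inter_mem hs self_mem_nhdsWithin, ?_⟩
    refine (hi.mono_set inter_subset_left).congr ?_
    exact ae_restrict_of_ae_restrict_of_subset inter_subset_right hg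
  · have e1 : ∫ x in Ω, f₂ x * fderiv ℝ φ x v = ∫ x in Ω, f x * fderiv ℝ φ x v :=
      integral_congr_ae (by filter_upwards [hf] with x hx; rw [hx])
    have e2 : ∫ x in Ω, g₂ x * φ x = ∫ x in Ω, g x * φ x :=
      integral_congr_ae (by filter_upwards [hg] with x hx; rw [hx])
    rw [e1, e2]; exact h.2.2 φ h1 h2 h3

/-- A continuous function supported in `Ω` turns a locally integrable function on `Ω` into an
integrable one. -/
theorem LocallyIntegrableOn.integrableOn_mul_of_tsupport {E : Type*} [NormedAddCommGroup E]
    [MeasurableSpace E] [OpensMeasurableSpace E] {μ : Measure E} {Ω : Set E}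
    {f φ : E → ℝ} (hf : LocallyIntegrableOn f Ω μ)
    (hφ : Continuous φ) (hc : HasCompactSupport φ) (hs : tsupport φ ⊆ Ω) :
    IntegrableOn (fun x => f x * φ x) Ω μ := by
  have hK : IsCompact (tsupport φ) := hc
  have h1 : IntegrableOn (fun x => f x * φ x) (tsupport φ) μ :=
    (hf.integrableOn_compact_subset hs hK).mul_continuousOn hφ.continuousOn hK
  refine (integrableOn_iff_integrable_of_support_subset (s := tsupport φ) ?_).1 h1 |>.integrableOn
  intro x hx
  apply subset_tsupport
  intro h0
  exact hx (by simp [h0])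

theorem exists_Icc_of_tsupport_subset_Ioo {φ : ℝ → ℝ} (hc : HasCompactSupport φ)
    (hs : tsupport φ ⊆ Ioo 0 1) : ∃ s, 0 < s ∧ s < 1 ∧ tsupport φ ⊆ Icc s (1 - s) := by
  have hK : IsCompact (tsupport φ) := hc
  rcases (tsupport φ).eq_empty_or_nonempty with h | h
  · exact ⟨1 / 2, by norm_num, by norm_num, by simp [h]⟩
  · obtain ⟨x, hx, hx'⟩ := hK.exists_isLeast h
    obtain ⟨y, hy, hy'⟩ := hK.exists_isGreatest h
    have h1 := hs hx
    have h2 := hs hy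
    refine ⟨min x (1 - y), lt_min h1.1 (by linarith [h2.2]), (min_le_left _ _).trans_lt h1.2,
      fun z hz => ⟨(min_le_left _ _).trans (hx' hz), ?_⟩⟩
    have := hy' hz
    have := min_le_right x (1 - y)
    linarith

theorem setIntegral_Ioo_eq_of_support {F : ℝ → ℝ} {a b c d : ℝ} (hac : a ≤ c) (hcd : c ≤ d)
    (hdb : d < b) (h : ∀ x ∈ Ioo a b, x ∉ Ioc c d → F x = 0) :
    ∫ x in Ioo a b, F x = ∫ x in c..d, F x := by
  rw [intervalIntegral.integral_of_le hcd]
  exact setIntegral_eq_of_subset_of_forall_sdiff_eq_zero measurableSet_Ioo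
    (fun x hx => ⟨hac.trans_lt hx.1, hx.2.trans_lt hdb⟩) (fun x hx => h x hx.1 hx.2)

theorem PrimitiveOn.locallyIntegrableOn {f g : ℝ → ℝ} (hf : PrimitiveOn (Ioc 0 1) f g) :
    LocallyIntegrableOn g (Ioo 0 1) := by
  intro x hx
  refine ⟨Ioc (x / 2) 1 ∩ Ioo 0 1, Filter.inter_mem (mem_nhdsWithin_of_mem_nhds ?_)
    self_mem_nhdsWithin, ?_⟩
  · exact Filter.mem_of_superset (Ioo_mem_nhds (by linarith [hx.1]) hx.2) Ioo_subset_Ioc_self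
  · exact (hf.intervalIntegrable (a := x / 2) (b := 1) ⟨by linarith [hx.1], by linarith
      [hx.1, hx.2]⟩ ⟨one_pos, le_rfl⟩).1.mono_set inter_subset_left

theorem PrimitiveOn.hasWeakDirDeriv {f g : ℝ → ℝ} (hf : PrimitiveOn (Ioc 0 1) f g) :
    HasWeakDirDeriv (Ioo (0 : ℝ) 1) 1 f g := by
  refine ⟨((hf.continuousOn_Ioc).mono Ioo_subset_Ioc_self).locallyIntegrableOn measurableSet_Ioo,
    hf.locallyIntegrableOn, fun φ h1 h2 h3 => ?_⟩
  obtain ⟨s, hs0, hs1, hs⟩ := exists_Icc_of_tsupport_subset_Ioo h2 h3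
  have hsmall : ∀ x, x ∉ Icc s (1 - s) → φ x = 0 ∧ fderiv ℝ φ x = 0 := fun x hx =>
    ⟨image_eq_zero_of_notMem_tsupport (fun h => hx (hs h)),
      image_eq_zero_of_notMem_tsupport (fun h => hx (hs (tsupport_fderiv_subset ℝ h)))⟩
  have hd : ∀ x, HasDerivAt φ (fderiv ℝ φ x 1) x := fun x => by
    simpa using (h1.differentiable (by simp) x).hasDerivAt
  have hφ : PrimitiveOn univ φ (fun x => fderiv ℝ φ x 1) :=
    PrimitiveOn.of_hasDerivAt ordConnected_univ (fun x _ => hd x)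
      ((h1.continuous_fderiv (by simp)).clm_apply continuous_const).continuousOn
  have hm1 : s / 2 ∈ Ioc (0 : ℝ) 1 := ⟨by linarith, by linarith⟩
  have hm2 : 1 - s / 2 ∈ Ioc (0 : ℝ) 1 := ⟨by linarith, by linarith⟩
  have hp := hf.mul ordConnected_Ioc (hφ.mono (subset_univ _))
  have key := hp.integral_eq hm1 hm2
  have z1 : φ (s / 2) = 0 := (hsmall _ (fun h => by linarith [h.1])).1
  have z2 : φ (1 - s / 2) = 0 := (hsmall _ (fun h => by linarith [h.2])).1
  rw [z1, z2, intervalIntegral.integral_add] at key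
  · rw [setIntegral_Ioo_eq_of_support (c := s / 2) (d := 1 - s / 2) (by linarith) (by linarith)
      (by linarith),
      setIntegral_Ioo_eq_of_support (c := s / 2) (d := 1 - s / 2) (by linarith) (by linarith)
        (by linarith)]
    · linarith
    · intro x _ hx
      rw [(hsmall x (fun h => hx ⟨by linarith [h.1], by linarith [h.2]⟩)).1, mul_zero]
    · intro x _ hx
      rw [(hsmall x (fun h => hx ⟨by linarith [h.1], by linarith [h.2]⟩)).2]; simp
  · exact (hf.intervalIntegrable hm1 hm2).mul_continuousOn h1.continuous.continuousOn
  · exact (hφ.intervalIntegrable (mem_univ _) (mem_univ _)).continuousOn_mul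
      (hf.continuousOn_uIcc ordConnected_Ioc hm1 hm2)

theorem HasWeakDirDeriv.ae_eq {f g₁ g₂ : ℝ → ℝ} (h₁ : HasWeakDirDeriv (Ioo (0 : ℝ) 1) 1 f g₁)
    (h₂ : HasWeakDirDeriv (Ioo (0 : ℝ) 1) 1 f g₂) : g₁ =ᵐ[volume.restrict (Ioo 0 1)] g₂ := by
  have key : ∀ᵐ x, x ∈ Ioo (0 : ℝ) 1 → (g₁ - g₂) x = 0 := by
    refine IsOpen.ae_eq_zero_of_integral_contDiff_smul_eq_zero isOpen_Ioo (h₁.2.1.sub h₂.2.1) ?_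
    intro φ a b c
    have e1 := h₁.2.2 φ a b c
    have e2 := h₂.2.2 φ a b c
    have e3 : ∫ x, φ x • (g₁ - g₂) x = ∫ x in Ioo 0 1, (g₁ x * φ x - g₂ x * φ x) := by
      rw [← setIntegral_eq_integral_of_forall_compl_eq_zero (s := Ioo (0 : ℝ) 1)]
      · congr 1; ext x; simp; ring
      · intro x hx
        rw [image_eq_zero_of_notMem_tsupport (fun h => hx (c h)), zero_smul]
    rw [e3, integral_sub
      (LocallyIntegrableOn.integrableOn_mul_of_tsupport h₁.2.1 a.continuous b c)
      (LocallyIntegrableOn.integrableOn_mul_of_tsupport h₂.2.1 a.continuous b c)]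
    linarith
  rw [Filter.EventuallyEq, ae_restrict_iff' measurableSet_Ioo]
  filter_upwards [key] with x hx hx'
  have := hx hx'
  simpa [sub_eq_zero] using this

theorem weakDeriv_ae_eq {f g : ℝ → ℝ} (h : HasWeakDirDeriv (Ioo (0 : ℝ) 1) 1 f g) :
    weakDeriv f =ᵐ[volume.restrict (Ioo 0 1)] g := by
  have hex : ∃ g : ℝ → ℝ, HasWeakDirDeriv (Ioo (0 : ℝ) 1) 1 f g := ⟨g, h⟩
  rw [weakDeriv, dif_pos hex]
  exact hex.choose_spec.ae_eq h

/-- The primitive of a test function of mean zero is again a test function. -/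
theorem exists_primitive_test {θ : ℝ → ℝ} (h1 : ContDiff ℝ ∞ θ) (h2 : HasCompactSupport θ)
    (h3 : tsupport θ ⊆ Ioo 0 1) (h0 : ∫ x in Ioo (0 : ℝ) 1, θ x = 0) :
    ∃ χ : ℝ → ℝ, ContDiff ℝ ∞ χ ∧ HasCompactSupport χ ∧ tsupport χ ⊆ Ioo 0 1 ∧
      ∀ x, fderiv ℝ χ x 1 = θ x := by
  obtain ⟨s, hs0, hs1, hs⟩ := exists_Icc_of_tsupport_subset_Ioo h2 h3
  have hsmall : ∀ x, x ∉ Icc s (1 - s) → θ x = 0 := fun x hx =>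
    image_eq_zero_of_notMem_tsupport (fun h => hx (hs h))
  set χ : ℝ → ℝ := fun x => ∫ t in (0 : ℝ)..x, θ t with hχ
  have hd : ∀ x, HasDerivAt χ (θ x) x := fun x =>
    h1.continuous.integral_hasStrictDerivAt 0 x |>.hasDerivAt
  have hd' : deriv χ = θ := funext fun x => (hd x).deriv
  have hint : ∀ a b, IntervalIntegrable θ volume a b := fun a b =>
    h1.continuous.intervalIntegrable a b
  have hsupp : Function.support χ ⊆ Icc s (1 - s) := by
    intro x hx
    by_contra hcon
    apply hx
    rw [mem_Icc, not_and_or, not_le, not_le] at hcon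
    rcases hcon with h | h
    · rw [hχ]
      simp only
      rw [intervalIntegral.integral_congr (g := fun _ => 0)]
      · simp
      · intro y hy
        refine hsmall y fun hy' => ?_
        have := (mem_uIcc.1 hy)
        rcases this with h' | h' <;> linarith [h'.1, h'.2, hy'.1]
    · have e1 : ∫ t in (0 : ℝ)..1, θ t = 0 := by
        rw [intervalIntegral.integral_of_le zero_le_one, integral_Ioc_eq_integral_Ioo, h0]
      have e2 : ∫ t in x..1, θ t = 0 := by
        rw [intervalIntegral.integral_congr (g := fun _ => 0)]
        · simp
        · intro y hy
          refine hsmall y fun hy' => ?_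
          have := (mem_uIcc.1 hy)
          rcases this with h' | h' <;> linarith [h'.1, h'.2, hy'.2]
      have := intervalIntegral.integral_add_adjacent_intervals (hint 0 x) (hint x 1)
      rw [e1, e2, add_zero] at this
      exact this
  have hts : tsupport χ ⊆ Icc s (1 - s) := closure_minimal hsupp isClosed_Icc
  refine ⟨χ, ?_, HasCompactSupport.of_support_subset_isCompact isCompact_Icc hsupp, ?_, ?_⟩
  · rw [contDiff_infty_iff_deriv, hd']
    exact ⟨fun x => (hd x).differentiableAt, h1⟩
  · exact hts.trans fun x hx => ⟨by linarith [hx.1], by linarith [hx.2]⟩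
  · intro x
    rw [fderiv_apply_one_eq_deriv, (hd x).deriv]

/-- The lemma of du Bois-Reymond: a function with vanishing weak derivative is constant. -/
theorem HasWeakDirDeriv.ae_eq_const {d : ℝ → ℝ}
    (h : HasWeakDirDeriv (Ioo (0 : ℝ) 1) 1 d (fun _ => 0)) :
    ∃ c, d =ᵐ[volume.restrict (Ioo 0 1)] fun _ => c := by
  let B : ContDiffBump (1 / 2 : ℝ) := ⟨1 / 8, 1 / 4, by norm_num, by norm_num⟩
  set ρ : ℝ → ℝ := B.normed volume with hρ
  have r1 : ContDiff ℝ ∞ ρ := B.contDiff_normed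
  have r2 : HasCompactSupport ρ := B.hasCompactSupport_normed
  have r3 : tsupport ρ ⊆ Ioo 0 1 := by
    rw [hρ, B.tsupport_normed_eq]
    intro x hx
    have : |x - 1 / 2| ≤ 1 / 4 := by rwa [← Real.dist_eq]
    rw [abs_le] at this
    exact ⟨by linarith, by linarith⟩
  have hzero : ∀ {φ : ℝ → ℝ}, tsupport φ ⊆ Ioo 0 1 → ∀ x, x ∉ Ioo (0 : ℝ) 1 → φ x = 0 :=
    fun hs x hx => image_eq_zero_of_notMem_tsupport fun h => hx (hs h)
  have r4 : ∫ x in Ioo (0 : ℝ) 1, ρ x = 1 := by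
    rw [setIntegral_eq_integral_of_forall_compl_eq_zero (fun x hx => hzero r3 x hx)]
    exact B.integral_normed
  set c := ∫ x in Ioo (0 : ℝ) 1, d x * ρ x with hc
  refine ⟨c, ?_⟩
  have key : ∀ᵐ x, x ∈ Ioo (0 : ℝ) 1 → (d x - c) = 0 := by
    refine IsOpen.ae_eq_zero_of_integral_contDiff_smul_eq_zero isOpen_Ioo
      (h.1.sub (continuous_const.locallyIntegrable.locallyIntegrableOn _)) ?_
    intro ψ a1 a2 a3
    set m := ∫ x in Ioo (0 : ℝ) 1, ψ x with hm
    have iψ : IntegrableOn ψ (Ioo (0 : ℝ) 1) :=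
      (a1.continuous.integrable_of_hasCompactSupport a2).integrableOn
    have iρ : IntegrableOn ρ (Ioo (0 : ℝ) 1) :=
      (r1.continuous.integrable_of_hasCompactSupport r2).integrableOn
    have b2 : HasCompactSupport (fun x => ψ x - m * ρ x) := by
      have : (fun x => ψ x - m * ρ x) = ψ - (fun x => m * ρ x) := rfl
      rw [this]
      exact a2.sub (r2.mul_left (f := fun _ => m))
    have b3 : tsupport (fun x => ψ x - m * ρ x) ⊆ Ioo 0 1 :=
      (tsupport_sub ψ (fun x => m * ρ x)).trans
        (union_subset a3 ((tsupport_mul_subset_right (f := fun _ => m)).trans r3))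
    obtain ⟨χ, c1, c2, c3, c4⟩ := exists_primitive_test (θ := fun x => ψ x - m * ρ x)
      (a1.sub (contDiff_const.mul r1)) b2 b3 (by
        rw [integral_sub iψ (iρ.const_mul m), integral_const_mul, r4, ← hm]; ring)
    have e := h.2.2 χ c1 c2 c3
    simp only [c4, zero_mul, integral_zero, neg_zero] at e
    have j1 := LocallyIntegrableOn.integrableOn_mul_of_tsupport h.1 a1.continuous a2 a3
    have j2 := LocallyIntegrableOn.integrableOn_mul_of_tsupport h.1 r1.continuous r2 r3
    have e2 : ∫ x in Ioo (0 : ℝ) 1, d x * (ψ x - m * ρ x) =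
        ∫ x in Ioo (0 : ℝ) 1, (d x * ψ x - m * (d x * ρ x)) := by
      congr 1; ext x; ring
    rw [e2, integral_sub j1 (j2.const_mul m), integral_const_mul, ← hc] at e
    have e3 : ∫ x, ψ x • (d x - c) = ∫ x in Ioo 0 1, (d x * ψ x - c * ψ x) := by
      rw [← setIntegral_eq_integral_of_forall_compl_eq_zero (s := Ioo (0 : ℝ) 1)]
      · congr 1; ext x; simp; ring
      · intro x hx
        rw [hzero a3 x hx, zero_smul]
    rw [e3, integral_sub j1 (iψ.const_mul c), integral_const_mul, ← hm]
    linarith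
  rw [Filter.EventuallyEq, ae_restrict_iff' measurableSet_Ioo]
  filter_upwards [key] with x hx hx'
  have := hx hx'
  simpa [sub_eq_zero] using this

theorem HasWeakDirDeriv.add {f g f₂ g₂ : ℝ → ℝ} (h : HasWeakDirDeriv (Ioo (0 : ℝ) 1) 1 f g)
    (h₂ : HasWeakDirDeriv (Ioo (0 : ℝ) 1) 1 f₂ g₂) :
    HasWeakDirDeriv (Ioo (0 : ℝ) 1) 1 (fun x => f x + f₂ x) (fun x => g x + g₂ x) := by
  refine ⟨h.1.add h₂.1, h.2.1.add h₂.2.1, fun φ a1 a2 a3 => ?_⟩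
  have hcd : Continuous (fun x => fderiv ℝ φ x 1) :=
    (a1.continuous_fderiv (by simp)).clm_apply continuous_const
  have hcs : HasCompactSupport (fun x => fderiv ℝ φ x 1) := a2.fderiv_apply ℝ 1
  have hts : tsupport (fun x => fderiv ℝ φ x 1) ⊆ Ioo 0 1 :=
    (tsupport_fderiv_apply_subset ℝ 1).trans a3
  simp only [add_mul]
  rw [integral_add (LocallyIntegrableOn.integrableOn_mul_of_tsupport h.1 hcd hcs hts)
    (LocallyIntegrableOn.integrableOn_mul_of_tsupport h₂.1 hcd hcs hts),
    integral_add (LocallyIntegrableOn.integrableOn_mul_of_tsupport h.2.1 a1.continuous a2 a3)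
    (LocallyIntegrableOn.integrableOn_mul_of_tsupport h₂.2.1 a1.continuous a2 a3),
    h.2.2 φ a1 a2 a3, h₂.2.2 φ a1 a2 a3]
  ring

theorem HasWeakDirDeriv.const_mul {f g : ℝ → ℝ} (h : HasWeakDirDeriv (Ioo (0 : ℝ) 1) 1 f g)
    (c : ℝ) : HasWeakDirDeriv (Ioo (0 : ℝ) 1) 1 (fun x => c * f x) (fun x => c * g x) := by
  refine ⟨h.1.smul c, h.2.1.smul c, fun φ a1 a2 a3 => ?_⟩
  simp only [mul_assoc, integral_const_mul]
  rw [h.2.2 φ a1 a2 a3]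
  ring

theorem HasWeakDirDeriv.sub {f g f₂ g₂ : ℝ → ℝ} (h : HasWeakDirDeriv (Ioo (0 : ℝ) 1) 1 f g)
    (h₂ : HasWeakDirDeriv (Ioo (0 : ℝ) 1) 1 f₂ g₂) :
    HasWeakDirDeriv (Ioo (0 : ℝ) 1) 1 (fun x => f x - f₂ x) (fun x => g x - g₂ x) := by
  simpa [sub_eq_add_neg] using h.add (h₂.const_mul (-1))

/-- A weakly differentiable function on `(0,1)` whose derivative is integrable away from `0` agrees
almost everywhere with a primitive of its derivative on `(0,1]`. -/
theorem HasWeakDirDeriv.exists_primitiveOn {f g : ℝ → ℝ}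
    (h : HasWeakDirDeriv (Ioo (0 : ℝ) 1) 1 f g)
    (hg : ∀ a ∈ Ioc (0 : ℝ) 1, IntervalIntegrable g volume a 1) :
    ∃ F : ℝ → ℝ, PrimitiveOn (Ioc 0 1) F g ∧ f =ᵐ[volume.restrict (Ioo 0 1)] F := by
  have hp : ∀ C, PrimitiveOn (Ioc 0 1) (fun x => C - ∫ s in x..1, g s) g := by
    intro C a ha b hb
    have hab := (hg a ha).trans (hg b hb).symm
    refine ⟨hab, ?_⟩
    have := intervalIntegral.integral_add_adjacent_intervals hab (hg b hb)
    linarith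
  have h0 := h.sub (hp 0).hasWeakDirDeriv
  simp only [sub_self] at h0
  obtain ⟨c, hc⟩ := h0.ae_eq_const
  refine ⟨_, hp c, ?_⟩
  filter_upwards [hc] with x hx
  linarith

/-! ### Polar coordinates -/

/-- Polar coordinates in the Euclidean plane, as a map of `(r, t)`. -/
noncomputable def polarMap (q : ℝ × ℝ) : Plane := !₂[q.1 * Real.cos q.2, q.1 * Real.sin q.2]

/-- Lebesgue measure `dr dt` on the coordinate rectangle of the unit disc, without the Jacobian. -/
noncomputable def rectMeasure : Measure (ℝ × ℝ) :=
  (volume.restrict (Ioo 0 1)).prod (volume.restrict (Ioo (-Real.pi) Real.pi))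

theorem rectMeasure_eq_restrict :
    rectMeasure = volume.restrict (Ioo (0 : ℝ) 1 ×ˢ Ioo (-Real.pi) Real.pi) := by
  rw [rectMeasure, Measure.prod_restrict]; rfl

theorem continuous_polarMap : Continuous polarMap := by
  unfold polarMap
  refine (PiLp.continuous_toLp 2 _).comp ?_
  refine continuous_pi fun i => ?_
  fin_cases i <;> simp <;> fun_prop

@[simp] theorem polarMap_zero (q : ℝ × ℝ) : polarMap q 0 = q.1 * Real.cos q.2 := by simp [polarMap]
@[simp] theorem polarMap_one (q : ℝ × ℝ) : polarMap q 1 = q.1 * Real.sin q.2 := by simp [polarMap]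

theorem norm_polarMap {q : ℝ × ℝ} (hq : 0 ≤ q.1) : ‖polarMap q‖ = q.1 := by
  rw [EuclideanSpace.norm_eq]
  simp only [Fin.sum_univ_two, polarMap_zero, polarMap_one, Real.norm_eq_abs, sq_abs]
  rw [show (q.1 * Real.cos q.2) ^ 2 + (q.1 * Real.sin q.2) ^ 2
    = q.1 ^ 2 * (Real.cos q.2 ^ 2 + Real.sin q.2 ^ 2) by ring, Real.cos_sq_add_sin_sq, mul_one,
    Real.sqrt_sq hq]

theorem lintegral_plane (F : Plane → ℝ≥0∞) :
    ∫⁻ x, F x = ∫⁻ q in polarCoord.target, ENNReal.ofReal q.1 * F (polarMap q) := by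
  have h1 := (EuclideanSpace.volume_preserving_symm_measurableEquiv_toLp (Fin 2)).symm
  have h2 := (MeasureTheory.volume_preserving_finTwoArrow ℝ).symm
  rw [← h1.lintegral_comp_emb (MeasurableEquiv.measurableEmbedding _),
    ← h2.lintegral_comp_emb (MeasurableEquiv.measurableEmbedding _),
    ← lintegral_comp_polarCoord_symm]
  refine lintegral_congr fun q => ?_
  rw [smul_eq_mul]
  congr 2

theorem map_polarMap : (rectMeasure.withDensity (fun q => ENNReal.ofReal q.1)).map polarMap =
    volume.restrict unitDisc := by
  ext s hs
  have hd : MeasurableSet unitDisc := measurableSet_ball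
  have hm := continuous_polarMap.measurable
  rw [Measure.map_apply hm hs, withDensity_apply _ (hm hs), Measure.restrict_apply hs,
    ← lintegral_indicator_one (hs.inter hd), lintegral_plane, rectMeasure_eq_restrict,
    Measure.restrict_restrict (hm hs),
    ← lintegral_indicator ((hm hs).inter (measurableSet_Ioo.prod measurableSet_Ioo)),
    ← lintegral_indicator (polarCoord.open_target.measurableSet)]
  refine lintegral_congr fun q => ?_
  by_cases h1 : q ∈ polarCoord.target
  · have hq : 0 < q.1 ∧ -Real.pi < q.2 ∧ q.2 < Real.pi := by
      simpa [polarCoord] using h1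
    rw [indicator_of_mem h1]
    by_cases h2 : polarMap q ∈ s ∩ unitDisc
    · have h3 : q.1 < 1 := by
        have := h2.2
        rwa [unitDisc, mem_ball_zero_iff, norm_polarMap hq.1.le] at this
      have h4 : q ∈ polarMap ⁻¹' s ∩ Ioo (0 : ℝ) 1 ×ˢ Ioo (-Real.pi) Real.pi :=
        ⟨h2.1, ⟨hq.1, h3⟩, hq.2⟩
      rw [indicator_of_mem (s := s ∩ unitDisc) h2, indicator_of_mem h4]
      simp
    · rw [indicator_of_notMem (s := s ∩ unitDisc) h2, indicator_of_notMem, mul_zero]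
      rintro ⟨h3, h4, -⟩
      refine h2 ⟨h3, ?_⟩
      rw [unitDisc, mem_ball_zero_iff, norm_polarMap hq.1.le]
      exact h4.2
  · rw [indicator_of_notMem h1, indicator_of_notMem]
    rintro ⟨-, h3, h4⟩
    apply h1
    simpa [polarCoord] using And.intro h3.1 h4

theorem rectMeasure_absolutelyContinuous :
    rectMeasure ≪ rectMeasure.withDensity (fun q => ENNReal.ofReal q.1) := by
  refine withDensity_absolutelyContinuous' (by fun_prop) ?_
  rw [rectMeasure_eq_restrict]
  filter_upwards [ae_restrict_mem (measurableSet_Ioo.prod measurableSet_Ioo)] with q hq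
  simpa using hq.1.1

theorem quasiMeasurePreserving_polarMap :
    Measure.QuasiMeasurePreserving polarMap rectMeasure (volume.restrict unitDisc) := by
  refine ⟨continuous_polarMap.measurable, ?_⟩
  rw [← map_polarMap]
  exact rectMeasure_absolutelyContinuous.map continuous_polarMap.measurable

theorem ae_rect_mem : ∀ᵐ q ∂rectMeasure, q.1 ∈ Ioo (0 : ℝ) 1 := by
  rw [rectMeasure_eq_restrict]
  filter_upwards [ae_restrict_mem (measurableSet_Ioo.prod measurableSet_Ioo)] with q hq
  exact hq.1

theorem integrable_unitDisc_iff {F : Plane → ℝ}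
    (hF : AEStronglyMeasurable F (volume.restrict unitDisc)) :
    IntegrableOn F unitDisc ↔ Integrable (fun q => q.1 * F (polarMap q)) rectMeasure := by
  rw [IntegrableOn, ← map_polarMap, integrable_map_measure (by rwa [map_polarMap])
    continuous_polarMap.aemeasurable,
    integrable_withDensity_iff_integrable_smul' (by fun_prop)
      (Filter.Eventually.of_forall fun q => ENNReal.ofReal_lt_top)]
  refine integrable_congr ?_
  filter_upwards [ae_rect_mem] with q hq
  simp [ENNReal.toReal_ofReal hq.1.le]

theorem integral_unitDisc {F : Plane → ℝ}
    (hF : AEStronglyMeasurable F (volume.restrict unitDisc)) :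
    ∫ x in unitDisc, F x = ∫ q, q.1 * F (polarMap q) ∂rectMeasure := by
  rw [← map_polarMap, integral_map continuous_polarMap.aemeasurable (by rwa [map_polarMap]),
    integral_withDensity_eq_integral_toReal_smul (by fun_prop)
      (Filter.Eventually.of_forall fun q => ENNReal.ofReal_lt_top)]
  refine integral_congr_ae ?_
  filter_upwards [ae_rect_mem] with q hq
  simp [ENNReal.toReal_ofReal hq.1.le]

/-! ### Weak derivatives on the disc and angular averages -/

/-- The components `cos t`, `sin t` of the unit vector at angle `t`. -/
noncomputable def dirComp (k : Fin 2) (t : ℝ) : ℝ := ![Real.cos t, Real.sin t] k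

@[simp] theorem dirComp_zero (t : ℝ) : dirComp 0 t = Real.cos t := rfl
@[simp] theorem dirComp_one (t : ℝ) : dirComp 1 t = Real.sin t := rfl

theorem polarMap_apply (q : ℝ × ℝ) (k : Fin 2) : polarMap q k = q.1 * dirComp k q.2 := by
  fin_cases k <;> simp [polarMap]

theorem abs_dirComp_le (k : Fin 2) (t : ℝ) : |dirComp k t| ≤ 1 := by
  fin_cases k
  · exact Real.abs_cos_le_one t
  · exact Real.abs_sin_le_one t

theorem contDiff_dirComp (k : Fin 2) : ContDiff ℝ ∞ (dirComp k) := by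
  fin_cases k
  · exact Real.contDiff_cos
  · exact Real.contDiff_sin

theorem locallyIntegrableOn_of_mul_id {m : ℝ → ℝ}
    (h : IntegrableOn (fun r => r * m r) (Ioo 0 1)) : LocallyIntegrableOn m (Ioo 0 1) := by
  have h1 : LocallyIntegrableOn (fun r => r⁻¹ * (r * m r)) (Ioo (0 : ℝ) 1) :=
    h.locallyIntegrableOn.continuousOn_mul
      (continuousOn_id.inv₀ fun x hx => hx.1.ne') isOpen_Ioo.isLocallyClosed
  intro x hx
  obtain ⟨s, hs, hi⟩ := h1 x hx
  refine ⟨s ∩ Ioo 0 1, Filter.inter_mem hs self_mem_nhdsWithin, ?_⟩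
  refine (hi.mono_set inter_subset_left).congr ?_
  refine ae_restrict_of_ae_restrict_of_subset inter_subset_right ?_
  filter_upwards [ae_restrict_mem measurableSet_Ioo] with r hr
  field_simp [hr.1.ne']

theorem intervalIntegrable_of_mul_id {m : ℝ → ℝ}
    (h : IntegrableOn (fun r => r * m r) (Ioo 0 1)) {a : ℝ} (ha : a ∈ Ioc (0 : ℝ) 1) :
    IntervalIntegrable m volume a 1 := by
  have h0 : IntegrableOn (fun r => r * m r) (Ioc a 1) :=
    ((integrableOn_Ioc_iff_integrableOn_Ioo (by simp)).2 h).mono_set (Ioc_subset_Ioc_left ha.1.le)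
  have h1 : IntervalIntegrable (fun r => r * m r) volume a 1 :=
    (intervalIntegrable_iff_integrableOn_Ioc_of_le ha.2).2 h0
  have hpos : ∀ x ∈ uIcc a 1, 0 < x := fun x hx => by
    rw [uIcc_of_le ha.2] at hx; exact ha.1.trans_le hx.1
  have h2 := h1.continuousOn_mul (g := fun r => r⁻¹)
    (continuousOn_id.inv₀ fun x hx => (hpos x hx).ne')
  refine h2.congr fun x hx => ?_
  have := hpos x (uIoc_subset_uIcc hx)
  field_simp

theorem radial_eventually_zero {χ : ℝ → ℝ} (h2 : HasCompactSupport χ)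
    (h3 : tsupport χ ⊆ Ioo 0 1) : ∀ᶠ x : Plane in nhds 0, χ ‖x‖ = 0 := by
  obtain ⟨s, hs0, hs1, hs⟩ := exists_Icc_of_tsupport_subset_Ioo h2 h3
  filter_upwards [Metric.ball_mem_nhds (0 : Plane) hs0] with x hx
  have : ‖x‖ < s := by simpa using hx
  exact image_eq_zero_of_notMem_tsupport (fun h => by linarith [(hs h).1])

theorem contDiff_radial {χ : ℝ → ℝ} (h1 : ContDiff ℝ ∞ χ) (h2 : HasCompactSupport χ)
    (h3 : tsupport χ ⊆ Ioo 0 1) : ContDiff ℝ ∞ (fun x : Plane => χ ‖x‖) := by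
  rw [contDiff_iff_contDiffAt]
  intro x
  rcases eq_or_ne x 0 with rfl | hx
  · refine (contDiffAt_const (c := (0 : ℝ))).congr_of_eventuallyEq ?_
    exact radial_eventually_zero h2 h3
  · exact h1.contDiffAt.comp x (contDiffAt_norm ℝ hx)

theorem tsupport_radial {χ : ℝ → ℝ} (h2 : HasCompactSupport χ) (h3 : tsupport χ ⊆ Ioo 0 1) :
    HasCompactSupport (fun x : Plane => χ ‖x‖) ∧
    tsupport (fun x : Plane => χ ‖x‖) ⊆ unitDisc := by
  obtain ⟨s, hs0, hs1, hs⟩ := exists_Icc_of_tsupport_subset_Ioo h2 h3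
  have hsupp : Function.support (fun x : Plane => χ ‖x‖) ⊆ Metric.closedBall 0 (1 - s) := by
    intro x hx
    have : ‖x‖ ∈ tsupport χ := subset_tsupport _ hx
    simpa using (hs this).2
  refine ⟨HasCompactSupport.of_support_subset_isCompact (isCompact_closedBall 0 (1 - s)) hsupp,
    (closure_minimal hsupp Metric.isClosed_closedBall).trans ?_⟩
  exact Metric.closedBall_subset_ball (by linarith)

theorem fderiv_radial {χ : ℝ → ℝ} (h1 : ContDiff ℝ ∞ χ) {x : Plane} (hx : x ≠ 0) (v : Plane) :
    HasFDerivAt (fun x : Plane => χ ‖x‖) (deriv χ ‖x‖ • fderiv ℝ (fun x : Plane => ‖x‖) x) x ∧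
    fderiv ℝ (fun x : Plane => ‖x‖) x v = inner ℝ x v / ‖x‖ := by
  have hn : DifferentiableAt ℝ (fun x : Plane => ‖x‖) x :=
    (contDiffAt_norm ℝ hx (n := 1)).differentiableAt (by simp)
  refine ⟨?_, ?_⟩
  · exact ((h1.differentiable (by simp)) ‖x‖).hasDerivAt.comp_hasFDerivAt x hn.hasFDerivAt
  · have e1 : HasFDerivAt (fun x : Plane => ‖x‖ ^ 2) (2 • innerSL ℝ x) x :=
      (hasStrictFDerivAt_norm_sq x).hasFDerivAt
    have e2 := hn.hasFDerivAt.pow 2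
    have := congrArg (fun L : Plane →L[ℝ] ℝ => L v) (e1.unique e2)
    have hx' := norm_ne_zero_iff.2 hx
    simp at this
    field_simp
    linarith

/-- The divergence of the vector field `φ(r) a(t) x / r²`, written as `χ(|x|) N(x) x` with `N`
homogeneous of degree `d` and `χ(r) = φ(r) / r^(d+2)`: it is `φ'(r) a(t) / r`. -/
theorem sum_fderiv_radial_field {φ χ : ℝ → ℝ} {N : Plane → ℝ} {a : ℝ → ℝ} {d : ℕ}
    (hχ : ContDiff ℝ ∞ χ) (hχφ : ∀ r, r ^ (d + 2) * χ r = φ r)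
    (hN : ContDiff ℝ ∞ N) (hNd : ∀ x, fderiv ℝ N x x = d * N x)
    (hNa : ∀ q, N (polarMap q) = q.1 ^ d * a q.2) {q : ℝ × ℝ} (hq : 0 < q.1) :
    ∑ k, fderiv ℝ (fun x : Plane => χ ‖x‖ * N x * x k) (polarMap q) (EuclideanSpace.single k 1)
      = deriv φ q.1 * a q.2 / q.1 := by
  have hn := norm_polarMap hq.le
  set x := polarMap q with hx
  have hx0 : x ≠ 0 := norm_ne_zero_iff.1 (by rw [hn]; exact hq.ne')
  have hk : ∀ k : Fin 2, fderiv ℝ (fun x : Plane => χ ‖x‖ * N x * x k) x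
      (EuclideanSpace.single k 1) = deriv χ q.1 / q.1 * N x * (x k * x k)
        + χ q.1 * (x k * fderiv ℝ N x (EuclideanSpace.single k 1)) + χ q.1 * N x := by
    intro k
    have e1 := (fderiv_radial hχ hx0 (EuclideanSpace.single k 1)).1
    have e2 := (hN.differentiable (by simp) x).hasFDerivAt
    have e3 : HasFDerivAt (fun x : Plane => x k) (EuclideanSpace.proj k : Plane →L[ℝ] ℝ) x :=
      (EuclideanSpace.proj k : Plane →L[ℝ] ℝ).hasFDerivAt
    have e4 := (fderiv_radial hχ hx0 (EuclideanSpace.single k 1)).2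
    have e5 : HasFDerivAt (fun x : Plane => χ ‖x‖ * N x * x k) _ x := (e1.mul e2).mul e3
    rw [e5.fderiv]
    simp [e4, hn, EuclideanSpace.inner_single_right]
    ring
  simp only [hk]
  rw [Finset.sum_add_distrib, Finset.sum_add_distrib, ← Finset.mul_sum, ← Finset.mul_sum]
  have s1 : ∑ k, x k * x k = q.1 ^ 2 := by
    rw [← hn, EuclideanSpace.norm_sq_eq]
    simp [sq]
  have s2 : ∑ k, x k * fderiv ℝ N x (EuclideanSpace.single k 1) = d * N x := by
    have hx' : x = ∑ k, x k • EuclideanSpace.single k (1 : ℝ) := by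
      ext i; fin_cases i <;> simp
    rw [← hNd x]
    conv_rhs => rw [hx', map_sum]
    simp only [← hx', map_smul, smul_eq_mul]
  have s3 : deriv φ q.1 = (d + 2 : ℕ) * q.1 ^ (d + 1) * χ q.1 + q.1 ^ (d + 2) * deriv χ q.1 := by
    have e1 : HasDerivAt (fun r => r ^ (d + 2) * χ r)
        ((d + 2 : ℕ) * q.1 ^ (d + 1) * χ q.1 + q.1 ^ (d + 2) * deriv χ q.1) q.1 := by
      have := (hasDerivAt_pow (d + 2) q.1).mul ((hχ.differentiable (by simp)) q.1).hasDerivAt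
      exact this
    have e2 : (fun r => r ^ (d + 2) * χ r) = φ := funext hχφ
    rw [e2] at e1
    exact e1.deriv
  rw [s1, s2, s3, hNa q]
  simp
  field_simp
  ring

theorem exists_div_pow {φ : ℝ → ℝ} (h1 : ContDiff ℝ ∞ φ) (h2 : HasCompactSupport φ)
    (h3 : tsupport φ ⊆ Ioo 0 1) (n : ℕ) : ∃ χ : ℝ → ℝ, ContDiff ℝ ∞ χ ∧ HasCompactSupport χ ∧
      tsupport χ ⊆ Ioo 0 1 ∧ ∀ r, r ^ n * χ r = φ r := by
  have hts : tsupport (fun r => φ r * (r ^ n)⁻¹) ⊆ tsupport φ := tsupport_mul_subset_left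
  have h0 : φ 0 = 0 := image_eq_zero_of_notMem_tsupport fun h => (h3 h).1.ne rfl
  refine ⟨fun r => φ r * (r ^ n)⁻¹, ?_, h2.mul_right, hts.trans h3, fun r => ?_⟩
  · rw [contDiff_iff_contDiffAt]
    intro r
    rcases eq_or_ne r 0 with rfl | hr
    · have : φ =ᶠ[nhds 0] 0 := by
        have : (0 : ℝ) ∈ (tsupport φ)ᶜ := fun h => (h3 h).1.ne rfl
        filter_upwards [(isClosed_tsupport φ).isOpen_compl.mem_nhds this] with x hx
        exact image_eq_zero_of_notMem_tsupport hx
      refine (contDiffAt_const (c := (0 : ℝ))).congr_of_eventuallyEq ?_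
      filter_upwards [this] with x hx
      simp [hx]
    · exact h1.contDiffAt.mul ((contDiffAt_id.pow n).inv (pow_ne_zero n hr))
  · rcases eq_or_ne r 0 with rfl | hr
    · simp [h0]
    · field_simp

/-- Angular averages of a weakly differentiable function on the disc are weakly differentiable in
the radius, with the average of the radial derivative as weak derivative. The weight `a` is the
restriction to the unit circle of a homogeneous smooth function `N`. -/
theorem hasWeakDirDeriv_angularAverage {F : Plane → ℝ} {G : Fin 2 → Plane → ℝ} {N : Plane → ℝ}
    {a : ℝ → ℝ} {d : ℕ} (hF : IntegrableOn F unitDisc) (hG : ∀ k, IntegrableOn (G k) unitDisc)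
    (hw : ∀ k, HasWeakDirDeriv unitDisc (EuclideanSpace.single k 1) F (G k))
    (hN : ContDiff ℝ ∞ N) (hNd : ∀ x, fderiv ℝ N x x = d * N x)
    (hNa : ∀ q, N (polarMap q) = q.1 ^ d * a q.2) (ha : Continuous a) (ha1 : ∀ t, |a t| ≤ 1) :
    HasWeakDirDeriv (Ioo (0 : ℝ) 1) 1
      (fun r => ∫ t in Ioo (-Real.pi) Real.pi, F (polarMap (r, t)) * a t)
      (fun r => ∫ t in Ioo (-Real.pi) Real.pi,
        (∑ k, G k (polarMap (r, t)) * dirComp k t) * a t) ∧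
    IntegrableOn (fun r => r * ∫ t in Ioo (-Real.pi) Real.pi,
        (∑ k, G k (polarMap (r, t)) * dirComp k t) * a t) (Ioo 0 1) := by
  have mul_int : ∀ {H : ℝ × ℝ → ℝ} {b : ℝ → ℝ}, Integrable H rectMeasure → Continuous b →
      (∀ t, |b t| ≤ 1) → Integrable (fun q => H q * b q.2) rectMeasure := fun hH hb hb1 =>
    hH.mul_bdd (c := 1) (hb.comp continuous_snd).aestronglyMeasurable
      (Filter.Eventually.of_forall fun q => by simpa using hb1 q.2)
  have hF2 := (integrable_unitDisc_iff hF.aestronglyMeasurable).1 hF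
  have hG2 := fun k => (integrable_unitDisc_iff (hG k).aestronglyMeasurable).1 (hG k)
  have iF : IntegrableOn (fun r => r * ∫ t in Ioo (-Real.pi) Real.pi,
      F (polarMap (r, t)) * a t) (Ioo 0 1) := by
    have := (mul_int hF2 ha ha1).integral_prod_left
    refine this.congr (Filter.Eventually.of_forall fun r => ?_)
    simp only [mul_assoc]
    exact integral_const_mul _ _
  have iG : IntegrableOn (fun r => r * ∫ t in Ioo (-Real.pi) Real.pi,
        (∑ k, G k (polarMap (r, t)) * dirComp k t) * a t) (Ioo 0 1) := by
    have h := integrable_finsetSum Finset.univ fun k (_ : k ∈ Finset.univ) =>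
      mul_int (mul_int (hG2 k) (contDiff_dirComp k).continuous (abs_dirComp_le k)) ha ha1
    have := h.integral_prod_left
    refine this.congr (Filter.Eventually.of_forall fun r => ?_)
    simp only
    rw [← integral_const_mul]
    congr 1; ext t
    rw [Finset.sum_mul, Finset.mul_sum]
    exact Finset.sum_congr rfl fun k _ => by ring
  refine ⟨⟨locallyIntegrableOn_of_mul_id iF, locallyIntegrableOn_of_mul_id iG,
    fun φ p1 p2 p3 => ?_⟩, iG⟩
  obtain ⟨χ, c1, c2, c3, c4⟩ := exists_div_pow p1 p2 p3 (d + 2)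
  -- the components of the test vector field
  set Φ : Fin 2 → Plane → ℝ := fun k x => χ ‖x‖ * N x * x k with hΦ
  have hcoord : ∀ k : Fin 2, ContDiff ℝ ∞ (fun x : Plane => x k) := fun k =>
    (EuclideanSpace.proj k : Plane →L[ℝ] ℝ).contDiff
  have d1 : ∀ k, ContDiff ℝ ∞ (Φ k) := fun k => ((contDiff_radial c1 c2 c3).mul hN).mul (hcoord k)
  have d2 : ∀ k, HasCompactSupport (Φ k) := fun k =>
    ((tsupport_radial c2 c3).1.mul_right).mul_right
  have d3 : ∀ k, tsupport (Φ k) ⊆ unitDisc := fun k =>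
    (tsupport_mul_subset_left.trans tsupport_mul_subset_left).trans (tsupport_radial c2 c3).2
  have w := fun k => (hw k).2.2 (Φ k) (d1 k) (d2 k) (d3 k)
  have jF : ∀ k, IntegrableOn (fun x => F x * fderiv ℝ (Φ k) x (EuclideanSpace.single k 1))
      unitDisc := fun k =>
    LocallyIntegrableOn.integrableOn_mul_of_tsupport hF.locallyIntegrableOn
      (((d1 k).continuous_fderiv (by simp)).clm_apply continuous_const)
      ((d2 k).fderiv_apply ℝ _) ((tsupport_fderiv_apply_subset ℝ _).trans (d3 k))
  have jG : ∀ k, IntegrableOn (fun x => G k x * Φ k x) unitDisc := fun k =>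
    LocallyIntegrableOn.integrableOn_mul_of_tsupport (hG k).locallyIntegrableOn
      (d1 k).continuous (d2 k) (d3 k)
  have w2 : ∫ x in unitDisc, ∑ k, F x * fderiv ℝ (Φ k) x (EuclideanSpace.single k 1) =
      -∫ x in unitDisc, ∑ k, G k x * Φ k x := by
    rw [integral_finsetSum _ fun k _ => jF k, integral_finsetSum _ fun k _ => jG k,
      ← Finset.sum_neg_distrib]
    exact Finset.sum_congr rfl fun k _ => w k
  have JF := integrable_finsetSum Finset.univ fun k (_ : k ∈ Finset.univ) => jF k
  have JG := integrable_finsetSum Finset.univ fun k (_ : k ∈ Finset.univ) => jG k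
  rw [integral_unitDisc JF.aestronglyMeasurable, integral_unitDisc JG.aestronglyMeasurable] at w2
  have KF := (integrable_unitDisc_iff JF.aestronglyMeasurable).1 JF
  have KG := (integrable_unitDisc_iff JG.aestronglyMeasurable).1 JG
  have eF : (fun q : ℝ × ℝ => q.1 * ∑ k, F (polarMap q) *
      fderiv ℝ (Φ k) (polarMap q) (EuclideanSpace.single k 1)) =ᵐ[rectMeasure]
      fun q => F (polarMap q) * a q.2 * fderiv ℝ φ q.1 1 := by
    filter_upwards [ae_rect_mem] with q hq
    rw [← Finset.mul_sum, sum_fderiv_radial_field c1 c4 hN hNd hNa hq.1,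
      fderiv_apply_one_eq_deriv]
    have := hq.1.ne'
    field_simp
  have eG : (fun q : ℝ × ℝ => q.1 * ∑ k, G k (polarMap q) * Φ k (polarMap q)) =ᵐ[rectMeasure]
      fun q => (∑ k, G k (polarMap q) * dirComp k q.2) * a q.2 * φ q.1 := by
    filter_upwards [ae_rect_mem] with q hq
    simp only [hΦ, norm_polarMap hq.1.le, hNa, polarMap_apply]
    rw [Finset.mul_sum, Finset.sum_mul, Finset.sum_mul, ← c4 q.1]
    exact Finset.sum_congr rfl fun k _ => by ring
  rw [integral_congr_ae eF, integral_congr_ae eG, rectMeasure, integral_prod, integral_prod] at w2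
  · simp only [integral_mul_const] at w2
    exact w2
  · exact KG.congr eG
  · exact KF.congr eF

/-! ### Weak differentiability of functions given in polar coordinates -/

theorem hasDerivAt_dirComp (k : Fin 2) (t : ℝ) :
    HasDerivAt (dirComp k) (dirComp k (t + Real.pi / 2)) t := by
  fin_cases k
  · simp only [Fin.zero_eta, dirComp_zero, Real.cos_add_pi_div_two]
    exact Real.hasDerivAt_cos t
  · simp only [Fin.mk_one, dirComp_one, Real.sin_add_pi_div_two]
    exact Real.hasDerivAt_sin t

theorem dirComp_add_pi_div_two_twice (k : Fin 2) (t : ℝ) :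
    dirComp k (t + Real.pi / 2 + Real.pi / 2) = -dirComp k t := by
  have : t + Real.pi / 2 + Real.pi / 2 = t + Real.pi := by ring
  rw [this]
  fin_cases k <;> simp [Real.cos_add_pi, Real.sin_add_pi]

theorem single_eq_dirComp (j : Fin 2) (t : ℝ) :
    (EuclideanSpace.single j 1 : Plane) = dirComp j t • polarMap (1, t)
      + dirComp j (t + Real.pi / 2) • polarMap (1, t + Real.pi / 2) := by
  ext i
  have := Real.sin_sq_add_cos_sq t
  fin_cases j <;> fin_cases i <;>
    simp [Real.cos_add_pi_div_two, Real.sin_add_pi_div_two] <;> nlinarith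

theorem polarMap_eq_smul (q : ℝ × ℝ) : polarMap q = q.1 • polarMap (1, q.2) := by
  ext i; simp [polarMap_apply]

theorem hasDerivAt_polarMap_fst (r t : ℝ) :
    HasDerivAt (fun r => polarMap (r, t)) (polarMap (1, t)) r := by
  have : (fun r => polarMap (r, t)) = fun r => r • polarMap (1, t) :=
    funext fun r => polarMap_eq_smul (r, t)
  rw [this]
  simpa using (hasDerivAt_id r).smul_const (polarMap (1, t))

theorem hasDerivAt_polarMap_snd (r t : ℝ) :
    HasDerivAt (fun t => polarMap (r, t)) (r • polarMap (1, t + Real.pi / 2)) t := by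
  have h : ∀ r t, polarMap (r, t) = (r * dirComp 0 t) • EuclideanSpace.single 0 (1 : ℝ)
      + (r * dirComp 1 t) • EuclideanSpace.single 1 (1 : ℝ) := fun r t => by
    ext i; fin_cases i <;> simp
  rw [h, smul_add, smul_smul, smul_smul]
  simp only [h, one_mul]
  exact (((hasDerivAt_dirComp 0 t).const_mul r).smul_const _).add
    (((hasDerivAt_dirComp 1 t).const_mul r).smul_const _)

theorem integrable_rect_mul {g : ℝ → ℝ} (hg : IntegrableOn g (Ioo 0 1)) {K : ℝ × ℝ → ℝ}
    (hK : Continuous K) : Integrable (fun q => g q.1 * K q) rectMeasure := by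
  have h1 : Integrable (fun q : ℝ × ℝ => g q.1) rectMeasure := Integrable.comp_fst hg _
  obtain ⟨C, hC⟩ := (isCompact_Icc.prod isCompact_Icc :
    IsCompact (Icc (0 : ℝ) 1 ×ˢ Icc (-Real.pi) Real.pi)).exists_bound_of_continuousOn
      hK.continuousOn
  refine h1.mul_bdd (c := C) hK.aestronglyMeasurable ?_
  rw [rectMeasure_eq_restrict]
  filter_upwards [ae_restrict_mem (measurableSet_Ioo.prod measurableSet_Ioo)] with q hq
  exact hC q ⟨Ioo_subset_Icc_self hq.1, Ioo_subset_Icc_self hq.2⟩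

theorem PrimitiveOn.integrableOn_of_bounded {f f' : ℝ → ℝ} (hf : PrimitiveOn (Ioc 0 1) f f')
    {C : ℝ} (hC : ∀ r ∈ Ioc (0 : ℝ) 1, |f r| ≤ C) : IntegrableOn f (Ioo 0 1) := by
  refine Integrable.of_bound hf.aestronglyMeasurable C ?_
  filter_upwards [ae_restrict_mem measurableSet_Ioo] with r hr
  exact hC r (Ioo_subset_Ioc_self hr)

/-- Integration by parts along a ray. The boundary term at the origin vanishes because `f` is
bounded. -/
theorem PrimitiveOn.integral_ray {f f' η η' : ℝ → ℝ} (hf : PrimitiveOn (Ioc 0 1) f f') {C : ℝ}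
    (hC : ∀ r ∈ Ioc (0 : ℝ) 1, |f r| ≤ C) (hf' : IntegrableOn (fun r => r * f' r) (Ioo 0 1))
    (hη : ∀ r, HasDerivAt η (η' r) r) (hη' : Continuous η') (h1 : η 1 = 0) :
    ∫ r in Ioo (0 : ℝ) 1, f r * (r * η' r + η r) = -∫ r in Ioo (0 : ℝ) 1, (r * f' r) * η r := by
  have cη : Continuous η := continuous_iff_continuousAt.2 fun r => (hη r).continuousAt
  have mulc : ∀ {g b : ℝ → ℝ}, IntegrableOn g (Ioo 0 1) → Continuous b →
      IntegrableOn (fun r => g r * b r) (Ioo 0 1) := by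
    intro g b hg hb
    obtain ⟨B, hB⟩ := isCompact_Icc.exists_bound_of_continuousOn (s := Icc (0 : ℝ) 1)
      hb.continuousOn
    refine Integrable.mul_bdd (c := B) hg hb.aestronglyMeasurable ?_
    filter_upwards [ae_restrict_mem measurableSet_Ioo] with r hr
    exact hB r (Ioo_subset_Icc_self hr)
  have i1 : IntegrableOn (fun r => f r * (r * η' r + η r)) (Ioo 0 1) :=
    mulc (hf.integrableOn_of_bounded hC) (by fun_prop)
  have i2 : IntegrableOn (fun r => (r * f' r) * η r) (Ioo 0 1) := mulc hf' cη
  set K : ℝ → ℝ := fun r => f' r * (r * η r) + f r * (1 * η r + r * η' r) with hK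
  have iK : IntegrableOn K (Ioo 0 1) := by
    refine (i1.add i2).congr (Filter.Eventually.of_forall fun r => ?_)
    simp only [hK, Pi.add_apply]; ring
  have hz : PrimitiveOn univ (fun r => r * η r) (fun r => 1 * η r + r * η' r) :=
    PrimitiveOn.of_hasDerivAt ordConnected_univ (fun r _ => (hasDerivAt_id r).mul (hη r))
      (by fun_prop)
  have hp := hf.mul ordConnected_Ioc (hz.mono (subset_univ _))
  have iK' : IntegrableOn K (uIcc 0 1) := by
    rw [uIcc_of_le zero_le_one]
    exact (integrableOn_Icc_iff_integrableOn_Ioo (by simp) (by simp)).2 iK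
  have t1 : Filter.Tendsto (fun s => ∫ r in s..1, K r) (nhdsWithin 0 (Ioi 0))
      (nhds (∫ r in (0 : ℝ)..1, K r)) := by
    have hc := intervalIntegral.continuousOn_primitive_interval_left iK' 0 left_mem_uIcc
    refine Filter.Tendsto.mono_left hc ?_
    rw [uIcc_of_le zero_le_one, ← nhdsWithin_Ioc_eq_nhdsGT (zero_lt_one (α := ℝ))]
    exact nhdsWithin_mono _ Ioc_subset_Icc_self
  have t2 : Filter.Tendsto (fun s => ∫ r in s..1, K r) (nhdsWithin 0 (Ioi 0)) (nhds 0) := by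
    have e : (fun s => -(f s * (s * η s))) =ᶠ[nhdsWithin 0 (Ioi 0)]
        (fun s => ∫ r in s..1, K r) := by
      filter_upwards [Ioc_mem_nhdsGT (zero_lt_one (α := ℝ))] with s hs
      have := hp.integral_eq hs ⟨one_pos, le_rfl⟩
      rw [h1] at this
      simp only [hK]
      linarith
    refine Filter.Tendsto.congr' e ?_
    have hb : Filter.Tendsto (fun s => C * |s * η s|) (nhdsWithin 0 (Ioi 0)) (nhds 0) := by
      have : Continuous (fun s => C * |s * η s|) := by fun_prop
      simpa using (this.tendsto 0).mono_left nhdsWithin_le_nhds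
    refine squeeze_zero_norm' ?_ hb
    filter_upwards [Ioc_mem_nhdsGT (zero_lt_one (α := ℝ))] with s hs
    rw [norm_neg, Real.norm_eq_abs, abs_mul]
    exact mul_le_mul_of_nonneg_right (hC s hs) (abs_nonneg _)
  have e0 := tendsto_nhds_unique t1 t2
  rw [intervalIntegral.integral_of_le zero_le_one, integral_Ioc_eq_integral_Ioo] at e0
  have e1 : ∫ r in Ioo (0 : ℝ) 1, K r = ∫ r in Ioo (0 : ℝ) 1,
      (f r * (r * η' r + η r) + (r * f' r) * η r) := by
    congr 1; ext r; simp only [hK]; ring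
  rw [e1, integral_add i1 i2] at e0
  linarith

/-- A function `f(r) a(t)` in polar coordinates, with `f` bounded and absolutely continuous away
from the origin, is weakly differentiable on the whole disc; its partial derivatives are given by
`∂ⱼ = cⱼ(t) ∂ᵣ + cⱼ'(t) r⁻¹ ∂ₜ`. -/
theorem hasWeakDirDeriv_polar {f f' a a' : ℝ → ℝ} (hf : PrimitiveOn (Ioc 0 1) f f') {C : ℝ}
    (hC : ∀ r ∈ Ioc (0 : ℝ) 1, |f r| ≤ C) (hf' : IntegrableOn (fun r => r * f' r) (Ioo 0 1))
    (ha : ∀ t, HasDerivAt a (a' t) t) (ha' : Continuous a') (hper : a (-Real.pi) = a Real.pi)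
    {F G : Plane → ℝ} (hF : IntegrableOn F unitDisc) (hG : IntegrableOn G unitDisc) (j : Fin 2)
    (hFp : ∀ q : ℝ × ℝ, q.1 ∈ Ioo (0 : ℝ) 1 → F (polarMap q) = f q.1 * a q.2)
    (hGp : ∀ q : ℝ × ℝ, q.1 ∈ Ioo (0 : ℝ) 1 → G (polarMap q) = f' q.1 * (a q.2 * dirComp j q.2)
      + f q.1 / q.1 * (a' q.2 * dirComp j (q.2 + Real.pi / 2))) :
    HasWeakDirDeriv unitDisc (EuclideanSpace.single j 1) F G := by
  refine ⟨hF.locallyIntegrableOn, hG.locallyIntegrableOn, fun φ p1 p2 p3 => ?_⟩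
  have ca : Continuous a := continuous_iff_continuousAt.2 fun r => (ha r).continuousAt
  have cj : Continuous (dirComp j) := (contDiff_dirComp j).continuous
  have cφ := p1.continuous
  have cD : Continuous (fderiv ℝ φ) := p1.continuous_fderiv (by simp)
  have cP := continuous_polarMap
  have jF : IntegrableOn (fun x => F x * fderiv ℝ φ x (EuclideanSpace.single j 1)) unitDisc :=
    LocallyIntegrableOn.integrableOn_mul_of_tsupport hF.locallyIntegrableOn
      (cD.clm_apply continuous_const)
      (p2.fderiv_apply ℝ _) ((tsupport_fderiv_apply_subset ℝ _).trans p3)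
  have jG : IntegrableOn (fun x => G x * φ x) unitDisc :=
    LocallyIntegrableOn.integrableOn_mul_of_tsupport hG.locallyIntegrableOn cφ p2 p3
  rw [integral_unitDisc jF.aestronglyMeasurable, integral_unitDisc jG.aestronglyMeasurable]
  -- the test function in polar coordinates and its partial derivatives
  set ϕ : ℝ × ℝ → ℝ := fun q => φ (polarMap q) with hϕ
  set ϕr : ℝ × ℝ → ℝ := fun q => fderiv ℝ φ (polarMap q) (polarMap (1, q.2)) with hϕr
  set ϕt : ℝ × ℝ → ℝ := fun q =>
    q.1 * fderiv ℝ φ (polarMap q) (polarMap (1, q.2 + Real.pi / 2)) with hϕt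
  have cϕ : Continuous ϕ := cφ.comp cP
  have cϕr : Continuous ϕr := (cD.comp cP).clm_apply (cP.comp (by fun_prop))
  have cϕt : Continuous ϕt := continuous_fst.mul ((cD.comp cP).clm_apply (cP.comp (by fun_prop)))
  have dφ : ∀ x, HasFDerivAt φ (fderiv ℝ φ x) x := fun x =>
    (p1.differentiable (by simp) x).hasFDerivAt
  have dr : ∀ r t, HasDerivAt (fun r => ϕ (r, t)) (ϕr (r, t)) r := fun r t =>
    (dφ (polarMap (r, t))).comp_hasDerivAt r (hasDerivAt_polarMap_fst r t)
  have dt : ∀ r t, HasDerivAt (fun t => ϕ (r, t)) (ϕt (r, t)) t := fun r t => by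
    have := (dφ (polarMap (r, t))).comp_hasDerivAt t (hasDerivAt_polarMap_snd r t)
    simpa only [hϕt, map_smul, smul_eq_mul] using! this
  have if0 := hf.integrableOn_of_bounded hC
  have c1 : Continuous (fun t => dirComp j (t + Real.pi / 2)) := cj.comp (by fun_prop)
  have I1 : Integrable (fun q : ℝ × ℝ => f q.1 * ((q.1 * ϕr q + ϕ q) * (a q.2 * dirComp j q.2)))
    rectMeasure := integrable_rect_mul if0 (by fun_prop)
  have I2 : Integrable (fun q : ℝ × ℝ => f q.1 * (a q.2 * dirComp j (q.2 + Real.pi / 2) * ϕt q))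
    rectMeasure := integrable_rect_mul if0 (by fun_prop)
  have I3 : Integrable (fun q : ℝ × ℝ => f q.1 * (a q.2 * dirComp j q.2 * ϕ q))
    rectMeasure := integrable_rect_mul if0 (by fun_prop)
  have I4 : Integrable (fun q : ℝ × ℝ => (q.1 * f' q.1) * (ϕ q * (a q.2 * dirComp j q.2)))
    rectMeasure := integrable_rect_mul (g := fun r => r * f' r) hf' (by fun_prop)
  have I5 : Integrable (fun q : ℝ × ℝ =>
      f q.1 * (a' q.2 * dirComp j (q.2 + Real.pi / 2) * ϕ q)) rectMeasure :=
    integrable_rect_mul if0 (by fun_prop)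
  have eF : (fun q : ℝ × ℝ => q.1 * (F (polarMap q) * fderiv ℝ φ (polarMap q)
      (EuclideanSpace.single j 1))) =ᵐ[rectMeasure] fun q =>
      f q.1 * ((q.1 * ϕr q + ϕ q) * (a q.2 * dirComp j q.2))
        + f q.1 * (a q.2 * dirComp j (q.2 + Real.pi / 2) * ϕt q)
        - f q.1 * (a q.2 * dirComp j q.2 * ϕ q) := by
    filter_upwards [ae_rect_mem] with q hq
    rw [hFp q hq, single_eq_dirComp j q.2, map_add, map_smul, map_smul]
    simp only [hϕr, hϕt, hϕ, smul_eq_mul]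
    ring
  have eG : (fun q : ℝ × ℝ => q.1 * (G (polarMap q) * φ (polarMap q))) =ᵐ[rectMeasure] fun q =>
      (q.1 * f' q.1) * (ϕ q * (a q.2 * dirComp j q.2))
        + f q.1 * (a' q.2 * dirComp j (q.2 + Real.pi / 2) * ϕ q) := by
    filter_upwards [ae_rect_mem] with q hq
    rw [hGp q hq]
    have := hq.1.ne'
    simp only [hϕ]
    field_simp
  have I12 : Integrable (fun q : ℝ × ℝ => f q.1 * ((q.1 * ϕr q + ϕ q) * (a q.2 * dirComp j q.2))
      + f q.1 * (a q.2 * dirComp j (q.2 + Real.pi / 2) * ϕt q)) rectMeasure := I1.add I2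
  rw [integral_congr_ae eF, integral_congr_ae eG, integral_sub I12 I3,
    integral_add I1 I2, integral_add I4 I5]
  -- integration by parts along rays
  have R : ∫ q, f q.1 * ((q.1 * ϕr q + ϕ q) * (a q.2 * dirComp j q.2)) ∂rectMeasure =
      -∫ q, (q.1 * f' q.1) * (ϕ q * (a q.2 * dirComp j q.2)) ∂rectMeasure := by
    rw [rectMeasure, integral_prod_symm _ I1, integral_prod_symm _ I4, ← integral_neg]
    congr 1; ext t
    simp only
    have hb : ϕ (1, t) = 0 := by
      refine image_eq_zero_of_notMem_tsupport (f := φ) fun h => ?_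
      have := p3 h
      rw [unitDisc, mem_ball_zero_iff, norm_polarMap zero_le_one] at this
      exact lt_irrefl _ this
    have := hf.integral_ray hC hf' (η := fun r => ϕ (r, t)) (η' := fun r => ϕr (r, t))
      (fun r => dr r t) (by fun_prop) hb
    simp only [← mul_assoc (f _), ← mul_assoc (_ * f' _)]
    rw [integral_mul_const, integral_mul_const, this]
    ring
  -- integration by parts along circles
  have T : ∫ q, f q.1 * (a q.2 * dirComp j (q.2 + Real.pi / 2) * ϕt q) ∂rectMeasure =
      ∫ q, f q.1 * (a q.2 * dirComp j q.2 * ϕ q) ∂rectMeasure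
      - ∫ q, f q.1 * (a' q.2 * dirComp j (q.2 + Real.pi / 2) * ϕ q) ∂rectMeasure := by
    rw [← integral_sub I3 I5]
    have I6 := I3.sub I5
    rw [rectMeasure, integral_prod _ I2]
    rw [rectMeasure] at I6
    erw [integral_prod _ I6]
    congr 1; ext r
    simp only [Pi.sub_apply, ← mul_sub]
    rw [integral_const_mul, integral_const_mul]
    congr 1
    rw [← integral_Ioc_eq_integral_Ioo, ← integral_Ioc_eq_integral_Ioo,
      ← intervalIntegral.integral_of_le (by linarith [Real.pi_pos]),
      ← intervalIntegral.integral_of_le (by linarith [Real.pi_pos])]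
    have dc : ∀ t, HasDerivAt (fun t => dirComp j (t + Real.pi / 2)) (-dirComp j t) t := fun t => by
      have := (hasDerivAt_dirComp j (t + Real.pi / 2)).comp_add_const t (Real.pi / 2)
      rwa [dirComp_add_pi_div_two_twice] at this
    have dac := fun t => (ha t).mul (dc t)
    have := intervalIntegral.integral_mul_deriv_eq_deriv_mul (a := -Real.pi) (b := Real.pi)
      (u := fun t => a t * dirComp j (t + Real.pi / 2)) (v := fun t => ϕ (r, t))
      (u' := fun t => a' t * dirComp j (t + Real.pi / 2) + a t * -dirComp j t)
      (v' := fun t => ϕt (r, t)) (fun t _ => dac t) (fun t _ => dt r t)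
      (Continuous.intervalIntegrable (by fun_prop) _ _)
      (Continuous.intervalIntegrable (by fun_prop) _ _)
    rw [this]
    have b1 : polarMap (r, -Real.pi) = polarMap (r, Real.pi) := by
      ext i; fin_cases i <;> simp
    have b2 : dirComp j (-Real.pi + Real.pi / 2) = dirComp j (Real.pi + Real.pi / 2) := by
      have : Real.pi + Real.pi / 2 = -Real.pi + Real.pi / 2 + 2 * Real.pi := by ring
      rw [this]
      fin_cases j
      · exact (Real.cos_add_two_pi _).symm
      · exact (Real.sin_add_two_pi _).symm
    simp only [hϕ, b1, b2, hper, sub_self, zero_sub]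
    rw [← intervalIntegral.integral_neg]
    congr 1; ext t; ring
  rw [R, T]
  ring

/-! ### The energy of one-dimensional profiles -/

/-- The integrand of the energy, in terms of `u`, `k = u'`, `v = w'` and `p = w''`. -/
noncomputable def energyDensity (h : ℝ) (u k v p : ℝ → ℝ) (r : ℝ) : ℝ :=
  u r ^ 2 / r + r * (k r + v r ^ 2 - 4 * r ^ 2) ^ 2 + h ^ 2 * (r * p r ^ 2 + v r ^ 2 / r)

/-- The energy in terms of `u`, `k = u'`, `v = w'` and `p = w''`. -/
noncomputable def reducedEnergy (h : ℝ) (u k v p : ℝ → ℝ) : ℝ≥0∞ :=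
  ∫⁻ r in Ioo (0 : ℝ) 1, ENNReal.ofReal (energyDensity h u k v p r)

/-- The one-dimensional form of an admissible pair: `u` and `v = w'` are absolutely continuous on
compact subintervals of `(0,1]` with derivatives `k` and `p`, and `∫₀¹ v = 1 - δ`. -/
structure Profile (δ : ℝ) (u k v p : ℝ → ℝ) : Prop where
  prim_u : PrimitiveOn (Ioc 0 1) u k
  prim_v : PrimitiveOn (Ioc 0 1) v p
  integrable_v : IntervalIntegrable v volume 0 1
  integral_v : ∫ r in (0 : ℝ)..1, v r = 1 - δ

theorem energyDensity_nonneg (h : ℝ) (u k v p : ℝ → ℝ) {r : ℝ} (hr : 0 < r) :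
    0 ≤ energyDensity h u k v p r := by
  unfold energyDensity; positivity

theorem aestronglyMeasurable_energyDensity {h : ℝ} {u k v p : ℝ → ℝ}
    (hu : PrimitiveOn (Ioc 0 1) u k) (hv : PrimitiveOn (Ioc 0 1) v p) :
    AEStronglyMeasurable (energyDensity h u k v p) (volume.restrict (Ioo 0 1)) := by
  have a1 := hu.aestronglyMeasurable.aemeasurable
  have a2 := hu.aestronglyMeasurable_deriv.aemeasurable
  have a3 := hv.aestronglyMeasurable.aemeasurable
  have a4 := hv.aestronglyMeasurable_deriv.aemeasurable
  refine AEMeasurable.aestronglyMeasurable ?_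
  unfold energyDensity
  fun_prop

theorem integrableOn_energyDensity {h : ℝ} {u k v p : ℝ → ℝ}
    (hu : PrimitiveOn (Ioc 0 1) u k) (hv : PrimitiveOn (Ioc 0 1) v p)
    (hE : reducedEnergy h u k v p ≠ ⊤) :
    IntegrableOn (energyDensity h u k v p) (Ioo 0 1) := by
  refine ⟨aestronglyMeasurable_energyDensity hu hv, ?_⟩
  rw [hasFiniteIntegral_iff_ofReal]
  · exact hE.lt_top
  · filter_upwards [ae_restrict_mem measurableSet_Ioo] with r hr
    exact energyDensity_nonneg h u k v p hr.1

theorem reducedEnergy_eq_ofReal {h : ℝ} {u k v p : ℝ → ℝ}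
    (hi : IntegrableOn (energyDensity h u k v p) (Ioo 0 1)) :
    reducedEnergy h u k v p = ENNReal.ofReal (∫ r in Ioo 0 1, energyDensity h u k v p r) := by
  rw [ofReal_integral_eq_lintegral_ofReal hi]
  · rfl
  · filter_upwards [ae_restrict_mem measurableSet_Ioo] with r hr
    exact energyDensity_nonneg h u k v p hr.1

/-- Each of the four terms of the energy density is integrable when their sum is. -/
theorem integrableOn_terms {h : ℝ} (hh : 0 < h) {u k v p : ℝ → ℝ}
    (hu : PrimitiveOn (Ioc 0 1) u k) (hv : PrimitiveOn (Ioc 0 1) v p)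
    (hi : IntegrableOn (energyDensity h u k v p) (Ioo 0 1)) :
    IntegrableOn (fun r => u r ^ 2 / r) (Ioo 0 1) ∧
    IntegrableOn (fun r => r * (k r + v r ^ 2 - 4 * r ^ 2) ^ 2) (Ioo 0 1) ∧
    IntegrableOn (fun r => r * p r ^ 2) (Ioo 0 1) ∧
    IntegrableOn (fun r => v r ^ 2 / r) (Ioo 0 1) := by
  have a1 := hu.aestronglyMeasurable.aemeasurable
  have a2 := hu.aestronglyMeasurable_deriv.aemeasurable
  have a3 := hv.aestronglyMeasurable.aemeasurable
  have a4 := hv.aestronglyMeasurable_deriv.aemeasurable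
  have key : ∀ {F : ℝ → ℝ} (c : ℝ), AEMeasurable F (volume.restrict (Ioo 0 1)) →
      (∀ r ∈ Ioo (0 : ℝ) 1, 0 ≤ F r ∧ F r ≤ c * energyDensity h u k v p r) →
      IntegrableOn F (Ioo 0 1) := fun c hF hb => by
    refine (hi.const_mul c).mono' hF.aestronglyMeasurable ?_
    filter_upwards [ae_restrict_mem measurableSet_Ioo] with r hr
    rw [Real.norm_of_nonneg (hb r hr).1]
    exact (hb r hr).2
  have hh2 : (h ^ 2)⁻¹ * h ^ 2 = 1 := by field_simp
  have hpos : ∀ r ∈ Ioo (0 : ℝ) 1, 0 ≤ u r ^ 2 / r ∧ 0 ≤ r * (k r + v r ^ 2 - 4 * r ^ 2) ^ 2 ∧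
      0 ≤ r * p r ^ 2 ∧ 0 ≤ v r ^ 2 / r := fun r hr => by
    have := hr.1
    refine ⟨by positivity, by positivity, by positivity, by positivity⟩
  refine ⟨key 1 (by fun_prop) fun r hr => ?_, key 1 (by fun_prop) fun r hr => ?_,
    key (h ^ 2)⁻¹ (by fun_prop) fun r hr => ?_, key (h ^ 2)⁻¹ (by fun_prop) fun r hr => ?_⟩ <;>
  obtain ⟨t1, t2, t3, t4⟩ := hpos r hr
  · refine ⟨t1, ?_⟩
    have : 0 ≤ h ^ 2 * (r * p r ^ 2 + v r ^ 2 / r) := by positivity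
    rw [energyDensity]; linarith
  · refine ⟨t2, ?_⟩
    have : 0 ≤ h ^ 2 * (r * p r ^ 2 + v r ^ 2 / r) := by positivity
    rw [energyDensity]; linarith
  · refine ⟨t3, ?_⟩
    have : 0 ≤ (h ^ 2)⁻¹ * (u r ^ 2 / r + r * (k r + v r ^ 2 - 4 * r ^ 2) ^ 2) := by positivity
    rw [energyDensity, mul_add, ← mul_assoc, hh2]; linarith
  · refine ⟨t4, ?_⟩
    have : 0 ≤ (h ^ 2)⁻¹ * (u r ^ 2 / r + r * (k r + v r ^ 2 - 4 * r ^ 2) ^ 2) := by positivity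
    rw [energyDensity, mul_add, ← mul_assoc, hh2]; linarith

/-- The Hardy-type norm `∫ f²/r + r f'²` controls the supremum of `f`, because `(f²)' = 2 f f'` and
`f²` is small somewhere. -/
theorem PrimitiveOn.sq_le {f f' : ℝ → ℝ} (hf : PrimitiveOn (Ioc 0 1) f f')
    (h1 : IntegrableOn (fun r => f r ^ 2 / r) (Ioo 0 1))
    (h2 : IntegrableOn (fun r => r * f' r ^ 2) (Ioo 0 1)) {r : ℝ} (hr : r ∈ Ioc (0 : ℝ) 1) :
    f r ^ 2 ≤ 2 * ((∫ t in Ioo 0 1, f t ^ 2 / t) + ∫ t in Ioo 0 1, t * f' t ^ 2) := by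
  set J := (∫ t in Ioo (0 : ℝ) 1, f t ^ 2 / t) + ∫ t in Ioo (0 : ℝ) 1, t * f' t ^ 2 with hJ
  have hJ' : J = ∫ t in Ioo (0 : ℝ) 1, (f t ^ 2 / t + t * f' t ^ 2) := (integral_add h1 h2).symm
  have h12 : IntegrableOn (fun t => f t ^ 2 / t + t * f' t ^ 2) (Ioo 0 1) := h1.add h2
  have h12c : IntegrableOn (fun t => f t ^ 2 / t + t * f' t ^ 2) (Ioc 0 1) :=
    (integrableOn_Ioc_iff_integrableOn_Ioo (by simp)).2 h12
  have hsq := hf.mul ordConnected_Ioc hf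
  have diff : ∀ s ∈ Ioo (0 : ℝ) 1, f r ^ 2 ≤ f s ^ 2 / s + J := by
    intro s hs
    have e := hsq.integral_eq (Ioo_subset_Ioc_self hs) hr
    have b : ‖∫ t in s..r, (f' t * f t + f t * f' t)‖ ≤ J := by
      refine intervalIntegral.norm_integral_le_integral_norm_uIoc.trans ?_
      rw [hJ', ← integral_Ioc_eq_integral_Ioo]
      have hsub : uIoc s r ⊆ Ioc 0 1 := uIoc_subset_uIcc.trans
        (ordConnected_Ioc.uIcc_subset (Ioo_subset_Ioc_self hs) hr)
      refine le_trans (setIntegral_mono_on ?_ (h12c.mono_set hsub) measurableSet_uIoc ?_)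
        (setIntegral_mono_set h12c ?_ hsub.eventuallyLE)
      · exact ((hsq.intervalIntegrable (Ioo_subset_Ioc_self hs) hr).norm).def'
      · intro t ht
        have ht0 := (hsub ht).1
        rw [Real.norm_eq_abs, show f' t * f t + f t * f' t = 2 * (f t * f' t) by ring, abs_le]
        have e1 : f t ^ 2 / t + t * f' t ^ 2 - 2 * (f t * f' t) = (f t - t * f' t) ^ 2 / t := by
          field_simp; ring
        have e2 : f t ^ 2 / t + t * f' t ^ 2 + 2 * (f t * f' t) = (f t + t * f' t) ^ 2 / t := by
          field_simp; ring
        have p1 : 0 ≤ (f t - t * f' t) ^ 2 / t := by positivity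
        have p2 : 0 ≤ (f t + t * f' t) ^ 2 / t := by positivity
        exact ⟨by linarith, by linarith⟩
      · filter_upwards [ae_restrict_mem measurableSet_Ioc] with t ht
        have := ht.1
        simp only [Pi.zero_apply]
        positivity
    rw [e, Real.norm_eq_abs] at b
    have b' := (abs_le.1 b).2
    have : f s ^ 2 ≤ f s ^ 2 / s := by
      rw [le_div_iff₀ hs.1]
      nlinarith [sq_nonneg (f s), hs.2]
    nlinarith
  have hc : ∀ c : ℝ, ∫ _ in Ioo (0 : ℝ) 1, c = c := fun c => by simp
  have ic : ∀ c : ℝ, IntegrableOn (fun _ => c) (Ioo (0 : ℝ) 1) := fun c => by simp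
  have := setIntegral_mono_on (ic (f r ^ 2)) (h1.add (ic J)) measurableSet_Ioo
    (fun s hs => diff s hs)
  simp only [Pi.add_apply] at this
  rw [integral_add h1 (ic J), hc, hc] at this
  have : 0 ≤ ∫ t in Ioo (0 : ℝ) 1, t * f' t ^ 2 :=
    setIntegral_nonneg measurableSet_Ioo fun t ht => mul_nonneg ht.1.le (sq_nonneg _)
  linarith

theorem PrimitiveOn.exists_abs_le {f f' : ℝ → ℝ} (hf : PrimitiveOn (Ioc 0 1) f f')
    (h1 : IntegrableOn (fun r => f r ^ 2 / r) (Ioo 0 1))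
    (h2 : IntegrableOn (fun r => r * f' r ^ 2) (Ioo 0 1)) :
    ∃ C, 0 ≤ C ∧ ∀ r ∈ Ioc (0 : ℝ) 1, |f r| ≤ C :=
  ⟨_, Real.sqrt_nonneg _, fun _ hr => Real.abs_le_sqrt (hf.sq_le h1 h2 hr)⟩

theorem integrableOn_id_mul_of_sq {f' : ℝ → ℝ}
    (hm : AEStronglyMeasurable f' (volume.restrict (Ioo 0 1)))
    (h2 : IntegrableOn (fun r => r * f' r ^ 2) (Ioo 0 1)) :
    IntegrableOn (fun r => r * f' r) (Ioo 0 1) := by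
  have i1 : IntegrableOn (fun _ : ℝ => (1 : ℝ)) (Ioo 0 1) := by simp
  refine (h2.add i1).mono' (continuous_id.aestronglyMeasurable.mul hm) ?_
  filter_upwards [ae_restrict_mem measurableSet_Ioo] with r hr
  simp only [Pi.add_apply, Real.norm_eq_abs, abs_mul, abs_of_pos hr.1, ← sq_abs (f' r)]
  nlinarith [sq_nonneg (|f' r| - 1), hr.1, hr.2, mul_nonneg hr.1.le (sq_nonneg (|f' r| - 1)),
    mul_nonneg hr.1.le (abs_nonneg (f' r))]

/-! ### From profiles to admissible pairs -/

theorem aestronglyMeasurable_comp_norm {f : ℝ → ℝ}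
    (hf : AEStronglyMeasurable f (volume.restrict (Ioo 0 1))) :
    AEStronglyMeasurable (fun x : Plane => f ‖x‖) (volume.restrict unitDisc) := by
  refine hf.comp_quasiMeasurePreserving ⟨measurable_norm, ?_⟩
  refine Measure.AbsolutelyContinuous.mk fun s hs h0 => ?_
  rw [← map_polarMap, Measure.map_map measurable_norm continuous_polarMap.measurable,
    Measure.map_apply (measurable_norm.comp continuous_polarMap.measurable) hs]
  refine withDensity_absolutelyContinuous _ _ ?_
  have h1 : rectMeasure (Prod.fst ⁻¹' s) = 0 :=
    (Measure.quasiMeasurePreserving_fst (μ := volume.restrict (Ioo (0 : ℝ) 1))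
      (ν := volume.restrict (Ioo (-Real.pi) Real.pi))).preimage_null h0
  have h2 := ae_rect_mem
  refine measure_mono_null_ae ?_ h1
  filter_upwards [h2] with q hq hq'
  have : ‖polarMap q‖ ∈ s := hq'
  rwa [norm_polarMap hq.1.le] at this

theorem memLp_two_of_polar {F : Plane → ℝ} {M : ℝ → ℝ}
    (hF : AEStronglyMeasurable F (volume.restrict unitDisc))
    (hM : IntegrableOn (fun r => r * M r) (Ioo 0 1))
    (h : ∀ q : ℝ × ℝ, q.1 ∈ Ioo (0 : ℝ) 1 → F (polarMap q) ^ 2 ≤ M q.1) :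
    MemLp F 2 (volume.restrict unitDisc) := by
  rw [memLp_two_iff_integrable_sq hF]
  have hF2 : AEStronglyMeasurable (fun x => F x ^ 2) (volume.restrict unitDisc) := hF.pow 2
  refine (integrable_unitDisc_iff hF2).2 ?_
  have h1 : Integrable (fun q : ℝ × ℝ => q.1 * M q.1) rectMeasure :=
    Integrable.comp_fst hM _
  refine h1.mono' (continuous_fst.aestronglyMeasurable.mul
    (hF2.comp_quasiMeasurePreserving quasiMeasurePreserving_polarMap)) ?_
  filter_upwards [ae_rect_mem] with q hq
  rw [Real.norm_of_nonneg (mul_nonneg hq.1.le (sq_nonneg _))]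
  exact mul_le_mul_of_nonneg_left (h q hq) hq.1.le

instance : IsFiniteMeasure (volume.restrict unitDisc) :=
  ⟨by rw [Measure.restrict_apply_univ]; exact measure_ball_lt_top⟩

theorem MeasureTheory.MemLp.integrableOn_unitDisc {F : Plane → ℝ}
    (hF : MemLp F 2 (volume.restrict unitDisc)) : IntegrableOn F unitDisc :=
  hF.integrable (by norm_num)

theorem measurable_coord (i : Fin 2) : Measurable (fun x : Plane => x i) :=
  (EuclideanSpace.proj i : Plane →L[ℝ] ℝ).continuous.measurable

theorem norm_inv_mul_polarMap {q : ℝ × ℝ} (hq : 0 < q.1) (i : Fin 2) :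
    ‖polarMap q‖⁻¹ * polarMap q i = dirComp i q.2 := by
  rw [norm_polarMap hq.le, polarMap_apply]
  field_simp

/-- The radial vector field `f(|x|) x / |x|` is of class `W^{1,2}` on the disc as soon as
`∫ f²/r + r f'²` is finite. -/
theorem memSobolevTwo_radialField {f f' : ℝ → ℝ} (hf : PrimitiveOn (Ioc 0 1) f f')
    (h1 : IntegrableOn (fun r => f r ^ 2 / r) (Ioo 0 1))
    (h2 : IntegrableOn (fun r => r * f' r ^ 2) (Ioo 0 1)) (i : Fin 2) :
    MemSobolevTwo 1 unitDisc (fun x => f ‖x‖ * (‖x‖⁻¹ * x i)) := by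
  obtain ⟨C, hC0, hC⟩ := hf.exists_abs_le h1 h2
  have mf := aestronglyMeasurable_comp_norm hf.aestronglyMeasurable
  have mf' := aestronglyMeasurable_comp_norm hf.aestronglyMeasurable_deriv
  have mi := fun i => measurable_coord i
  have mF : AEStronglyMeasurable (fun x : Plane => f ‖x‖ * (‖x‖⁻¹ * x i))
      (volume.restrict unitDisc) :=
    mf.mul (measurable_norm.inv.mul (mi i)).aestronglyMeasurable
  have hFp : ∀ q : ℝ × ℝ, q.1 ∈ Ioo (0 : ℝ) 1 →
      f ‖polarMap q‖ * (‖polarMap q‖⁻¹ * polarMap q i) = f q.1 * dirComp i q.2 := fun q hq => by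
    rw [norm_inv_mul_polarMap hq.1, norm_polarMap hq.1.le]
  have hF : MemLp (fun x : Plane => f ‖x‖ * (‖x‖⁻¹ * x i)) 2 (volume.restrict unitDisc) := by
    refine memLp_two_of_polar (M := fun _ => C ^ 2) mF
      (((continuous_id.mul continuous_const).integrableOn_Icc).mono_set Ioo_subset_Icc_self) ?_
    intro q hq
    rw [hFp q hq]
    refine sq_le_sq' ?_ ?_ <;>
    have e1 := hC q.1 (Ioo_subset_Ioc_self hq) <;>
    have e2 := abs_dirComp_le i q.2 <;>
    have e3 : |f q.1 * dirComp i q.2| ≤ C * 1 := by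
      rw [abs_mul]; exact mul_le_mul e1 e2 (abs_nonneg _) hC0
    · linarith [(abs_le.1 e3).1]
    · linarith [(abs_le.1 e3).2]
  refine ⟨hF, fun j => ?_⟩
  set G : Plane → ℝ := fun x => f' ‖x‖ * ((‖x‖⁻¹ * x i) * (‖x‖⁻¹ * x j))
    + f ‖x‖ / ‖x‖ * ((EuclideanSpace.single j 1 : Plane) i
      - (‖x‖⁻¹ * x i) * (‖x‖⁻¹ * x j)) with hG
  have mG : AEStronglyMeasurable G (volume.restrict unitDisc) := by
    refine AEMeasurable.aestronglyMeasurable ?_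
    have ni := fun i => measurable_norm.inv.mul (mi i)
    exact (mf'.aemeasurable.mul ((ni i).mul (ni j)).aemeasurable).add
      ((mf.aemeasurable.div measurable_norm.aemeasurable).mul
        ((measurable_const.sub ((ni i).mul (ni j))).aemeasurable))
  have hGp : ∀ q : ℝ × ℝ, q.1 ∈ Ioo (0 : ℝ) 1 → G (polarMap q) =
      f' q.1 * (dirComp i q.2 * dirComp j q.2)
        + f q.1 / q.1 * (dirComp i (q.2 + Real.pi / 2) * dirComp j (q.2 + Real.pi / 2)) := by
    intro q hq
    simp only [hG, norm_inv_mul_polarMap hq.1]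
    rw [norm_polarMap hq.1.le]
    conv_lhs => rw [single_eq_dirComp j q.2]
    simp only [PiLp.add_apply, PiLp.smul_apply, polarMap_apply, smul_eq_mul]
    ring
  have hGm : MemLp G 2 (volume.restrict unitDisc) := by
    refine memLp_two_of_polar (M := fun r => 2 * (f' r ^ 2 + f r ^ 2 / r ^ 2)) mG ?_ ?_
    · refine ((h2.add h1).const_mul 2).congr ?_
      filter_upwards [ae_restrict_mem measurableSet_Ioo] with r hr
      have := hr.1.ne'
      simp only [Pi.add_apply]
      field_simp
    · intro q hq
      rw [hGp q hq, ← div_pow]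
      have b : ∀ t, (dirComp i t * dirComp j t) ^ 2 ≤ 1 := fun t => by
        rw [← sq_abs, abs_mul]
        exact pow_le_one₀ (by positivity)
          (mul_le_one₀ (abs_dirComp_le i t) (abs_nonneg _) (abs_dirComp_le j t))
      refine (add_sq_le).trans ?_
      rw [mul_pow, mul_pow]
      have := mul_le_mul_of_nonneg_left (b q.2) (sq_nonneg (f' q.1))
      have := mul_le_mul_of_nonneg_left (b (q.2 + Real.pi / 2)) (sq_nonneg (f q.1 / q.1))
      linarith
  refine ⟨G, ?_, hGm⟩
  exact hasWeakDirDeriv_polar hf hC (integrableOn_id_mul_of_sq hf.aestronglyMeasurable_deriv h2)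
    (hasDerivAt_dirComp i) ((contDiff_dirComp i).continuous.comp (by fun_prop))
    (by fin_cases i <;> simp) hF.integrableOn_unitDisc hGm.integrableOn_unitDisc j hFp hGp

/-- Finite energy forces `r u'²` to be integrable, since `w'` is bounded. -/
theorem integrableOn_id_mul_sq_of_energy {h : ℝ} (hh : 0 < h) {u k v p : ℝ → ℝ}
    (hu : PrimitiveOn (Ioc 0 1) u k) (hv : PrimitiveOn (Ioc 0 1) v p)
    (hi : IntegrableOn (energyDensity h u k v p) (Ioo 0 1)) :
    IntegrableOn (fun r => r * k r ^ 2) (Ioo 0 1) := by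
  obtain ⟨t1, t2, t3, t4⟩ := integrableOn_terms hh hu hv hi
  obtain ⟨C, hC0, hC⟩ := hv.exists_abs_le t4 t3
  have i1 : IntegrableOn (fun _ : ℝ => 3 * C ^ 4 + 48) (Ioo 0 1) := by simp
  refine ((t2.const_mul 3).add i1).mono'
    (continuous_id.aestronglyMeasurable.mul (hu.aestronglyMeasurable_deriv.pow 2)) ?_
  filter_upwards [ae_restrict_mem measurableSet_Ioo] with r hr
  have hr0 := hr.1.le
  simp only [Pi.add_apply]
  rw [Real.norm_of_nonneg (mul_nonneg hr0 (sq_nonneg _))]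
  have hv2 : v r ^ 2 ≤ C ^ 2 := sq_le_sq' (by linarith [(abs_le.1 (hC r ⟨hr.1, hr.2.le⟩)).1])
    (abs_le.1 (hC r ⟨hr.1, hr.2.le⟩)).2
  have hv4 : (v r ^ 2) ^ 2 ≤ C ^ 4 := by
    rw [show C ^ 4 = (C ^ 2) ^ 2 by ring]; exact pow_le_pow_left₀ (sq_nonneg _) hv2 2
  have hr4 : (4 * r ^ 2) ^ 2 ≤ 16 := by
    rw [mul_pow, ← pow_mul]; nlinarith [pow_le_one₀ hr0 hr.2.le (n := 2 * 2)]
  set g := k r + v r ^ 2 - 4 * r ^ 2 with hg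
  have hk : k r ^ 2 ≤ 3 * (g ^ 2 + (v r ^ 2) ^ 2 + (4 * r ^ 2) ^ 2) := by
    have : k r = g - v r ^ 2 + 4 * r ^ 2 := by rw [hg]; ring
    rw [this]
    nlinarith [sq_nonneg (g + v r ^ 2), sq_nonneg (g - 4 * r ^ 2),
      sq_nonneg (v r ^ 2 + 4 * r ^ 2)]
  have hk2 : k r ^ 2 ≤ 3 * g ^ 2 + (3 * C ^ 4 + 48) := by linarith
  have hpos : 0 ≤ 3 * C ^ 4 + 48 := by positivity
  calc r * k r ^ 2 ≤ r * (3 * g ^ 2 + (3 * C ^ 4 + 48)) := mul_le_mul_of_nonneg_left hk2 hr0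
    _ = 3 * (r * g ^ 2) + r * (3 * C ^ 4 + 48) := by ring
    _ ≤ _ := by nlinarith [hr.2]

theorem energy_eq_reducedEnergy {h : ℝ} {u₀ w u k v p : ℝ → ℝ}
    (hu : u₀ =ᵐ[volume.restrict (Ioo 0 1)] u)
    (hk : HasWeakDirDeriv (Ioo (0 : ℝ) 1) 1 u₀ k)
    (hv : HasWeakDirDeriv (Ioo (0 : ℝ) 1) 1 w v)
    (hp : HasWeakDirDeriv (Ioo (0 : ℝ) 1) 1 v p) :
    energy h (u₀, w) = reducedEnergy h u k v p := by
  have hv' := weakDeriv_ae_eq hv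
  have hp' := weakDeriv_ae_eq (hp.congr hv'.symm (ae_eq_refl p))
  refine lintegral_congr_ae ?_
  filter_upwards [hu, weakDeriv_ae_eq hk, hv', hp'] with r e1 e2 e3 e4
  simp only [energyDensity, e1, e2, e3, e4]

/-- A profile of finite energy comes from an admissible pair. -/
theorem Profile.admissible {h δ : ℝ} (hh : 0 < h) {u k v p : ℝ → ℝ} (P : Profile δ u k v p)
    (hE : reducedEnergy h u k v p ≠ ⊤) :
    (u, fun r => ∫ s in (0 : ℝ)..r, v s) ∈ admissible δ ∧
      energy h (u, fun r => ∫ s in (0 : ℝ)..r, v s) = reducedEnergy h u k v p := by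
  have hi := integrableOn_energyDensity P.prim_u P.prim_v hE
  obtain ⟨t1, t2, t3, t4⟩ := integrableOn_terms hh P.prim_u P.prim_v hi
  have t5 := integrableOn_id_mul_sq_of_energy hh P.prim_u P.prim_v hi
  set w : ℝ → ℝ := fun r => ∫ s in (0 : ℝ)..r, v s with hw
  have iv : ∀ r ∈ Icc (0 : ℝ) 1, IntervalIntegrable v volume 0 r := fun r hr =>
    P.integrable_v.mono_set (by
      rw [uIcc_of_le hr.1, uIcc_of_le zero_le_one]; exact Icc_subset_Icc_right hr.2)
  have hprim : PrimitiveOn (Ioc 0 1) w v := fun a ha b hb => by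
    have ha' := iv a (Ioc_subset_Icc_self ha)
    have hb' := iv b (Ioc_subset_Icc_self hb)
    exact ⟨ha'.symm.trans hb', intervalIntegral.integral_interval_sub_left hb' ha'⟩
  have hcont : ContinuousOn w (Icc 0 1) := by
    have := intervalIntegral.continuousOn_primitive_interval' P.integrable_v left_mem_uIcc
    rwa [uIcc_of_le zero_le_one] at this
  refine ⟨⟨fun i => ?_, ?_, hcont, by simp [hw], P.integral_v⟩,
    energy_eq_reducedEnergy (ae_eq_refl u) P.prim_u.hasWeakDirDeriv hprim.hasWeakDirDeriv
      P.prim_v.hasWeakDirDeriv⟩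
  · have e : (fun x => inPlane u x i) = fun x : Plane => (1 / 2 * u ‖x‖) * (‖x‖⁻¹ * x i) := by
      ext x; simp [inPlane]
    simp only
    rw [e]
    refine memSobolevTwo_radialField (f := fun r => 1 / 2 * u r) (f' := fun r => 1 / 2 * k r)
      (P.prim_u.const_mul (1 / 2)) ?_ ?_ i
    · refine (t1.const_mul (1 / 4)).congr (Filter.Eventually.of_forall fun r => ?_)
      simp only; ring
    · refine (t5.const_mul (1 / 4)).congr (Filter.Eventually.of_forall fun r => ?_)
      simp only; ring
  · obtain ⟨B, hB⟩ := isCompact_Icc.exists_bound_of_continuousOn hcont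
    have hB0 : 0 ≤ B := (norm_nonneg _).trans (hB 0 (by simp))
    have hBw : ∀ r ∈ Ioc (0 : ℝ) 1, |w r| ≤ B := fun r hr => hB r (Ioc_subset_Icc_self hr)
    obtain ⟨C, hC0, hC⟩ := P.prim_v.exists_abs_le t4 t3
    have mv := P.prim_v.aestronglyMeasurable
    have hWm : MemLp (fun x : Plane => w ‖x‖) 2 (volume.restrict unitDisc) := by
      refine memLp_two_of_polar (M := fun _ => B ^ 2)
        (aestronglyMeasurable_comp_norm hprim.aestronglyMeasurable)
        (((continuous_id.mul continuous_const).integrableOn_Icc).mono_set Ioo_subset_Icc_self) ?_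
      intro q hq
      rw [norm_polarMap hq.1.le, ← sq_abs]
      exact pow_le_pow_left₀ (abs_nonneg _) (hBw _ (Ioo_subset_Ioc_self hq)) 2
    refine ⟨hWm, fun j => ⟨fun x => v ‖x‖ * (‖x‖⁻¹ * x j), ?_,
      memSobolevTwo_radialField P.prim_v t4 t3 j⟩⟩
    have hGm := (memSobolevTwo_radialField P.prim_v t4 t3 j).1
    have hiv : IntegrableOn (fun r => r * v r) (Ioo 0 1) := by
      refine Integrable.mono (P.prim_v.integrableOn_of_bounded hC)
        (continuous_id.aestronglyMeasurable.mul mv) ?_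
      filter_upwards [ae_restrict_mem measurableSet_Ioo] with r hr
      rw [norm_mul, Real.norm_of_nonneg hr.1.le]
      exact mul_le_of_le_one_left (norm_nonneg _) hr.2.le
    refine hasWeakDirDeriv_polar (a := fun _ => 1) (a' := fun _ => 0) hprim hBw hiv
      (fun t => hasDerivAt_const t 1) continuous_const rfl hWm.integrableOn_unitDisc
      hGm.integrableOn_unitDisc j (fun q hq => ?_) (fun q hq => ?_)
    · simp [norm_polarMap hq.1.le]
    · rw [norm_inv_mul_polarMap hq.1, norm_polarMap hq.1.le]; ring

/-! ### From admissible pairs to profiles -/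

theorem integral_cos_sq_period : ∫ t in Ioo (-Real.pi) Real.pi, Real.cos t * Real.cos t
    = Real.pi := by
  rw [← integral_Ioc_eq_integral_Ioo, ← intervalIntegral.integral_of_le
    (by linarith [Real.pi_pos])]
  simp only [← sq]
  rw [integral_cos_sq]
  simp

/-- The radial profile of an in-plane displacement of class `W^{1,2}` is weakly differentiable. -/
theorem exists_weakDeriv_of_inPlane {u : ℝ → ℝ}
    (hU : MemSobolevTwo 1 unitDisc (fun x => inPlane u x 0)) :
    ∃ k, HasWeakDirDeriv (Ioo (0 : ℝ) 1) 1 u k ∧ IntegrableOn (fun r => r * k r) (Ioo 0 1) := by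
  obtain ⟨hF, hG⟩ := hU
  choose G hw hG2 using hG
  obtain ⟨e1, e2⟩ := hasWeakDirDeriv_angularAverage (N := fun x : Plane => x 0) (a := Real.cos)
    (d := 1) hF.integrableOn_unitDisc (fun k => MemLp.integrableOn_unitDisc (hG2 k)) hw
    (EuclideanSpace.proj (0 : Fin 2) : Plane →L[ℝ] ℝ).contDiff (fun x => by
      have : fderiv ℝ (fun x : Plane => x 0) x =
          (EuclideanSpace.proj (0 : Fin 2) : Plane →L[ℝ] ℝ) :=
        (EuclideanSpace.proj (0 : Fin 2) : Plane →L[ℝ] ℝ).fderiv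
      rw [this]; simp) (fun q => by simp) Real.continuous_cos Real.abs_cos_le_one
  refine ⟨_, (e1.const_mul (2 / Real.pi)).congr ?_ (ae_eq_refl _), ?_⟩
  · filter_upwards [ae_restrict_mem measurableSet_Ioo] with r hr
    have : ∀ t, inPlane u (polarMap (r, t)) 0 * Real.cos t =
        1 / 2 * u r * (Real.cos t * Real.cos t) := fun t => by
      have := norm_inv_mul_polarMap (q := (r, t)) hr.1 0
      simp only [inPlane, PiLp.smul_apply, smul_eq_mul]
      rw [this, norm_polarMap (q := (r, t)) hr.1.le, dirComp_zero]
      ring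
    simp only [this]
    rw [integral_const_mul, integral_cos_sq_period]
    have := Real.pi_pos.ne'
    field_simp
  · refine (e2.const_mul (2 / Real.pi)).congr (Filter.Eventually.of_forall fun r => ?_)
    simp only; ring

/-- The radial profile of an out-of-plane displacement of class `W^{2,2}` is twice weakly
differentiable: its derivative is the angular average of the radial derivative `∑ cₖ ∂ₖW`, and the
average of each `cₖ ∂ₖW` is in turn weakly differentiable. -/
theorem exists_weakDeriv_of_outOfPlane {w : ℝ → ℝ}
    (hW : MemSobolevTwo 2 unitDisc (outOfPlane w)) :
    ∃ v p, HasWeakDirDeriv (Ioo (0 : ℝ) 1) 1 w v ∧ HasWeakDirDeriv (Ioo (0 : ℝ) 1) 1 v p ∧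
      IntegrableOn (fun r => r * p r) (Ioo 0 1) := by
  obtain ⟨hF, hG⟩ := hW
  choose g hw hg using hG
  have gi := fun k => MemLp.integrableOn_unitDisc (hg k).1
  obtain ⟨e1, -⟩ := hasWeakDirDeriv_angularAverage (N := fun _ : Plane => 1) (a := fun _ => 1)
    (d := 0) hF.integrableOn_unitDisc gi hw contDiff_const (fun x => by simp) (fun q => by simp)
    continuous_const (fun t => by simp)
  have h2 : ∀ k : Fin 2, ∃ p, HasWeakDirDeriv (Ioo (0 : ℝ) 1) 1
      (fun r => ∫ t in Ioo (-Real.pi) Real.pi, g k (polarMap (r, t)) * dirComp k t) p ∧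
      IntegrableOn (fun r => r * p r) (Ioo 0 1) := by
    intro k
    obtain ⟨hgk, hG⟩ := hg k
    choose G hGw hG2 using hG
    obtain ⟨f1, f2⟩ := hasWeakDirDeriv_angularAverage (N := fun x : Plane => x k) (a := dirComp k)
      (d := 1) (gi k) (fun l => MemLp.integrableOn_unitDisc (hG2 l)) hGw
      (EuclideanSpace.proj k : Plane →L[ℝ] ℝ).contDiff (fun x => by
        have : fderiv ℝ (fun x : Plane => x k) x = (EuclideanSpace.proj k : Plane →L[ℝ] ℝ) :=
          (EuclideanSpace.proj k : Plane →L[ℝ] ℝ).fderiv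
        rw [this]; simp) (fun q => by simp [polarMap_apply]) (contDiff_dirComp k).continuous
      (abs_dirComp_le k)
    exact ⟨_, f1, f2⟩
  choose p hp hpi using h2
  have hsum := ((hp 0).add (hp 1)).const_mul (1 / (2 * Real.pi))
  refine ⟨_, _, (e1.const_mul (1 / (2 * Real.pi))).congr ?_ ?_, hsum, ?_⟩
  · filter_upwards [ae_restrict_mem measurableSet_Ioo] with r hr
    simp only [outOfPlane, norm_polarMap (q := (r, _)) hr.1.le]
    have := Real.pi_pos
    simp [this.le]
    field_simp
    ring
  · have hq : ∀ k, ∀ᵐ r ∂(volume.restrict (Ioo (0 : ℝ) 1)),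
        Integrable (fun t => r * g k (polarMap (r, t)))
          (volume.restrict (Ioo (-Real.pi) Real.pi)) :=
      fun k => ((integrable_unitDisc_iff (gi k).aestronglyMeasurable).1 (gi k)).prod_right_ae
    filter_upwards [hq 0, hq 1, ae_restrict_mem measurableSet_Ioo] with r h0 h1 hr
    have hr0 := hr.1.ne'
    have key : ∀ k, Integrable (fun t => r * g k (polarMap (r, t)))
        (volume.restrict (Ioo (-Real.pi) Real.pi)) →
        Integrable (fun t => g k (polarMap (r, t)) * dirComp k t)
        (volume.restrict (Ioo (-Real.pi) Real.pi)) := fun k hk => by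
      have h3 := (hk.mul_bdd (c := 1) (contDiff_dirComp k).continuous.aestronglyMeasurable
        (Filter.Eventually.of_forall fun t => abs_dirComp_le k t)).const_mul r⁻¹
      refine h3.congr (Filter.Eventually.of_forall fun t => ?_)
      simp only
      field_simp
    simp only [mul_one, Fin.sum_univ_two]
    rw [integral_add (key 0 h0) (key 1 h1)]
  · refine (((hpi 0).add (hpi 1)).const_mul (1 / (2 * Real.pi))).congr
      (Filter.Eventually.of_forall fun r => ?_)
    simp only [Pi.add_apply]; ring

/-- An admissible pair of finite energy gives rise to a profile with the same energy. -/
theorem exists_profile_of_admissible {h δ : ℝ} (hh : 0 < h) {q : (ℝ → ℝ) × (ℝ → ℝ)}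
    (hq : q ∈ admissible δ) (hE : energy h q ≠ ⊤) :
    ∃ u k v p, Profile δ u k v p ∧ reducedEnergy h u k v p = energy h q := by
  obtain ⟨u₀, w⟩ := q
  obtain ⟨hU, hW, hc, h0, h1⟩ := hq
  simp only at hU hW hc h0 h1
  obtain ⟨k, hk, ik⟩ := exists_weakDeriv_of_inPlane (hU 0)
  obtain ⟨v₀, p, hv, hp, ip⟩ := exists_weakDeriv_of_outOfPlane hW
  obtain ⟨u, pu, eu⟩ := hk.exists_primitiveOn fun a ha => intervalIntegrable_of_mul_id ik ha
  obtain ⟨v, pv, ev⟩ := hp.exists_primitiveOn fun a ha => intervalIntegrable_of_mul_id ip ha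
  have hv' : HasWeakDirDeriv (Ioo (0 : ℝ) 1) 1 w v := hv.congr (ae_eq_refl _) ev
  have hE' : energy h (u₀, w) = reducedEnergy h u k v p :=
    energy_eq_reducedEnergy eu hk hv' pv.hasWeakDirDeriv
  rw [hE'] at hE
  obtain ⟨t1, t2, t3, t4⟩ := integrableOn_terms hh pu pv (integrableOn_energyDensity pu pv hE)
  obtain ⟨C, hC0, hC⟩ := pv.exists_abs_le t4 t3
  have iv : IntervalIntegrable v volume 0 1 := by
    rw [intervalIntegrable_iff_integrableOn_Ioc_of_le zero_le_one,
      integrableOn_Ioc_iff_integrableOn_Ioo (by simp)]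
    exact pv.integrableOn_of_bounded hC
  refine ⟨u, k, v, p, ⟨pu, pv, iv, ?_⟩, hE'.symm⟩
  set W : ℝ → ℝ := fun r => ∫ s in (0 : ℝ)..r, v s with hWdef
  have iv' : ∀ r ∈ Icc (0 : ℝ) 1, IntervalIntegrable v volume 0 r := fun r hr =>
    iv.mono_set (by
      rw [uIcc_of_le hr.1, uIcc_of_le zero_le_one]; exact Icc_subset_Icc_right hr.2)
  have hprim : PrimitiveOn (Ioc 0 1) W v := fun a ha b hb => by
    have ha' := iv' a (Ioc_subset_Icc_self ha)
    have hb' := iv' b (Ioc_subset_Icc_self hb)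
    exact ⟨ha'.symm.trans hb', intervalIntegral.integral_interval_sub_left hb' ha'⟩
  have hcont : ContinuousOn W (Icc 0 1) := by
    have := intervalIntegral.continuousOn_primitive_interval' iv left_mem_uIcc
    rwa [uIcc_of_le zero_le_one] at this
  -- `w` and the primitive of `v` differ by a constant, on all of `[0,1]` by continuity
  have hd := hv'.sub hprim.hasWeakDirDeriv
  simp only [sub_self] at hd
  obtain ⟨c, hcc⟩ := hd.ae_eq_const
  have heq : EqOn (fun x => w x - W x) (fun _ => c) (Icc 0 1) := by
    refine Measure.eqOn_Icc_of_ae_eq volume zero_ne_one ?_ (hc.sub hcont) continuousOn_const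
    rwa [Measure.restrict_congr_set Ioo_ae_eq_Icc] at hcc
  have c0 := heq (left_mem_Icc.2 zero_le_one)
  have c1 := heq (right_mem_Icc.2 zero_le_one)
  simp only [h0, h1] at c0 c1
  have W0 : W 0 = 0 := by simp [hWdef]
  have : W 1 = 1 - δ := by linarith
  exact this

/-! ### Lower bounds: the cost of bending and of the zeros of the slope -/

/-- The four terms of the energy of a profile are integrable and bounded by `E`, respectively by
`E / h²`. -/
structure EnergyBound (E h : ℝ) (u k v p : ℝ → ℝ) : Prop where
  prim_u : PrimitiveOn (Ioc 0 1) u k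
  prim_v : PrimitiveOn (Ioc 0 1) v p
  int_u : IntegrableOn (fun r => u r ^ 2 / r) (Ioo 0 1)
  le_u : ∫ r in Ioo 0 1, u r ^ 2 / r ≤ E
  int_g : IntegrableOn (fun r => r * (k r + v r ^ 2 - 4 * r ^ 2) ^ 2) (Ioo 0 1)
  le_g : ∫ r in Ioo 0 1, r * (k r + v r ^ 2 - 4 * r ^ 2) ^ 2 ≤ E
  int_p : IntegrableOn (fun r => r * p r ^ 2) (Ioo 0 1)
  le_p : ∫ r in Ioo 0 1, r * p r ^ 2 ≤ E / h ^ 2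
  int_v : IntegrableOn (fun r => v r ^ 2 / r) (Ioo 0 1)
  le_v : ∫ r in Ioo 0 1, v r ^ 2 / r ≤ E / h ^ 2

theorem EnergyBound.of_integrable {E h : ℝ} (hh : 0 < h) {u k v p : ℝ → ℝ}
    (hu : PrimitiveOn (Ioc 0 1) u k) (hv : PrimitiveOn (Ioc 0 1) v p)
    (hi : IntegrableOn (energyDensity h u k v p) (Ioo 0 1))
    (hE : ∫ r in Ioo 0 1, energyDensity h u k v p r ≤ E) : EnergyBound E h u k v p := by
  obtain ⟨t1, t2, t3, t4⟩ := integrableOn_terms hh hu hv hi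
  have n1 : 0 ≤ ∫ r in Ioo (0 : ℝ) 1, u r ^ 2 / r :=
    setIntegral_nonneg measurableSet_Ioo fun t ht => div_nonneg (sq_nonneg _) ht.1.le
  have n2 : 0 ≤ ∫ r in Ioo (0 : ℝ) 1, r * (k r + v r ^ 2 - 4 * r ^ 2) ^ 2 :=
    setIntegral_nonneg measurableSet_Ioo fun t ht => mul_nonneg ht.1.le (sq_nonneg _)
  have n3 : 0 ≤ ∫ r in Ioo (0 : ℝ) 1, r * p r ^ 2 :=
    setIntegral_nonneg measurableSet_Ioo fun t ht => mul_nonneg ht.1.le (sq_nonneg _)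
  have n4 : 0 ≤ ∫ r in Ioo (0 : ℝ) 1, v r ^ 2 / r :=
    setIntegral_nonneg measurableSet_Ioo fun t ht => div_nonneg (sq_nonneg _) ht.1.le
  have e : ∫ r in Ioo (0 : ℝ) 1, energyDensity h u k v p r =
      (∫ r in Ioo (0 : ℝ) 1, u r ^ 2 / r)
      + (∫ r in Ioo (0 : ℝ) 1, r * (k r + v r ^ 2 - 4 * r ^ 2) ^ 2)
      + h ^ 2 * ((∫ r in Ioo (0 : ℝ) 1, r * p r ^ 2) + ∫ r in Ioo (0 : ℝ) 1, v r ^ 2 / r) := by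
    rw [← integral_add t1 t2, ← integral_add t3 t4, ← integral_const_mul, ← integral_add]
    · rfl
    · exact t1.add t2
    · exact (t3.add t4).const_mul _
  have hh2 : 0 < h ^ 2 := by positivity
  rw [e] at hE
  refine ⟨hu, hv, t1, ?_, t2, ?_, t3, ?_, t4, ?_⟩
  · nlinarith
  · nlinarith
  · rw [le_div_iff₀ hh2]; nlinarith
  · rw [le_div_iff₀ hh2]; nlinarith

theorem intervalIntegrable_of_Ioo {F : ℝ → ℝ} {x y : ℝ} (hx : 0 ≤ x) (hxy : x ≤ y) (hy : y ≤ 1)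
    (hF : IntegrableOn F (Ioo 0 1)) : IntervalIntegrable F volume x y := by
  rw [intervalIntegrable_iff_integrableOn_Ioo_of_le hxy]
  exact hF.mono_set (Ioo_subset_Ioo hx hy)

theorem integral_le_of_nonneg {F : ℝ → ℝ} {x y : ℝ} (hx : 0 ≤ x) (hxy : x ≤ y) (hy : y ≤ 1)
    (hF : IntegrableOn F (Ioo 0 1)) (h0 : ∀ r ∈ Ioo (0 : ℝ) 1, 0 ≤ F r) :
    ∫ r in x..y, F r ≤ ∫ r in Ioo 0 1, F r := by
  rw [intervalIntegral.integral_of_le hxy, integral_Ioc_eq_integral_Ioo]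
  refine setIntegral_mono_set hF ?_ (Ioo_subset_Ioo hx hy).eventuallyLE
  filter_upwards [ae_restrict_mem measurableSet_Ioo] with r hr
  exact h0 r hr

/-- The Cauchy-Schwarz inequality on a subinterval of `[0,1]`, for a function dominated by the
geometric mean of `F` and `ψ`. -/
theorem integral_abs_le_sqrt {φ F ψ : ℝ → ℝ} {A B x y : ℝ} (hA : 0 < A) (hB : 0 < B)
    (hx : 0 ≤ x) (hxy : x ≤ y) (hy : y ≤ 1) (hφ : IntervalIntegrable φ volume x y)
    (hF : IntegrableOn F (Ioo 0 1)) (hF0 : ∀ r ∈ Ioo (0 : ℝ) 1, 0 ≤ F r)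
    (hFA : ∫ r in Ioo 0 1, F r ≤ A) (hψ : IntervalIntegrable ψ volume x y)
    (hψB : ∫ r in x..y, ψ r ≤ B) (h : ∀ r ∈ Ioo x y, 0 ≤ ψ r ∧ φ r ^ 2 ≤ F r * ψ r) :
    ∫ r in x..y, |φ r| ≤ Real.sqrt (A * B) := by
  have hFi := intervalIntegrable_of_Ioo hx hxy hy hF
  set a := Real.sqrt A
  set b := Real.sqrt B
  have ha : 0 < a := Real.sqrt_pos.2 hA
  have hb : 0 < b := Real.sqrt_pos.2 hB
  have haA : a ^ 2 = A := Real.sq_sqrt hA.le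
  have hbB : b ^ 2 = B := Real.sq_sqrt hB.le
  have hpt : ∀ r ∈ Ioo x y, |φ r| ≤ b / a / 2 * F r + a / b / 2 * ψ r := by
    intro r hr
    have hr' : r ∈ Ioo (0 : ℝ) 1 := ⟨hx.trans_lt hr.1, hr.2.trans_le hy⟩
    obtain ⟨h0, h1⟩ := h r hr
    have h2 := hF0 r hr'
    refine abs_le_of_sq_le_sq' ?_ (by positivity) |> abs_le.2
    have e : (b / a / 2 * F r + a / b / 2 * ψ r) ^ 2 - F r * ψ r
      = (b / a / 2 * F r - a / b / 2 * ψ r) ^ 2 := by field_simp; ring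
    nlinarith [sq_nonneg (b / a / 2 * F r - a / b / 2 * ψ r)]
  have h1 : ∫ r in x..y, |φ r| ≤ ∫ r in x..y, (b / a / 2 * F r + a / b / 2 * ψ r) :=
    intervalIntegral.integral_mono_on_of_le_Ioo hxy hφ.abs
      ((hFi.const_mul _).add (hψ.const_mul _)) hpt
  rw [intervalIntegral.integral_add (hFi.const_mul _) (hψ.const_mul _),
    intervalIntegral.integral_const_mul, intervalIntegral.integral_const_mul] at h1
  have h2 := (integral_le_of_nonneg hx hxy hy hF hF0).trans hFA
  have h3 : b / a / 2 * (∫ r in x..y, F r) ≤ b / a / 2 * A :=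
    mul_le_mul_of_nonneg_left h2 (by positivity)
  have h4 : a / b / 2 * (∫ r in x..y, ψ r) ≤ a / b / 2 * B :=
    mul_le_mul_of_nonneg_left hψB (by positivity)
  have h5 : b / a / 2 * A + a / b / 2 * B = a * b := by
    rw [← haA, ← hbB]; field_simp; ring
  rw [Real.sqrt_mul hA.le]
  linarith

namespace EnergyBound

variable {E h : ℝ} {u k v p : ℝ → ℝ}

theorem u_nonneg (r : ℝ) (hr : r ∈ Ioo (0 : ℝ) 1) : 0 ≤ u r ^ 2 / r :=
  div_nonneg (sq_nonneg _) hr.1.le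

/-- Every interval contains a point at which `u` is not larger than its mean square allows. -/
theorem exists_good_point (H : EnergyBound E h u k v p) (hE : 0 < E) {x y : ℝ} (hx : 0 < x)
    (hxy : x < y) (hy : y ≤ 1) : ∃ t ∈ Icc x y, u t ^ 2 * (y - x) ≤ 2 * y * E := by
  by_contra! hcon
  have hy0 := hx.trans hxy
  have h1 : ∫ _ in x..y, 2 * E / (y - x) ≤ ∫ r in x..y, u r ^ 2 / r := by
    refine intervalIntegral.integral_mono_on_of_le_Ioo hxy.le (by simp)
      (intervalIntegrable_of_Ioo hx.le hxy.le hy H.int_u) fun r hr => ?_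
    have hr0 := hx.trans hr.1
    have := hcon r (Ioo_subset_Icc_self hr)
    rw [div_le_div_iff₀ (by linarith) hr0]
    have : 2 * E * r ≤ 2 * E * y := mul_le_mul_of_nonneg_left hr.2.le (by linarith)
    linarith
  have h2 := (integral_le_of_nonneg hx.le hxy.le hy H.int_u u_nonneg).trans H.le_u
  have h3 : ∫ _ in x..y, 2 * E / (y - x) = 2 * E := by
    have : y - x ≠ 0 := by linarith
    simp; field_simp
  linarith

theorem intervalIntegrable_g (H : EnergyBound E h u k v p) {x y : ℝ} (hx : x ∈ Ioc (0 : ℝ) 1)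
    (hy : y ∈ Ioc (0 : ℝ) 1) :
    IntervalIntegrable (fun r => k r + v r ^ 2 - 4 * r ^ 2) volume x y := by
  have h1 := H.prim_u.intervalIntegrable hx hy
  have h2 : IntervalIntegrable (fun r => v r ^ 2) volume x y :=
    ((H.prim_v.continuousOn_uIcc ordConnected_Ioc hx hy).pow 2).intervalIntegrable
  have h3 : IntervalIntegrable (fun r : ℝ => 4 * r ^ 2) volume x y :=
    Continuous.intervalIntegrable (by fun_prop) _ _
  exact (h1.add h2).sub h3

theorem intervalIntegrable_v_sq (H : EnergyBound E h u k v p) {x y : ℝ} (hx : x ∈ Ioc (0 : ℝ) 1)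
    (hy : y ∈ Ioc (0 : ℝ) 1) : IntervalIntegrable (fun r => v r ^ 2) volume x y :=
  ((H.prim_v.continuousOn_uIcc ordConnected_Ioc hx hy).pow 2).intervalIntegrable

/-- The increment of `u` in terms of the membrane strain `g = u' + w'² - 4r²`. -/
theorem sub_eq (H : EnergyBound E h u k v p) {x y : ℝ} (hx : x ∈ Ioc (0 : ℝ) 1)
    (hy : y ∈ Ioc (0 : ℝ) 1) : u y - u x = (∫ r in x..y, (k r + v r ^ 2 - 4 * r ^ 2))
      + ∫ r in x..y, (4 * r ^ 2 - v r ^ 2) := by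
  have h3 : IntervalIntegrable (fun r : ℝ => 4 * r ^ 2) volume x y :=
    Continuous.intervalIntegrable (by fun_prop) _ _
  rw [← H.prim_u.integral_eq hx hy, ← intervalIntegral.integral_add (H.intervalIntegrable_g hx hy)
    (h3.sub (H.intervalIntegrable_v_sq hx hy))]
  congr 1; ext r; ring

theorem integral_abs_g_le (H : EnergyBound E h u k v p) (hE : 0 < E) {x y m : ℝ} (hm : 0 < m)
    (hx : m ≤ x) (hxy : x < y) (hy : y ≤ 1) :
    ∫ r in x..y, |k r + v r ^ 2 - 4 * r ^ 2| ≤ Real.sqrt (E * ((y - x) / m)) := by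
  have hx0 := hm.trans_le hx
  refine integral_abs_le_sqrt hE (div_pos (by linarith) hm) hx0.le hxy.le hy
    (H.intervalIntegrable_g ⟨hx0, by linarith⟩ ⟨by linarith, hy⟩) H.int_g
    (fun r hr => mul_nonneg hr.1.le (sq_nonneg _)) H.le_g (ψ := fun _ => 1 / m) (by simp)
    (by simp; field_simp; rfl) fun r hr => ⟨by positivity, ?_⟩
  have : m ≤ r := hx.trans hr.1.le
  rw [mul_one_div, le_div_iff₀ hm]
  nlinarith [sq_nonneg (k r + v r ^ 2 - 4 * r ^ 2)]

/-- Bending and stretching cannot both be small: away from the origin either `w'² ≈ 4r²`, which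
costs bending energy, or `u' ≈ 4r²`, which makes `u` large. -/
theorem sq_le_energy (H : EnergyBound E h u k v p) (hE : 0 < E) (hh : 0 < h) (hh2 : h ≤ 1 / 2) :
    h ^ 2 / 10000 ≤ E := by
  by_contra! hcon
  -- `u` is small at two points at distance at least `1/4`
  obtain ⟨a, ha, hua⟩ := H.exists_good_point hE (x := 1 / 4) (y := 1 / 2) (by norm_num)
    (by norm_num) (by norm_num)
  obtain ⟨b, hb, hub⟩ := H.exists_good_point hE (x := 3 / 4) (y := 1) (by norm_num)
    (by norm_num) (by norm_num)
  have ha' : a ∈ Ioc (0 : ℝ) 1 := ⟨by linarith [ha.1], by linarith [ha.2]⟩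
  have hb' : b ∈ Ioc (0 : ℝ) 1 := ⟨by linarith [hb.1], by linarith [hb.2]⟩
  have hab : a < b := by linarith [ha.2, hb.1]
  set S := Real.sqrt E with hS
  have hS0 : 0 < S := Real.sqrt_pos.2 hE
  have hSE : S ^ 2 = E := Real.sq_sqrt hE.le
  have e1 : |u a| ≤ 2 * S := abs_le.2 (abs_le_of_sq_le_sq' (by nlinarith) (by positivity))
  have e2 : |u b| ≤ 3 * S := abs_le.2 (abs_le_of_sq_le_sq' (by nlinarith) (by positivity))
  have e3 : |∫ r in a..b, (k r + v r ^ 2 - 4 * r ^ 2)| ≤ 2 * S := by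
    refine (intervalIntegral.abs_integral_le_integral_abs hab.le).trans
      ((H.integral_abs_g_le hE (m := 1 / 4) (by norm_num) ha.1 hab hb'.2).trans ?_)
    rw [Real.sqrt_le_left (by positivity)]
    nlinarith [hb'.2, ha.1]
  have e4 : ∫ r in a..b, v r ^ 2 ≤ E / h ^ 2 := by
    refine le_trans ?_ ((integral_le_of_nonneg ha'.1.le hab.le hb'.2 H.int_v
      (fun r hr => div_nonneg (sq_nonneg _) hr.1.le)).trans H.le_v)
    refine intervalIntegral.integral_mono_on_of_le_Ioo hab.le (H.intervalIntegrable_v_sq ha' hb')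
      (intervalIntegrable_of_Ioo ha'.1.le hab.le hb'.2 H.int_v) fun r hr => ?_
    rw [le_div_iff₀ (ha'.1.trans hr.1)]
    nlinarith [sq_nonneg (v r), hr.2, hb'.2]
  have e5 : (1 : ℝ) / 16 ≤ ∫ r in a..b, 4 * r ^ 2 := by
    have : ∫ _ in a..b, (1 : ℝ) / 4 ≤ ∫ r in a..b, 4 * r ^ 2 :=
      intervalIntegral.integral_mono_on hab.le (by simp)
        (Continuous.intervalIntegrable (by fun_prop) _ _) fun r hr => by
          nlinarith [hr.1, ha.1]
    have h2 : ∫ _ in a..b, (1 : ℝ) / 4 = (b - a) * (1 / 4) := by simp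
    linarith [hb.1, ha.2]
  have e6 := H.sub_eq ha' hb'
  rw [intervalIntegral.integral_sub (Continuous.intervalIntegrable (by fun_prop) _ _)
    (H.intervalIntegrable_v_sq ha' hb')] at e6
  have e7 : E / h ^ 2 ≤ 1 / 10000 := by
    rw [div_le_iff₀ (by positivity)]; linarith
  have e8 : S ≤ 1 / 200 := by
    refine Real.sqrt_le_iff.2 ⟨by norm_num, ?_⟩
    nlinarith
  have := abs_le.1 e1
  have := abs_le.1 e2
  have := abs_le.1 e3
  linarith

/-- A zero of `w'` at radius `r₀` costs energy of order `(r₀ ℓ)³` with `ℓ = √h`: bending keeps `w'`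
small on an interval of length `ℓ`, where then `u` has to grow like `r₀² ℓ`. -/
theorem ne_zero_of_energy_lt {l r₀ : ℝ} (H : EnergyBound E (l ^ 2) u k v p) (hE : 0 < E)
    (hl : 0 < l) (hlr : l ≤ r₀ / 2) (hr1 : r₀ ≤ 1) (hlt : 576 * E < l ^ 3 * r₀ ^ 3) :
    v r₀ ≠ 0 := by
  intro hv0
  have hr0 : 0 < r₀ := by linarith
  -- `u` is small at two points of `[r₀ - ℓ, r₀]` at distance at least `ℓ/3`
  obtain ⟨a, ha, hua⟩ := H.exists_good_point hE (x := r₀ - l) (y := r₀ - 2 * l / 3)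
    (by linarith) (by linarith) (by linarith)
  obtain ⟨b, hb, hub⟩ := H.exists_good_point hE (x := r₀ - l / 3) (y := r₀)
    (by linarith) (by linarith) (by linarith)
  have ha' : a ∈ Ioc (0 : ℝ) 1 := ⟨by linarith [ha.1], by linarith [ha.2]⟩
  have hb' : b ∈ Ioc (0 : ℝ) 1 := ⟨by linarith [hb.1], by linarith [hb.2]⟩
  have hr' : r₀ ∈ Ioc (0 : ℝ) 1 := ⟨hr0, hr1⟩
  have hab : a < b := by linarith [ha.2, hb.1]
  set S := Real.sqrt (r₀ * E / l) with hS
  have hS0 : 0 < S := Real.sqrt_pos.2 (by positivity)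
  have hSE : S ^ 2 * l = r₀ * E := by
    rw [Real.sq_sqrt (by positivity)]; field_simp
  have e1 : |u a| ≤ 5 / 2 * S := by
    refine abs_le.2 (abs_le_of_sq_le_sq' ?_ (by positivity))
    have : u a ^ 2 * l ≤ (5 / 2 * S) ^ 2 * l := by
      nlinarith [mul_pos hr0 hE, mul_pos hl hE]
    exact le_of_mul_le_mul_right this hl
  have e2 : |u b| ≤ 5 / 2 * S := by
    refine abs_le.2 (abs_le_of_sq_le_sq' ?_ (by positivity))
    have : u b ^ 2 * l ≤ (5 / 2 * S) ^ 2 * l := by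
      nlinarith [mul_pos hr0 hE]
    exact le_of_mul_le_mul_right this hl
  have e3 : |∫ r in a..b, (k r + v r ^ 2 - 4 * r ^ 2)| ≤ S := by
    refine (intervalIntegral.abs_integral_le_integral_abs hab.le).trans
      ((H.integral_abs_g_le hE (m := r₀ / 2) (by linarith) (by linarith [ha.1]) hab hb'.2).trans
        (Real.sqrt_le_sqrt ?_))
    have : (b - a) / (r₀ / 2) ≤ r₀ / l := by
      rw [div_le_div_iff₀ (by linarith) hl]
      nlinarith [hb.2, ha.1]
    calc E * ((b - a) / (r₀ / 2)) ≤ E * (r₀ / l) := mul_le_mul_of_nonneg_left this hE.le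
      _ = r₀ * E / l := by ring
  -- by the bending energy, `w'` cannot exceed `r₀/2` within distance `ℓ` of its zero
  have e4 : ∀ r ∈ Ioo a b, |v r| ≤ r₀ / 2 := by
    intro r hr
    have hr1' : r₀ - l < r := ha.1.trans_lt hr.1
    have hr2 : r < r₀ := hr.2.trans_le hb.2
    have hrm : r ∈ Ioc (0 : ℝ) 1 := ⟨by linarith, by linarith⟩
    have h1 := H.prim_v.integral_eq hrm hr'
    rw [hv0, zero_sub] at h1
    have h2 : ∫ s in r..r₀, |p s| ≤ Real.sqrt (E / (l ^ 2) ^ 2 * (2 * l / r₀)) := by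
      refine integral_abs_le_sqrt (by positivity) (by positivity) hrm.1.le hr2.le hr1
        (H.prim_v.intervalIntegrable hrm hr') H.int_p
        (fun r hr => mul_nonneg hr.1.le (sq_nonneg _)) H.le_p (ψ := fun _ => 2 / r₀) (by simp)
        ?_ fun s hs => ⟨by positivity, ?_⟩
      · simp only [intervalIntegral.integral_const, smul_eq_mul]
        rw [mul_div_assoc', div_le_div_iff_of_pos_right hr0]
        linarith
      · rw [mul_div_assoc', le_div_iff₀ hr0]
        nlinarith [sq_nonneg (p s), hs.1]
    have h3 := intervalIntegral.abs_integral_le_integral_abs (f := p) (μ := volume) hr2.le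
    rw [h1, abs_neg] at h3
    refine (h3.trans h2).trans ?_
    rw [Real.sqrt_le_left (by positivity)]
    rw [show E / (l ^ 2) ^ 2 * (2 * l / r₀) = 2 * E / (l ^ 3 * r₀) by field_simp,
      div_le_iff₀ (by positivity)]
    nlinarith
  have e5 : r₀ ^ 2 * l / 4 ≤ ∫ r in a..b, (4 * r ^ 2 - v r ^ 2) := by
    have : ∫ _ in a..b, (3 / 4 * r₀ ^ 2) ≤ ∫ r in a..b, (4 * r ^ 2 - v r ^ 2) := by
      refine intervalIntegral.integral_mono_on_of_le_Ioo hab.le (by simp)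
        ((Continuous.intervalIntegrable (by fun_prop) _ _).sub
          (H.intervalIntegrable_v_sq ha' hb')) fun r hr => ?_
      have h1 := e4 r hr
      have h2 : v r ^ 2 ≤ (r₀ / 2) ^ 2 := by
        rw [← sq_abs]; exact pow_le_pow_left₀ (abs_nonneg _) h1 2
      have h3 : r₀ / 2 ≤ r := by linarith [ha.1, hr.1]
      nlinarith
    have h2 : ∫ _ in a..b, (3 / 4 * r₀ ^ 2) = (b - a) * (3 / 4 * r₀ ^ 2) := by
      rw [intervalIntegral.integral_const, smul_eq_mul]
    rw [h2] at this
    nlinarith [hb.1, ha.2, sq_nonneg r₀, mul_nonneg (sub_nonneg.2 hb.1) (sq_nonneg r₀),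
      mul_nonneg (sub_nonneg.2 ha.2) (sq_nonneg r₀)]
  have e6 := H.sub_eq ha' hb'
  have := abs_le.1 e1
  have := abs_le.1 e2
  have := abs_le.1 e3
  have e7 : r₀ ^ 2 * l ≤ 24 * S := by linarith
  have e8 : (r₀ ^ 2 * l) ^ 2 ≤ (24 * S) ^ 2 := pow_le_pow_left₀ (by positivity) e7 2
  have e9 : (r₀ ^ 2 * l) ^ 2 * l ≤ 576 * (r₀ * E) := by
    rw [← hSE]; nlinarith
  have e10 : r₀ * (l ^ 3 * r₀ ^ 3) ≤ r₀ * (576 * E) := by nlinarith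
  have := le_of_mul_le_mul_left e10 hr0
  linarith

end EnergyBound

/-! ### Lower bounds: the sign of the slope and the boundary condition -/

theorem integral_inv_cube_le {x y : ℝ} (hx : 0 < x) (hxy : x ≤ y) :
    IntervalIntegrable (fun r : ℝ => 1 / (4 * r ^ 3)) volume x y ∧
    ∫ r in x..y, 1 / (4 * r ^ 3) ≤ 1 / (8 * x ^ 2) := by
  have hd : PrimitiveOn (Ioi 0) (fun r : ℝ => -1 / (8 * r ^ 2)) (fun r : ℝ => 1 / (4 * r ^ 3)) := by
    refine PrimitiveOn.of_hasDerivAt ordConnected_Ioi (fun r hr => ?_) ?_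
    · have hr0 : r ≠ 0 := ne_of_gt hr
      have h8 : HasDerivAt (fun r : ℝ => 8 * r ^ 2) (8 * (2 * r)) r := by
        simpa using (hasDerivAt_pow 2 r).const_mul 8
      have : HasDerivAt (fun r : ℝ => -1 / (8 * r ^ 2)) _ r :=
        (hasDerivAt_const r (-1)).div h8 (by positivity)
      convert this using 1
      field_simp
      norm_num
    · refine continuousOn_const.div (by fun_prop) fun r hr => ?_
      have hr0 : (0 : ℝ) < r := hr
      positivity
  refine ⟨hd.intervalIntegrable hx (hx.trans_le hxy), ?_⟩
  rw [hd.integral_eq hx (hx.trans_le hxy)]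
  have : 0 < y := hx.trans_le hxy
  have : 0 ≤ 1 / (8 * y ^ 2) := by positivity
  rw [neg_div, neg_div]
  linarith

namespace EnergyBound

variable {E h : ℝ} {u k v p : ℝ → ℝ}

/-- On an interval where `w'` does not change sign, `|w'|` is close to `2r` in the mean: write
`2r - |w'| = (4r² - w'²) / (2r + |w'|)`, replace `4r² - w'²` by `u'` up to the strain and integrate
by parts. Here `s` is the sign of `w'`. -/
theorem integral_sub_abs_le (H : EnergyBound E h u k v p) (hE : 0 < E) (hh : 0 < h) {s a b : ℝ}
    (hs : s ^ 2 = 1) (ha : 0 < a) (hab : a ≤ b) (hb : b ≤ 1)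
    (hsv : ∀ r ∈ Icc a b, 0 < s * v r) :
    ∫ r in a..b, (2 * r - s * v r) ≤ |u a| / (2 * a) + |u b| / (2 * b) + Real.sqrt E / a
      + E / (4 * h * a ^ 2) := by
  have hI : Icc a b ⊆ Ioc 0 1 := fun r hr => ⟨ha.trans_le hr.1, hr.2.trans hb⟩
  have hoc : (Icc a b).OrdConnected := ordConnected_Icc
  have ham : a ∈ Icc a b := left_mem_Icc.2 hab
  have hbm : b ∈ Icc a b := right_mem_Icc.2 hab
  have hb0 : 0 < b := ha.trans_le hab
  set y : ℝ → ℝ := fun r => 2 * r + s * v r with hy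
  have hypos : ∀ r ∈ Icc a b, 0 < y r := fun r hr => by
    have := hsv r hr
    have := (hI hr).1
    simp only [hy]; linarith
  have h2r : PrimitiveOn (Icc a b) (fun r => 2 * r) (fun _ => 2) :=
    PrimitiveOn.of_hasDerivAt hoc (fun r _ => by simpa using (hasDerivAt_id r).const_mul 2)
      continuousOn_const
  have hv := H.prim_v.mono hI
  have hu := H.prim_u.mono hI
  have hyp : PrimitiveOn (Icc a b) y (fun r => 2 + s * p r) := h2r.add (hv.const_mul s)
  have hq := hyp.inv hoc hypos
  have hprod := hu.mul hoc hq
  have key := hprod.integral_eq ham hbm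
  have cu := hu.continuousOn_uIcc hoc ham hbm
  have cq := hq.continuousOn_uIcc hoc ham hbm
  have ik := (hu.intervalIntegrable ham hbm).mul_continuousOn cq
  have iq := (hq.intervalIntegrable ham hbm).continuousOn_mul cu
  have ig := (H.intervalIntegrable_g (hI ham) (hI hbm)).mul_continuousOn cq
  rw [intervalIntegral.integral_add ik iq] at key
  -- the integrand as strain and derivative of `u`, divided by `2r + |w'|`
  have e1 : ∫ r in a..b, (2 * r - s * v r) =
      (∫ r in a..b, k r * (y r)⁻¹) - ∫ r in a..b, (k r + v r ^ 2 - 4 * r ^ 2) * (y r)⁻¹ := by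
    rw [← intervalIntegral.integral_sub ik ig]
    refine intervalIntegral.integral_congr fun r hr => ?_
    rw [uIcc_of_le hab] at hr
    have := (hypos r hr).ne'
    rw [← sub_mul, eq_mul_inv_iff_mul_eq₀ this]
    simp only [hy]
    linear_combination -(v r ^ 2) * hs
  have hyinv : ∀ r ∈ Icc a b, 0 ≤ (y r)⁻¹ ∧ (y r)⁻¹ ≤ 1 / (2 * r) := fun r hr => by
    refine ⟨(inv_pos.2 (hypos r hr)).le, ?_⟩
    have h0 := (hI hr).1
    rw [← one_div]
    refine one_div_le_one_div_of_le (by linarith) ?_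
    have := hsv r hr
    simp only [hy]; linarith
  have B : ∀ r ∈ Icc a b, |u r * (y r)⁻¹| ≤ |u r| / (2 * r) := fun r hr => by
    obtain ⟨q1, q2⟩ := hyinv r hr
    rw [abs_mul, abs_of_nonneg q1, div_eq_mul_one_div]
    exact mul_le_mul_of_nonneg_left q2 (abs_nonneg _)
  have hB0 : (0 : ℝ) < 1 / (8 * a ^ 2) := by positivity
  obtain ⟨i3, j3⟩ := integral_inv_cube_le ha hab
  have hs8 : Real.sqrt (E * (1 / (8 * a ^ 2))) ≤ Real.sqrt E / (2 * a) := by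
    rw [Real.sqrt_le_left (by positivity), div_pow, Real.sq_sqrt hE.le, mul_one_div]
    refine div_le_div_of_nonneg_left hE.le (by positivity) (by nlinarith [sq_nonneg a])
  -- the strain term
  have G : |∫ r in a..b, (k r + v r ^ 2 - 4 * r ^ 2) * (y r)⁻¹| ≤ Real.sqrt E / (2 * a) := by
    refine (intervalIntegral.abs_integral_le_integral_abs hab).trans (le_trans ?_ hs8)
    refine integral_abs_le_sqrt hE hB0 ha.le hab hb ig H.int_g
      (fun r hr => mul_nonneg hr.1.le (sq_nonneg _)) H.le_g i3 j3 fun r hr => ?_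
    have hr0 := ha.trans hr.1
    obtain ⟨q1, q2⟩ := hyinv r (Ioo_subset_Icc_self hr)
    refine ⟨by positivity, ?_⟩
    have q3 : (y r)⁻¹ ^ 2 ≤ (1 / (2 * r)) ^ 2 := pow_le_pow_left₀ q1 q2 2
    rw [mul_pow]
    calc _ ≤ (k r + v r ^ 2 - 4 * r ^ 2) ^ 2 * (1 / (2 * r)) ^ 2 :=
          mul_le_mul_of_nonneg_left q3 (sq_nonneg _)
      _ = _ := by field_simp; ring
  -- the bending term
  have i1 : IntervalIntegrable (fun r => u r * (2 * (y r)⁻¹ ^ 2)) volume a b :=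
    (cu.mul ((cq.pow 2).const_mul 2)).intervalIntegrable
  have i1n : IntervalIntegrable (fun r => -(u r * (2 * (y r)⁻¹ ^ 2))) volume a b := i1.neg
  have i2 : IntervalIntegrable (fun r => (s * p r) * (u r * (y r)⁻¹ ^ 2)) volume a b :=
    ((hv.const_mul s).intervalIntegrable ham hbm).mul_continuousOn (cu.mul (cq.pow 2))
  have e2 : ∫ r in a..b, u r * (-(2 + s * p r) / y r ^ 2) =
      -(∫ r in a..b, u r * (2 * (y r)⁻¹ ^ 2)) - ∫ r in a..b, (s * p r) * (u r * (y r)⁻¹ ^ 2) := by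
    rw [← intervalIntegral.integral_neg, ← intervalIntegral.integral_sub i1n i2]
    congr 1; ext r
    rw [div_eq_mul_inv, inv_pow]; ring
  have U : |∫ r in a..b, u r * (2 * (y r)⁻¹ ^ 2)| ≤ Real.sqrt E / (2 * a) := by
    refine (intervalIntegral.abs_integral_le_integral_abs hab).trans (le_trans ?_ hs8)
    refine integral_abs_le_sqrt hE hB0 ha.le hab hb i1 H.int_u u_nonneg H.le_u i3 j3
      fun r hr => ?_
    have hr0 := ha.trans hr.1
    obtain ⟨q1, q2⟩ := hyinv r (Ioo_subset_Icc_self hr)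
    refine ⟨by positivity, ?_⟩
    have q3 : ((y r)⁻¹ ^ 2) ^ 2 ≤ ((1 / (2 * r)) ^ 2) ^ 2 :=
      pow_le_pow_left₀ (by positivity) (pow_le_pow_left₀ q1 q2 2) 2
    rw [mul_pow, mul_pow]
    calc _ ≤ u r ^ 2 * (2 ^ 2 * ((1 / (2 * r)) ^ 2) ^ 2) := by gcongr
      _ = _ := by field_simp; ring
  have W : |∫ r in a..b, (s * p r) * (u r * (y r)⁻¹ ^ 2)| ≤ E / (4 * h * a ^ 2) := by
    have hb' : 0 < E / h ^ 2 * (1 / (16 * a ^ 4)) := by positivity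
    have hsq : Real.sqrt (E * (E / h ^ 2 * (1 / (16 * a ^ 4)))) = E / (4 * h * a ^ 2) := by
      rw [show E * (E / h ^ 2 * (1 / (16 * a ^ 4))) = (E / (4 * h * a ^ 2)) ^ 2 by
        field_simp; ring]
      exact Real.sqrt_sq (by positivity)
    rw [← hsq]
    refine (intervalIntegral.abs_integral_le_integral_abs hab).trans ?_
    refine integral_abs_le_sqrt hE hb' ha.le hab hb i2 H.int_u u_nonneg H.le_u
      (ψ := fun r => r * p r ^ 2 * (1 / (16 * a ^ 4)))
      ((intervalIntegrable_of_Ioo ha.le hab hb H.int_p).mul_const _) ?_ fun r hr => ?_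
    · rw [intervalIntegral.integral_mul_const]
      refine mul_le_mul_of_nonneg_right ?_ (by positivity)
      exact (integral_le_of_nonneg ha.le hab hb H.int_p
        (fun r hr => mul_nonneg hr.1.le (sq_nonneg _))).trans H.le_p
    · have hr0 := ha.trans hr.1
      obtain ⟨q1, q2⟩ := hyinv r (Ioo_subset_Icc_self hr)
      refine ⟨by positivity, ?_⟩
      have q4 : (y r)⁻¹ ≤ 1 / (2 * a) := q2.trans
        (one_div_le_one_div_of_le (by linarith) (by linarith [hr.1]))
      have q3 : ((y r)⁻¹ ^ 2) ^ 2 ≤ ((1 / (2 * a)) ^ 2) ^ 2 :=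
        pow_le_pow_left₀ (by positivity) (pow_le_pow_left₀ q1 q4 2) 2
      rw [mul_pow, mul_pow, mul_pow, hs]
      calc _ ≤ 1 * p r ^ 2 * (u r ^ 2 * ((1 / (2 * a)) ^ 2) ^ 2) := by gcongr
        _ = _ := by field_simp; ring
  have ba := B a ham
  have bb := B b hbm
  rw [e1]
  rw [e2] at key
  have z1 := (abs_le.1 G).1
  have z2 := (abs_le.1 U).2
  have z3 := (abs_le.1 W).2
  have z4 := (abs_le.1 ba).1
  have z5 := (abs_le.1 bb).2
  have z6 : Real.sqrt E / a = Real.sqrt E / (2 * a) + Real.sqrt E / (2 * a) := by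
    field_simp; ring
  linarith

theorem integrableOn_v (H : EnergyBound E h u k v p) : IntegrableOn v (Ioo 0 1) := by
  obtain ⟨C, _, hC⟩ := H.prim_v.exists_abs_le H.int_v H.int_p
  exact H.prim_v.integrableOn_of_bounded hC

/-- In a small disc of radius `2R` the deflection is at most of order `R²`. The test function `√r`
is integrable against the strain down to the origin, and so is its reciprocal, which is needed to
pass from `w'²` to `|w'|`. -/
theorem integral_abs_v_le {R a : ℝ} (H : EnergyBound E h u k v p) (hE : 0 < E) (hh : 0 < h)
    (hh1 : h ≤ 1) (hR : 0 < R) (hRa : R ≤ a) (haR : a ≤ 2 * R) (ha1 : a ≤ 1)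
    (hER : Real.sqrt E ≤ R ^ 3) (hua : |u a| ≤ 2 * Real.sqrt E) :
    ∫ r in (0 : ℝ)..a, |v r| ≤ 22 * R ^ 2 := by
  have hR1 : R ≤ 1 := hRa.trans ha1
  have ha0 : 0 < a := hR.trans_le hRa
  set S := Real.sqrt E with hS
  have hS0 : 0 < S := Real.sqrt_pos.2 hE
  have hSE : S ^ 2 = E := Real.sq_sqrt hE.le
  -- the radius below which the bending energy alone controls the deflection
  set s₀ := R ^ 2 * h with hs₀
  have hs₀0 : 0 < s₀ := by positivity
  have hs₀R : s₀ ≤ R := by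
    calc R ^ 2 * h ≤ R ^ 2 * 1 := by gcongr
      _ ≤ R := by nlinarith
  obtain ⟨s, hs, hus⟩ := H.exists_good_point hE (x := s₀ / 2) (y := s₀) (by linarith)
    (by linarith) (by linarith)
  have hs0 : 0 < s := by linarith [hs.1]
  have hsa : s ≤ a := by linarith [hs.2]
  have hus' : |u s| ≤ 2 * S := by
    refine abs_le.2 (abs_le_of_sq_le_sq' ?_ (by positivity))
    have : u s ^ 2 * s₀ ≤ (2 * S) ^ 2 * s₀ := by nlinarith
    exact le_of_mul_le_mul_right this hs₀0
  have hsm : s ∈ Ioc (0 : ℝ) 1 := ⟨hs0, hsa.trans ha1⟩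
  have ham : a ∈ Ioc (0 : ℝ) 1 := ⟨ha0, ha1⟩
  -- the innermost part
  have p1 : ∫ r in (0 : ℝ)..s, |v r| ≤ R ^ 2 := by
    have hs₀1 : s ≤ R ^ 2 * h := hs.2
    refine (integral_abs_le_sqrt (A := E / h ^ 2) (B := s ^ 2) (ψ := fun r => r) (by positivity)
      (by positivity) le_rfl hs0.le hsm.2
      (intervalIntegrable_of_Ioo le_rfl hs0.le hsm.2 H.integrableOn_v) H.int_v
      (fun r hr => div_nonneg (sq_nonneg _) hr.1.le) H.le_v (by simp) ?_ fun r hr => ?_).trans ?_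
    · rw [integral_id]; nlinarith [sq_nonneg s]
    · refine ⟨hr.1.le, ?_⟩
      have := hr.1.ne'
      rw [div_mul_cancel₀ _ this]
    · rw [Real.sqrt_le_left (by positivity), ← hSE]
      have hS1 : S ≤ 1 := hER.trans (pow_le_one₀ hR.le hR1)
      rw [div_mul_eq_mul_div, div_le_iff₀ (by positivity), ← mul_pow, ← mul_pow]
      refine pow_le_pow_left₀ (by positivity) ?_ 2
      calc S * s ≤ 1 * (R ^ 2 * h) := by gcongr
        _ = _ := by ring
  set q := Real.sqrt a with hq
  have hq0 : 0 < q := Real.sqrt_pos.2 ha0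
  have hqa : q ^ 2 = a := Real.sq_sqrt ha0.le
  have hsq : Real.sqrt s ≤ q := Real.sqrt_le_sqrt hsa
  have hI : Icc s a ⊆ Ioc 0 1 := fun r hr => ⟨hs0.trans_le hr.1, hr.2.trans ha1⟩
  have hoc : (Icc s a).OrdConnected := ordConnected_Icc
  have hsI : s ∈ Icc s a := left_mem_Icc.2 hsa
  have haI : a ∈ Icc s a := right_mem_Icc.2 hsa
  have csq : ContinuousOn (fun r => 1 / (2 * Real.sqrt r)) (Icc s a) := by
    refine continuousOn_const.div (by fun_prop) fun r hr => ?_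
    have := Real.sqrt_pos.2 (hI hr).1
    positivity
  have hrt : PrimitiveOn (Icc s a) Real.sqrt (fun r => 1 / (2 * Real.sqrt r)) :=
    PrimitiveOn.of_hasDerivAt hoc (fun r hr => Real.hasDerivAt_sqrt (hI hr).1.ne') csq
  have hu := H.prim_u.mono hI
  have cu := hu.continuousOn_uIcc hoc hsI haI
  have crt : ContinuousOn Real.sqrt (uIcc s a) := Real.continuous_sqrt.continuousOn
  have ik := (hu.intervalIntegrable hsI haI).mul_continuousOn crt
  have iu := (hrt.intervalIntegrable hsI haI).continuousOn_mul cu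
  have ig := (H.intervalIntegrable_g hsm ham).mul_continuousOn crt
  have iv := (H.intervalIntegrable_v_sq hsm ham).mul_continuousOn crt
  have i4 : IntervalIntegrable (fun r : ℝ => 4 * r ^ 2 * Real.sqrt r) volume s a :=
    Continuous.intervalIntegrable (by fun_prop) _ _
  have key := (hu.mul hoc hrt).integral_eq hsI haI
  rw [intervalIntegral.integral_add ik iu] at key
  have e1 : ∫ r in s..a, v r ^ 2 * Real.sqrt r =
      (∫ r in s..a, (k r + v r ^ 2 - 4 * r ^ 2) * Real.sqrt r) - (∫ r in s..a, k r * Real.sqrt r)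
        + ∫ r in s..a, 4 * r ^ 2 * Real.sqrt r := by
    rw [← intervalIntegral.integral_sub ig ik, ← intervalIntegral.integral_add (ig.sub ik) i4]
    congr 1; ext r; ring
  have G : |∫ r in s..a, (k r + v r ^ 2 - 4 * r ^ 2) * Real.sqrt r| ≤ S * q := by
    refine (intervalIntegral.abs_integral_le_integral_abs hsa).trans ?_
    rw [hS, hq, ← Real.sqrt_mul hE.le]
    refine integral_abs_le_sqrt hE ha0 hs0.le hsa ha1 ig H.int_g
      (fun r hr => mul_nonneg hr.1.le (sq_nonneg _)) H.le_g (ψ := fun _ => 1) (by simp)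
      (by simp; linarith) fun r hr => ⟨zero_le_one, ?_⟩
    rw [mul_pow, Real.sq_sqrt (hs0.trans hr.1).le]
    exact (by ring : _ = _).le
  have U : |∫ r in s..a, u r * (1 / (2 * Real.sqrt r))| ≤ S * q := by
    refine (intervalIntegral.abs_integral_le_integral_abs hsa).trans ?_
    rw [hS, hq, ← Real.sqrt_mul hE.le]
    refine integral_abs_le_sqrt hE ha0 hs0.le hsa ha1 iu H.int_u u_nonneg H.le_u
      (ψ := fun _ => 1) (by simp) (by simp; linarith) fun r hr => ⟨zero_le_one, ?_⟩
    have hr0 := hs0.trans hr.1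
    rw [mul_pow, div_pow, mul_pow, Real.sq_sqrt hr0.le, mul_one, div_eq_mul_one_div (u r ^ 2)]
    refine mul_le_mul_of_nonneg_left ?_ (sq_nonneg _)
    rw [one_pow]
    exact one_div_le_one_div_of_le hr0 (by linarith)
  have F : ∫ r in s..a, 4 * r ^ 2 * Real.sqrt r ≤ 4 * a ^ 3 * q := by
    have : ∫ r in s..a, 4 * r ^ 2 * Real.sqrt r ≤ ∫ _ in s..a, 4 * a ^ 2 * q := by
      refine intervalIntegral.integral_mono_on hsa i4 (by simp) fun r hr => ?_
      have hr0 := (hI hr).1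
      have : Real.sqrt r ≤ q := Real.sqrt_le_sqrt hr.2
      have := hr.2
      gcongr
    refine this.trans ?_
    rw [intervalIntegral.integral_const, smul_eq_mul]
    have : 0 ≤ 4 * a ^ 2 * q := by positivity
    nlinarith
  have V : ∫ r in s..a, v r ^ 2 * Real.sqrt r ≤ 38 * R ^ 3 * q := by
    have b1 : |u a * Real.sqrt a| ≤ 2 * S * q := by
      rw [abs_mul, abs_of_pos hq0]; gcongr
    have b2 : |u s * Real.sqrt s| ≤ 2 * S * q := by
      rw [abs_mul, abs_of_nonneg (Real.sqrt_nonneg s)]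
      exact mul_le_mul hus' hsq (Real.sqrt_nonneg s) (by positivity)
    have z1 := (abs_le.1 G).2
    have z2 := (abs_le.1 U).2
    have z3 := (abs_le.1 b1).1
    have z4 := (abs_le.1 b2).2
    have h5 : ∫ r in s..a, v r ^ 2 * Real.sqrt r ≤ (6 * S + 4 * a ^ 3) * q := by
      rw [e1]; linarith
    refine h5.trans ?_
    have h6 : a ^ 3 ≤ (2 * R) ^ 3 := pow_le_pow_left₀ ha0.le haR 3
    refine mul_le_mul_of_nonneg_right ?_ hq0.le
    rw [mul_pow] at h6
    linarith
  have N : ∫ r in s..a, 1 / (2 * Real.sqrt r) ≤ q := by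
    rw [hrt.integral_eq hsI haI]
    linarith [Real.sqrt_nonneg s]
  -- the geometric mean inequality with weight `1 / (R √a)`
  have p2 : ∫ r in s..a, |v r| ≤ 21 * R ^ 2 := by
    have iv0 : IntervalIntegrable v volume s a :=
      intervalIntegrable_of_Ioo hs0.le hsa ha1 H.integrableOn_v
    have irt := hrt.intervalIntegrable hsI haI
    have h1 : ∫ r in s..a, |v r| ≤ ∫ r in s..a, (1 / (2 * R * q) * (v r ^ 2 * Real.sqrt r)
        + R * q * (1 / (2 * Real.sqrt r))) := by
      refine intervalIntegral.integral_mono_on hsa iv0.abs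
        ((iv.const_mul _).add (irt.const_mul _)) fun r hr => ?_
      have ht0 := Real.sqrt_pos.2 (hI hr).1
      set t := Real.sqrt r
      rw [← sq_abs (v r)]
      have e : 1 / (2 * R * q) * (|v r| ^ 2 * t) + R * q * (1 / (2 * t)) - |v r|
          = (|v r| * t - R * q) ^ 2 / (2 * R * q * t) := by field_simp; ring
      have : 0 ≤ (|v r| * t - R * q) ^ 2 / (2 * R * q * t) := by positivity
      linarith
    rw [intervalIntegral.integral_add (iv.const_mul _) (irt.const_mul _),
      intervalIntegral.integral_const_mul, intervalIntegral.integral_const_mul] at h1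
    have h2 : 1 / (2 * R * q) * (∫ r in s..a, v r ^ 2 * Real.sqrt r) ≤
        1 / (2 * R * q) * (38 * R ^ 3 * q) := mul_le_mul_of_nonneg_left V (by positivity)
    have h3 : R * q * (∫ r in s..a, 1 / (2 * Real.sqrt r)) ≤ R * q * q :=
      mul_le_mul_of_nonneg_left N (by positivity)
    have h4 : 1 / (2 * R * q) * (38 * R ^ 3 * q) = 19 * R ^ 2 := by field_simp; norm_num
    have h5 : R * q * q ≤ 2 * R ^ 2 := by
      rw [mul_assoc, ← sq, hqa]; nlinarith
    linarith
  have ia : IntervalIntegrable (fun r => |v r|) volume 0 s :=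
    (intervalIntegrable_of_Ioo le_rfl hs0.le hsm.2 H.integrableOn_v).abs
  have ib : IntervalIntegrable (fun r => |v r|) volume s a :=
    (intervalIntegrable_of_Ioo hs0.le hsa ha1 H.integrableOn_v).abs
  rw [← intervalIntegral.integral_add_adjacent_intervals ia ib]
  linarith

/-- The lower bound in the regime `δ ≫ h`, with `R = √δ / 8` and `ℓ = √h`: if the energy were
small, `w'` would have a sign beyond radius `R` by the cost of its zeros. A positive sign
contradicts `w(1) = 1 - δ`, because only the part of `w` below `R` can contribute to `δ`; a
negative sign contradicts `w(1) ≥ 0`. -/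
theorem ridge_le_energy {l R : ℝ} (H : EnergyBound E (l ^ 2) u k v p) (hE : 0 < E) (hl : 0 < l)
    (hlR : l ≤ R / 2) (hR1 : R ≤ 1 / 8) (hδ : ∫ r in (0 : ℝ)..1, v r = 1 - 64 * R ^ 2) :
    l ^ 3 * R ^ 3 ≤ 576 * E := by
  by_contra! hlt
  have hR : 0 < R := by linarith
  have hl1 : l ≤ 1 := by linarith
  set S := Real.sqrt E with hS
  have hS0 : 0 < S := Real.sqrt_pos.2 hE
  have hSE : S ^ 2 = E := Real.sq_sqrt hE.le
  have hSR : S ≤ R ^ 3 / 64 := by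
    refine Real.sqrt_le_iff.2 ⟨by positivity, ?_⟩
    have h1 : l ^ 3 ≤ (R / 2) ^ 3 := pow_le_pow_left₀ hl.le hlR 3
    have h2 : l ^ 3 * R ^ 3 ≤ (R / 2) ^ 3 * R ^ 3 := by gcongr
    have h3 : 0 < R ^ 6 := by positivity
    nlinarith
  have hR2 : R ^ 2 ≤ 1 / 64 := by nlinarith
  have hR20 : 0 < R ^ 2 := by positivity
  obtain ⟨a, ha, hua⟩ := H.exists_good_point hE (x := R) (y := 2 * R) hR (by linarith)
    (by linarith)
  obtain ⟨b, hb, hub⟩ := H.exists_good_point hE (x := 1 - R ^ 2) (y := 1) (by linarith)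
    (by linarith) le_rfl
  have ha0 : 0 < a := hR.trans_le ha.1
  have ha1 : a ≤ 1 / 4 := by linarith [ha.2]
  have hb2 : 63 / 64 ≤ b := by linarith [hb.1]
  have hab : a ≤ b := by linarith
  have eua : |u a| ≤ 2 * S := by
    refine abs_le.2 (abs_le_of_sq_le_sq' ?_ (by positivity))
    have : u a ^ 2 * R ≤ (2 * S) ^ 2 * R := by nlinarith
    exact le_of_mul_le_mul_right this hR
  have eub : |u b| ≤ R ^ 2 / 32 := by
    refine abs_le.2 (abs_le_of_sq_le_sq' ?_ (by positivity))
    have h1 : u b ^ 2 * R ^ 2 ≤ (R ^ 2 / 32) ^ 2 * R ^ 2 := by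
      have h2 : E ≤ (R ^ 3 / 64) ^ 2 := by rw [← hSE]; exact pow_le_pow_left₀ hS0.le hSR 2
      nlinarith
    exact le_of_mul_le_mul_right h1 hR20
  have hne : ∀ r ∈ Icc R 1, v r ≠ 0 := fun r hr => by
    refine H.ne_zero_of_energy_lt hE hl (by linarith [hr.1]) hr.2 (hlt.trans_le ?_)
    have := hr.1
    gcongr
  have cv : ContinuousOn v (Icc R 1) :=
    H.prim_v.continuousOn_Icc ordConnected_Ioc ⟨hR, by linarith⟩ ⟨one_pos, le_rfl⟩
  have inner := H.integral_abs_v_le hE (by positivity) (pow_le_one₀ hl.le hl1) hR ha.1 ha.2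
    (by linarith) (hSR.trans (by have : 0 < R ^ 3 := by positivity
                                 linarith)) eua
  -- the error terms of `integral_sub_abs_le`
  have err : |u a| / (2 * a) + |u b| / (2 * b) + S / a + E / (4 * l ^ 2 * a ^ 2) ≤ R ^ 2 := by
    have t0 : S / a ≤ R ^ 2 / 64 := by
      rw [div_le_iff₀ ha0]
      nlinarith [mul_le_mul_of_nonneg_left ha.1 hR20.le]
    have t1 : |u a| / (2 * a) ≤ S / a := by
      rw [div_le_div_iff₀ (by positivity) ha0]; nlinarith
    have t2 : |u b| / (2 * b) ≤ R ^ 2 / 32 := by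
      refine (div_le_self (abs_nonneg _) (by linarith)).trans eub
    have t3 : E / (4 * l ^ 2 * a ^ 2) ≤ R ^ 2 / 64 := by
      rw [div_le_iff₀ (by positivity)]
      have h1 : R ^ 2 ≤ a ^ 2 := pow_le_pow_left₀ hR.le ha.1 2
      have h2 : l ^ 3 * R ^ 3 ≤ l ^ 2 * R ^ 4 := by
        have : l ^ 3 * R ^ 3 = l ^ 2 * R ^ 3 * l := by ring
        rw [this, show l ^ 2 * R ^ 4 = l ^ 2 * R ^ 3 * R by ring]
        exact mul_le_mul_of_nonneg_left (by linarith) (by positivity)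
      have h3 : R ^ 2 / 64 * (4 * l ^ 2 * R ^ 2) ≤ R ^ 2 / 64 * (4 * l ^ 2 * a ^ 2) := by gcongr
      nlinarith [mul_pos (pow_pos hl 2) (pow_pos hR 4)]
    linarith
  have iv : ∀ {x y : ℝ}, 0 ≤ x → x ≤ y → y ≤ 1 → IntervalIntegrable v volume x y :=
    fun hx hxy hy => intervalIntegrable_of_Ioo hx hxy hy H.integrableOn_v
  have i2 : ∀ x y : ℝ, IntervalIntegrable (fun r : ℝ => 2 * r) volume x y := fun x y =>
    Continuous.intervalIntegrable (by fun_prop) _ _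
  have split : ∫ r in (0 : ℝ)..1, v r =
      (∫ r in (0 : ℝ)..a, v r) + (∫ r in a..b, v r) + ∫ r in b..1, v r := by
    rw [intervalIntegral.integral_add_adjacent_intervals (iv le_rfl ha0.le (by linarith))
      (iv ha0.le hab hb.2), intervalIntegral.integral_add_adjacent_intervals
      (iv le_rfl (by linarith) hb.2) (iv (by linarith) hb.2 le_rfl)]
  have hin := abs_le.1 ((intervalIntegral.abs_integral_le_integral_abs (f := v) (μ := volume)
    ha0.le).trans inner)
  have h2ab : ∫ r in a..b, 2 * r = b ^ 2 - a ^ 2 := by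
    rw [intervalIntegral.integral_const_mul, integral_id]; ring
  have hone : (1 : ℝ) ∈ Icc R 1 := ⟨by linarith, le_rfl⟩
  have ha2 : a ^ 2 ≤ 4 * R ^ 2 := by
    have := pow_le_pow_left₀ ha0.le ha.2 2
    linarith
  have hb1 : (63 / 64 : ℝ) ^ 2 ≤ b ^ 2 := pow_le_pow_left₀ (by norm_num) hb2 2
  rcases lt_or_gt_of_ne (hne 1 hone) with hneg | hpos
  · have sgn : ∀ r ∈ Icc R 1, v r < 0 := by
      intro r hr
      by_contra! hcon
      have hsub : Icc r 1 ⊆ Icc R 1 := Icc_subset_Icc_left hr.1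
      obtain ⟨z, hz, hz0⟩ := intermediate_value_Icc' hr.2 (cv.mono hsub) ⟨hneg.le, hcon⟩
      exact hne z (hsub hz) hz0
    have key := H.integral_sub_abs_le hE (by positivity) (s := -1) (by norm_num) ha0 hab hb.2
      fun r hr => by
        have := sgn r ⟨ha.1.trans hr.1, hr.2.trans hb.2⟩
        linarith
    have e : ∫ r in a..b, (2 * r - -1 * v r) = (b ^ 2 - a ^ 2) + ∫ r in a..b, v r := by
      rw [← h2ab, ← intervalIntegral.integral_add (i2 a b) (iv ha0.le hab hb.2)]
      congr 1; ext r; ring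
    have tail : ∫ r in b..1, v r ≤ 0 := by
      have : ∫ r in b..1, v r ≤ ∫ _ in b..1, (0 : ℝ) :=
        intervalIntegral.integral_mono_on hb.2 (iv (by linarith) hb.2 le_rfl) (by simp)
          fun r hr => (sgn r ⟨by linarith [hr.1], hr.2⟩).le
      simpa using this
    rw [e] at key
    linarith
  · have sgn : ∀ r ∈ Icc R 1, 0 < v r := by
      intro r hr
      by_contra! hcon
      have hsub : Icc r 1 ⊆ Icc R 1 := Icc_subset_Icc_left hr.1
      obtain ⟨z, hz, hz0⟩ := intermediate_value_Icc hr.2 (cv.mono hsub) ⟨hcon, hpos.le⟩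
      exact hne z (hsub hz) hz0
    have key := H.integral_sub_abs_le hE (by positivity) (s := 1) (by norm_num) ha0 hab hb.2
      fun r hr => by
        have := sgn r ⟨ha.1.trans hr.1, hr.2.trans hb.2⟩
        linarith
    have e : ∫ r in a..b, (2 * r - 1 * v r) = (b ^ 2 - a ^ 2) - ∫ r in a..b, v r := by
      rw [← h2ab, ← intervalIntegral.integral_sub (i2 a b) (iv ha0.le hab hb.2)]
      congr 1; ext r; ring
    have tail : 0 ≤ ∫ r in b..1, v r := by
      have : ∫ _ in b..1, (0 : ℝ) ≤ ∫ r in b..1, v r :=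
        intervalIntegral.integral_mono_on hb.2 (by simp) (iv (by linarith) hb.2 le_rfl)
          fun r hr => (sgn r ⟨by linarith [hr.1], hr.2⟩).le
      simpa using this
    rw [e] at key
    have hbb : (1 - R ^ 2) ^ 2 ≤ b ^ 2 := pow_le_pow_left₀ (by linarith) hb.1 2
    have : 0 ≤ (R ^ 2) ^ 2 := sq_nonneg _
    linarith

/-- The lower bound, with `h = ℓ²` and `δ = x²`. -/
theorem lower_bound {l x : ℝ} (H : EnergyBound E (l ^ 2) u k v p) (hE : 0 < E) (hl : 0 < l)
    (hl2 : l ^ 2 ≤ 1 / 2) (hx : 0 ≤ x) (hx1 : x ≤ 1)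
    (hδ : ∫ r in (0 : ℝ)..1, v r = 1 - x ^ 2) :
    l ^ 4 + x ^ 3 * l ^ 3 ≤ 10 ^ 8 * E := by
  have h1 := H.sq_le_energy hE (by positivity) hl2
  have h1' : l ^ 4 ≤ 10000 * E := by
    rw [← pow_mul] at h1; linarith
  -- for `ℓ > x/16` the term `x³ ℓ³` is dominated by `ℓ⁴`
  rcases le_or_gt l (x / 16) with hlx | hlx
  · have h2 := H.ridge_le_energy (R := x / 8) hE hl (by linarith) (by linarith) (by rw [hδ]; ring)
    have : l ^ 3 * (x / 8) ^ 3 = x ^ 3 * l ^ 3 / 512 := by ring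
    linarith
  · have h3 : x ^ 3 ≤ (16 * l) ^ 3 := pow_le_pow_left₀ hx (by linarith) 3
    have h4 : x ^ 3 * l ^ 3 ≤ (16 * l) ^ 3 * l ^ 3 := by gcongr
    have h5 : (16 * l) ^ 3 * l ^ 3 = 4096 * l ^ 4 * l ^ 2 := by ring
    have h6 : 4096 * l ^ 4 * l ^ 2 ≤ 4096 * l ^ 4 * (1 / 2) := by gcongr
    linarith

end EnergyBound

/-! ### Upper bound: the inverted cap -/

/-- The slope profile of a ridge: it passes from `-1` to `1`, and it overshoots in such a way that
`1 - ψ²` is the derivative of a function vanishing at `±∞`. -/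
noncomputable def ridgeSlope (t : ℝ) : ℝ := t * Real.sqrt (t ^ 2 + 3) / (t ^ 2 + 1)

/-- The derivative of `ridgeSlope`. -/
noncomputable def ridgeSlopeDeriv (t : ℝ) : ℝ :=
  (3 - t ^ 2) / (Real.sqrt (t ^ 2 + 3) * (t ^ 2 + 1) ^ 2)

/-- The in-plane displacement of a ridge, a primitive of `1 - ψ²`. -/
noncomputable def ridgeShift (t : ℝ) : ℝ := t / (t ^ 2 + 1)

theorem hasDerivAt_ridgeSlope (t : ℝ) : HasDerivAt ridgeSlope (ridgeSlopeDeriv t) t := by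
  have hq : 0 < Real.sqrt (t ^ 2 + 3) := Real.sqrt_pos.2 (by positivity)
  have hq2 : Real.sqrt (t ^ 2 + 3) ^ 2 = t ^ 2 + 3 := Real.sq_sqrt (by positivity)
  have h1 : HasDerivAt (fun t : ℝ => t ^ 2 + 3) (2 * t) t := by
    simpa using (hasDerivAt_pow 2 t).add_const 3
  have h2 : HasDerivAt (fun t : ℝ => t ^ 2 + 1) (2 * t) t := by
    simpa using (hasDerivAt_pow 2 t).add_const 1
  have h3 := ((hasDerivAt_id t).mul (h1.sqrt (by positivity))).div h2 (by positivity)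
  have h4 : HasDerivAt ridgeSlope _ t := h3
  convert h4 using 1
  rw [ridgeSlopeDeriv]
  simp only [id, Pi.mul_apply]
  set q := Real.sqrt (t ^ 2 + 3)
  field_simp
  linear_combination (-(1 + t ^ 2) + 2 * t ^ 2) * hq2

theorem hasDerivAt_ridgeShift (t : ℝ) : HasDerivAt ridgeShift (1 - ridgeSlope t ^ 2) t := by
  have h2 : HasDerivAt (fun t : ℝ => t ^ 2 + 1) (2 * t) t := by
    simpa using (hasDerivAt_pow 2 t).add_const 1
  have h4 : HasDerivAt ridgeShift _ t := (hasDerivAt_id t).div h2 (by positivity)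
  convert h4 using 1
  rw [ridgeSlope, div_pow, mul_pow, Real.sq_sqrt (by positivity)]
  simp only [id]
  field_simp
  ring

theorem continuous_ridgeSlope : Continuous ridgeSlope :=
  continuous_iff_continuousAt.2 fun t => (hasDerivAt_ridgeSlope t).continuousAt

theorem continuous_ridgeShift : Continuous ridgeShift :=
  continuous_iff_continuousAt.2 fun t => (hasDerivAt_ridgeShift t).continuousAt

theorem continuous_ridgeSlopeDeriv : Continuous ridgeSlopeDeriv := by
  unfold ridgeSlopeDeriv
  refine Continuous.div (by fun_prop) (by fun_prop) fun t => ?_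
  have : 0 < Real.sqrt (t ^ 2 + 3) := Real.sqrt_pos.2 (by positivity)
  positivity

theorem ridgeSlope_sq_le (t : ℝ) : ridgeSlope t ^ 2 ≤ 2 := by
  rw [ridgeSlope, div_pow, mul_pow, Real.sq_sqrt (by positivity), div_le_iff₀ (by positivity)]
  nlinarith [sq_nonneg t, sq_nonneg (t ^ 2)]

theorem ridgeShift_sq_le (t : ℝ) : ridgeShift t ^ 2 ≤ 1 / (t ^ 2 + 1) := by
  rw [ridgeShift, div_pow, div_le_div_iff₀ (by positivity) (by positivity)]
  nlinarith [sq_nonneg t, sq_nonneg (t ^ 2)]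

theorem ridgeSlopeDeriv_sq_le (t : ℝ) : ridgeSlopeDeriv t ^ 2 ≤ 4 / (t ^ 2 + 1) := by
  rw [ridgeSlopeDeriv, div_pow, mul_pow, Real.sq_sqrt (by positivity),
    div_le_div_iff₀ (by positivity) (by positivity)]
  have hs : 0 ≤ t ^ 2 := sq_nonneg t
  set s := t ^ 2
  have h1 : (3 - s) ^ 2 ≤ 9 * (s + 1) ^ 2 := by nlinarith
  have h2 : (3 - s) ^ 2 * (s + 1) ≤ 9 * (s + 1) ^ 2 * (s + 1) := by gcongr
  have h3 : 12 * (s + 1) ^ 3 * 1 ≤ 12 * (s + 1) ^ 3 * (s + 1) := by gcongr; linarith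
  have h4 : 0 ≤ 4 * s * (s + 1) ^ 4 := by positivity
  nlinarith [pow_pos (by linarith : 0 < s + 1) 3]

theorem ridgeSlope_le (t : ℝ) : ridgeSlope t ≤ 1 + 1 / (t ^ 2 + 1) := by
  have hq := Real.sqrt_nonneg (t ^ 2 + 3)
  have hq2 : Real.sqrt (t ^ 2 + 3) ^ 2 = t ^ 2 + 3 := Real.sq_sqrt (by positivity)
  have : t * Real.sqrt (t ^ 2 + 3) ≤ t ^ 2 + 2 := by
    nlinarith [sq_nonneg (t - Real.sqrt (t ^ 2 + 3))]
  rw [ridgeSlope, div_le_iff₀ (by positivity), add_mul, one_div_mul_cancel (by positivity)]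
  linarith

theorem ridgeSlope_le_of_nonpos {t : ℝ} (ht : t ≤ 0) : ridgeSlope t ≤ -1 + 1 / (t ^ 2 + 1) := by
  have : -t ≤ Real.sqrt (t ^ 2 + 3) := Real.le_sqrt_of_sq_le (by nlinarith)
  rw [ridgeSlope, div_le_iff₀ (by positivity), add_mul, one_div_mul_cancel (by positivity)]
  nlinarith

theorem ridgeSlope_nonpos {t : ℝ} (ht : t ≤ 0) : ridgeSlope t ≤ 0 :=
  div_nonpos_of_nonpos_of_nonneg (mul_nonpos_of_nonpos_of_nonneg ht (Real.sqrt_nonneg _))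
    (by positivity)

theorem one_le_ridgeSlope {t : ℝ} (ht : 1 ≤ t) : 1 ≤ ridgeSlope t := by
  have hq2 : Real.sqrt (t ^ 2 + 3) ^ 2 = t ^ 2 + 3 := Real.sq_sqrt (by positivity)
  have h0 : 0 ≤ t * Real.sqrt (t ^ 2 + 3) := by positivity
  rw [ridgeSlope, le_div_iff₀ (by positivity), one_mul]
  refine (pow_le_pow_iff_left₀ (by positivity) h0 two_ne_zero).1 ?_
  rw [mul_pow, hq2]
  nlinarith [mul_nonneg (sub_nonneg.2 ht) (sub_nonneg.2 ht)]

theorem integral_lorentzian_le {l R : ℝ} (hl : 0 < l) :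
    ∫ r in (0 : ℝ)..1, 1 / (((r - R) / l) ^ 2 + 1) ≤ 4 * l := by
  have hd : ∀ r, HasDerivAt (fun r => l * Real.arctan ((r - R) / l))
      (1 / (((r - R) / l) ^ 2 + 1)) r := fun r => by
    have h1 : HasDerivAt (fun r => (r - R) / l) (1 / l) r :=
      ((hasDerivAt_id r).sub_const R).div_const l
    have := (h1.arctan).const_mul l
    refine this.congr_deriv ?_
    rw [add_comm (1 : ℝ)]
    field_simp
  have hc : Continuous (fun r => 1 / (((r - R) / l) ^ 2 + 1)) :=
    continuous_const.div (by fun_prop) fun r => by positivity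
  rw [intervalIntegral.integral_eq_sub_of_hasDerivAt (fun r _ => hd r) (hc.intervalIntegrable _ _)]
  have h1 := Real.arctan_lt_pi_div_two ((1 - R) / l)
  have h2 := Real.neg_pi_div_two_lt_arctan ((0 - R) / l)
  have h3 := Real.pi_le_four
  nlinarith

/-- The radius of the ridge can be chosen such that the end point condition holds exactly. -/
theorem exists_ridge_radius {l x : ℝ} (hl : 0 < l) (hl1 : l ≤ 1) (hx : 0 ≤ x) (hx1 : x ≤ 1) :
    ∃ R ∈ Icc (-1 : ℝ) 1,
      ∫ r in (0 : ℝ)..1, 2 * r * ridgeSlope ((r - R) / l) = 1 - x ^ 2 ∧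
      (0 ≤ R → R ^ 2 ≤ x ^ 2 / 2 + 4 * l) := by
  set F : ℝ → ℝ := fun R => ∫ r in (0 : ℝ)..1, 2 * r * ridgeSlope ((r - R) / l) with hF
  have cs := continuous_ridgeSlope
  have cF : Continuous F :=
    intervalIntegral.continuous_parametric_intervalIntegral_of_continuous'
      (f := fun R r => 2 * r * ridgeSlope ((r - R) / l))
      (by simp only [Function.uncurry_def]; fun_prop) 0 1
  have ci : ∀ R a b, IntervalIntegrable (fun r => 2 * r * ridgeSlope ((r - R) / l)) volume a b :=
    fun R a b => Continuous.intervalIntegrable (by fun_prop) _ _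
  have hx2 : x ^ 2 ≤ 1 := pow_le_one₀ hx hx1
  have id2 : ∀ a b : ℝ, ∫ r in a..b, 2 * r = b ^ 2 - a ^ 2 := fun a b => by
    rw [intervalIntegral.integral_const_mul, integral_id]; ring
  have i2 : ∀ a b : ℝ, IntervalIntegrable (fun r : ℝ => 2 * r) volume a b := fun a b =>
    Continuous.intervalIntegrable (by fun_prop) _ _
  -- the deflection at `r = 1` depends continuously on `R`; it is at least `1` without a ridge in
  -- `(0,1)` and nonpositive when the whole disc is inverted
  have F1 : 1 ≤ F (-1) := by
    have : ∫ r in (0 : ℝ)..1, 2 * r ≤ F (-1) := by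
      refine intervalIntegral.integral_mono_on zero_le_one (i2 0 1) (ci _ _ _) fun r hr => ?_
      have h1 : 1 ≤ (r - -1) / l := by rw [le_div_iff₀ hl]; linarith [hr.1]
      have := one_le_ridgeSlope h1
      nlinarith [hr.1]
    rw [id2] at this
    linarith
  have F2 : F 1 ≤ 0 := by
    have : F 1 ≤ ∫ _ in (0 : ℝ)..1, (0 : ℝ) := by
      refine intervalIntegral.integral_mono_on zero_le_one (ci _ _ _) (by simp) fun r hr => ?_
      exact mul_nonpos_of_nonneg_of_nonpos (by linarith [hr.1])
        (ridgeSlope_nonpos (div_nonpos_of_nonpos_of_nonneg (by linarith [hr.2]) hl.le))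
    simpa using this
  obtain ⟨R, hR, hFR⟩ := intermediate_value_Icc' (by norm_num : (-1 : ℝ) ≤ 1) cF.continuousOn
    (show 1 - x ^ 2 ∈ Icc (F 1) (F (-1)) from ⟨by linarith, by nlinarith [sq_nonneg x]⟩)
  refine ⟨R, hR, hFR, fun hR0 => ?_⟩
  set L : ℝ → ℝ := fun r => 1 / (((r - R) / l) ^ 2 + 1) with hL
  have cL : Continuous L := continuous_const.div (by fun_prop) fun r => by positivity
  have iL : ∀ a b, IntervalIntegrable (fun r => 2 * L r) volume a b := fun a b =>
    Continuous.intervalIntegrable (by fun_prop) _ _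
  have L0 : ∀ r, 0 ≤ L r := fun r => by simp only [hL]; positivity
  -- up to the Lorentzian `L`, the slope is at most `-2r` below `R` and at most `2r` above
  have A : ∫ r in (0 : ℝ)..R, 2 * r * ridgeSlope ((r - R) / l) ≤
      ∫ r in (0 : ℝ)..R, (-(2 * r) + 2 * L r) := by
    refine intervalIntegral.integral_mono_on hR0 (ci _ _ _) ((i2 _ _).neg.add (iL _ _))
      fun r hr => ?_
    have h1 := ridgeSlope_le_of_nonpos (t := (r - R) / l)
      (div_nonpos_of_nonpos_of_nonneg (by linarith [hr.2]) hl.le)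
    have h2 := mul_le_mul_of_nonneg_left h1 (by linarith [hr.1] : 0 ≤ 2 * r)
    have h3 : r * L r ≤ 1 * L r := mul_le_mul_of_nonneg_right (by linarith [hr.2, hR.2]) (L0 r)
    simp only [hL] at h3 ⊢
    linarith
  have B : ∫ r in R..1, 2 * r * ridgeSlope ((r - R) / l) ≤ ∫ r in R..1, (2 * r + 2 * L r) := by
    refine intervalIntegral.integral_mono_on hR.2 (ci _ _ _) ((i2 _ _).add (iL _ _))
      fun r hr => ?_
    have h1 := ridgeSlope_le ((r - R) / l)
    have h2 := mul_le_mul_of_nonneg_left h1 (by linarith [hr.1] : 0 ≤ 2 * r)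
    have h3 : r * L r ≤ 1 * L r := mul_le_mul_of_nonneg_right hr.2 (L0 r)
    simp only [hL] at h3 ⊢
    linarith
  have S1 := intervalIntegral.integral_add_adjacent_intervals (ci R 0 R) (ci R R 1)
  have S2 := intervalIntegral.integral_add_adjacent_intervals (iL 0 R) (iL R 1)
  have in2 : IntervalIntegrable (fun r : ℝ => -(2 * r)) volume 0 R := (i2 0 R).neg
  rw [intervalIntegral.integral_add in2 (iL _ _), intervalIntegral.integral_neg,
    id2] at A
  rw [intervalIntegral.integral_add (i2 _ _) (iL _ _), id2] at B
  have C : ∫ r in (0 : ℝ)..1, 2 * L r ≤ 8 * l := by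
    rw [intervalIntegral.integral_const_mul]
    have := integral_lorentzian_le (R := R) hl
    linarith
  have hFR' : ∫ r in (0 : ℝ)..1, 2 * r * ridgeSlope ((r - R) / l) = 1 - x ^ 2 := hFR
  linarith

/-- The inverted cap: inside a radius `R ≈ √(δ/2)` the paraboloid is reflected, and the ridge has
width `ℓ = √h`. The energy is estimated with `h = ℓ²` and `δ = x²`. -/
theorem exists_profile_energy_le {l x : ℝ} (hl : 0 < l) (hl1 : l ≤ 1) (hx : 0 ≤ x) (hx1 : x ≤ 1) :
    ∃ u k v p, Profile (x ^ 2) u k v p ∧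
      IntegrableOn (energyDensity (l ^ 2) u k v p) (Ioo 0 1) ∧
      ∫ r in Ioo 0 1, energyDensity (l ^ 2) u k v p r ≤ 10 ^ 5 * (l ^ 4 + x ^ 3 * l ^ 3) := by
  obtain ⟨R, hR, hRint, hRx⟩ := exists_ridge_radius hl hl1 hx hx1
  set T : ℝ → ℝ := fun r => (r - R) / l with hT
  have cT : Continuous T := by simp only [hT]; fun_prop
  have dT : ∀ r, HasDerivAt T (1 / l) r := fun r => ((hasDerivAt_id r).sub_const R).div_const l
  have cs := continuous_ridgeSlope.comp cT
  have cd := continuous_ridgeSlopeDeriv.comp cT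
  have ch := continuous_ridgeShift.comp cT
  simp only [Function.comp_def] at cs cd ch
  set v : ℝ → ℝ := fun r => 2 * r * ridgeSlope (T r) with hv
  set p : ℝ → ℝ := fun r => 2 * ridgeSlope (T r) + 2 * r * (ridgeSlopeDeriv (T r) * (1 / l))
    with hp
  set u : ℝ → ℝ := fun r => 4 * l * r ^ 2 * ridgeShift (T r) with hu
  set k : ℝ → ℝ := fun r => 8 * l * r * ridgeShift (T r)
    + 4 * l * r ^ 2 * ((1 - ridgeSlope (T r) ^ 2) * (1 / l)) with hk
  have dv : ∀ r, HasDerivAt v (p r) r := fun r => by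
    have h1 : HasDerivAt (fun r : ℝ => 2 * r) 2 r := by simpa using (hasDerivAt_id r).const_mul 2
    have h2 := (hasDerivAt_ridgeSlope (T r)).comp r (dT r)
    exact h1.mul h2
  have du : ∀ r, HasDerivAt u (k r) r := fun r => by
    have h1 : HasDerivAt (fun r : ℝ => 4 * l * r ^ 2) (8 * l * r) r := by
      refine ((hasDerivAt_pow 2 r).const_mul (4 * l)).congr_deriv ?_
      push_cast
      ring
    have h2 := (hasDerivAt_ridgeShift (T r)).comp r (dT r)
    exact h1.mul h2
  have cv : Continuous v := by simp only [hv]; fun_prop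
  have P : Profile (x ^ 2) u k v p :=
    ⟨PrimitiveOn.of_hasDerivAt ordConnected_Ioc (fun r _ => du r)
      (by simp only [hk]; fun_prop),
    PrimitiveOn.of_hasDerivAt ordConnected_Ioc (fun r _ => dv r)
      (by simp only [hp]; fun_prop), cv.intervalIntegrable _ _, hRint⟩
  -- the energy density: the strain `k + v² - 4r²` reduces to `8 ℓ r χ(T r)` with `χ = ridgeShift`,
  -- because `χ' = 1 - ψ²` with `ψ = ridgeSlope`
  set D : ℝ → ℝ := fun r => 80 * l ^ 2 * r ^ 3 * ridgeShift (T r) ^ 2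
    + l ^ 4 * (r * (2 * ridgeSlope (T r) + 2 * r * (ridgeSlopeDeriv (T r) * (1 / l))) ^ 2
      + 4 * r * ridgeSlope (T r) ^ 2) with hD
  have cD : Continuous D := by simp only [hD]; fun_prop
  have eD : ∀ r ∈ Ioo (0 : ℝ) 1, D r = energyDensity (l ^ 2) u k v p r := fun r hr => by
    have hr0 := hr.1.ne'
    simp only [hD, energyDensity, hu, hk, hv, hp]
    field_simp
    ring
  have iD : IntegrableOn D (Ioo 0 1) := cD.integrableOn_Icc.mono_set Ioo_subset_Icc_self
  have iE : IntegrableOn (energyDensity (l ^ 2) u k v p) (Ioo 0 1) :=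
    iD.congr_fun eD measurableSet_Ioo
  refine ⟨u, k, v, p, P, iE, ?_⟩
  rw [← setIntegral_congr_fun measurableSet_Ioo eD, ← integral_Ioc_eq_integral_Ioo,
    ← intervalIntegral.integral_of_le zero_le_one]
  -- for negative `R` there is no ridge in the disc
  set ρ := max R 0 with hρ
  have hρ0 : 0 ≤ ρ := le_max_right _ _
  have hρ1 : ρ ≤ 1 := max_le hR.2 zero_le_one
  have hρx : ρ ^ 2 ≤ x ^ 2 / 2 + 4 * l := by
    rcases le_total 0 R with h0 | h0
    · rw [hρ, max_eq_left h0]; exact hRx h0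
    · rw [hρ, max_eq_right h0]
      have : 0 ≤ x ^ 2 / 2 + 4 * l := by positivity
      simpa using this
  set L : ℝ → ℝ := fun r => 1 / (T r ^ 2 + 1) with hL
  have cL : Continuous L := continuous_const.div (by fun_prop) fun r => by positivity
  have bound : ∀ r ∈ Icc (0 : ℝ) 1, D r ≤ 448 * l ^ 2 * ρ ^ 3 * L r + 920 * l ^ 4 := by
    intro r hr
    have hr0 := hr.1
    have b1 : ridgeShift (T r) ^ 2 ≤ L r := ridgeShift_sq_le _
    have b2 := ridgeSlope_sq_le (T r)
    have b3 : ridgeSlopeDeriv (T r) ^ 2 ≤ 4 * L r := by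
      have := ridgeSlopeDeriv_sq_le (T r)
      simp only [hL]; rw [mul_one_div]; exact this
    have hL0 : 0 ≤ L r := by simp only [hL]; positivity
    -- `r ≤ ρ + |r - R|`, and the Lorentzian absorbs the powers of `|r - R|`
    set d := |r - R| with hd
    have hd0 : 0 ≤ d := abs_nonneg _
    have hd2 : d ≤ 2 := abs_le.2 ⟨by linarith [hR.2], by linarith [hR.1, hr.2]⟩
    have hrd : r ≤ ρ + d := by
      have h1 := le_abs_self (r - R)
      have h2 : R ≤ ρ := le_max_left _ _
      linarith
    have c1 : r ^ 3 ≤ 4 * (ρ ^ 3 + d ^ 3) := by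
      have h1 : r ^ 3 ≤ (ρ + d) ^ 3 := pow_le_pow_left₀ hr0 hrd 3
      nlinarith [mul_nonneg (add_nonneg hρ0 hd0) (sq_nonneg (ρ - d))]
    have c2 : d ^ 2 * L r ≤ l ^ 2 := by
      simp only [hL, hT]
      rw [hd, sq_abs, mul_one_div, div_le_iff₀ (by positivity)]
      have : l ^ 2 * (((r - R) / l) ^ 2 + 1) = (r - R) ^ 2 + l ^ 2 := by field_simp
      rw [this]
      nlinarith [sq_nonneg l]
    have c3 : d ^ 3 * L r ≤ 2 * l ^ 2 := by
      calc d ^ 3 * L r = d * (d ^ 2 * L r) := by ring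
        _ ≤ 2 * l ^ 2 := by gcongr
    have c4 : r ^ 3 * L r ≤ 4 * ρ ^ 3 * L r + 8 * l ^ 2 := by
      have := mul_le_mul_of_nonneg_right c1 hL0
      linarith
    have d1 : 80 * l ^ 2 * r ^ 3 * ridgeShift (T r) ^ 2 ≤ 80 * l ^ 2 * (r ^ 3 * L r) := by
      rw [mul_assoc (80 * l ^ 2)]; gcongr
    have d2 : (2 * ridgeSlope (T r) + 2 * r * (ridgeSlopeDeriv (T r) * (1 / l))) ^ 2 ≤
        8 * ridgeSlope (T r) ^ 2 + 8 * r ^ 2 * ridgeSlopeDeriv (T r) ^ 2 / l ^ 2 := by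
      have e : 8 * r ^ 2 * ridgeSlopeDeriv (T r) ^ 2 / l ^ 2 =
        8 * (r * (ridgeSlopeDeriv (T r) * (1 / l))) ^ 2 := by field_simp
      rw [e]
      nlinarith [sq_nonneg (ridgeSlope (T r) - r * (ridgeSlopeDeriv (T r) * (1 / l)))]
    have d3 : l ^ 4 * (r * (2 * ridgeSlope (T r)
        + 2 * r * (ridgeSlopeDeriv (T r) * (1 / l))) ^ 2 + 4 * r * ridgeSlope (T r) ^ 2) ≤
        l ^ 4 * (r * (8 * ridgeSlope (T r) ^ 2
          + 8 * r ^ 2 * ridgeSlopeDeriv (T r) ^ 2 / l ^ 2) + 4 * r * ridgeSlope (T r) ^ 2) := by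
      gcongr
    have d4 : l ^ 4 * (r * (8 * ridgeSlope (T r) ^ 2
          + 8 * r ^ 2 * ridgeSlopeDeriv (T r) ^ 2 / l ^ 2) + 4 * r * ridgeSlope (T r) ^ 2) =
        12 * l ^ 4 * r * ridgeSlope (T r) ^ 2 + 8 * l ^ 2 * r ^ 3 * ridgeSlopeDeriv (T r) ^ 2 := by
      field_simp; ring
    have d5 : 12 * l ^ 4 * r * ridgeSlope (T r) ^ 2 ≤ 12 * l ^ 4 * 1 * 2 := by
      gcongr
      exact hr.2
    have d6 : 8 * l ^ 2 * r ^ 3 * ridgeSlopeDeriv (T r) ^ 2 ≤ 8 * l ^ 2 * r ^ 3 * (4 * L r) := by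
      gcongr
    have d7 : 112 * l ^ 2 * (r ^ 3 * L r) ≤ 112 * l ^ 2 * (4 * ρ ^ 3 * L r + 8 * l ^ 2) := by
      gcongr
    simp only [hD]
    rw [d4] at d3
    linarith
  have iL : IntervalIntegrable (fun r => 448 * l ^ 2 * ρ ^ 3 * L r) volume 0 1 :=
    (continuous_const.mul cL).intervalIntegrable _ _
  have h1 : ∫ r in (0 : ℝ)..1, D r ≤
      ∫ r in (0 : ℝ)..1, (448 * l ^ 2 * ρ ^ 3 * L r + 920 * l ^ 4) :=
    intervalIntegral.integral_mono_on zero_le_one (cD.intervalIntegrable _ _)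
      (iL.add (by simp)) bound
  rw [intervalIntegral.integral_add iL (by simp), intervalIntegral.integral_const_mul] at h1
  have h2 := integral_lorentzian_le (R := R) hl
  have h3 : 448 * l ^ 2 * ρ ^ 3 * (∫ r in (0 : ℝ)..1, L r) ≤ 448 * l ^ 2 * ρ ^ 3 * (4 * l) :=
    mul_le_mul_of_nonneg_left h2 (by positivity)
  have h4 : ρ ^ 3 ≤ x ^ 3 + 8 * l := by
    rcases le_total (8 * l) (x ^ 2) with h | h
    · have : ρ ≤ x := by
        refine (pow_le_pow_iff_left₀ hρ0 hx two_ne_zero).1 ?_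
        linarith
      have : ρ ^ 3 ≤ x ^ 3 := pow_le_pow_left₀ hρ0 this 3
      linarith
    · have h5 : ρ ^ 3 ≤ ρ ^ 2 := pow_le_pow_of_le_one hρ0 hρ1 (by norm_num)
      have : 0 ≤ x ^ 3 := by positivity
      linarith
  have h5 : l ^ 3 * ρ ^ 3 ≤ l ^ 3 * (x ^ 3 + 8 * l) := by gcongr
  have h6 : ∫ _ in (0 : ℝ)..1, 920 * l ^ 4 = 920 * l ^ 4 := by simp
  have h7 : 0 ≤ x ^ 3 * l ^ 3 := by positivity
  have h8 : 0 ≤ l ^ 4 := by positivity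
  rw [h6] at h1
  linarith

/-! ### Existence of minimizers -/

open Filter Topology in
/-- Weak sequential compactness of bounded sets in `L²`, stated for functions. -/
theorem exists_weakly_convergent_subseq {μ : Measure ℝ} [IsFiniteMeasure μ] {q : ℕ → ℝ → ℝ} {M : ℝ}
    (hq : ∀ n, MemLp (q n) 2 μ) (hM : ∀ n, ∫ x, q n x ^ 2 ∂μ ≤ M) :
    ∃ φ : ℕ → ℕ, StrictMono φ ∧ ∃ Q : ℝ → ℝ, MemLp Q 2 μ ∧ ∀ ψ : ℝ → ℝ, MemLp ψ 2 μ →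
      Tendsto (fun n => ∫ x, q (φ n) x * ψ x ∂μ) atTop (𝓝 (∫ x, Q x * ψ x ∂μ)) := by
  have : Fact ((1 : ℝ≥0∞) ≤ 2) := ⟨by norm_num⟩
  have : Fact ((2 : ℝ≥0∞) ≠ ⊤) := ⟨by norm_num⟩
  have inner_eq : ∀ f g : Lp ℝ 2 μ, inner ℝ f g = ∫ x, f x * g x ∂μ := fun f g => by
    rw [L2.inner_def]
    refine integral_congr_ae (Eventually.of_forall fun x => ?_)
    simp [mul_comm]
  set F : ℕ → Lp ℝ 2 μ := fun n => (hq n).toLp (q n) with hF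
  have nF : ∀ n, ‖F n‖ ≤ Real.sqrt M := fun n => by
    refine Real.le_sqrt_of_sq_le ?_
    rw [← real_inner_self_eq_norm_sq, inner_eq]
    refine le_trans (le_of_eq (integral_congr_ae ?_)) (hM n)
    filter_upwards [(hq n).coeFn_toLp] with x hx
    rw [hF, hx, sq]
  set D : ℕ → WeakDual ℝ (Lp ℝ 2 μ) := fun n =>
    StrongDual.toWeakDual (InnerProductSpace.toDual ℝ (Lp ℝ 2 μ) (F n)) with hD
  obtain ⟨d, -, φ, hφ, hd⟩ := WeakDual.isSeqCompact_closedBall ℝ (Lp ℝ 2 μ) 0 (Real.sqrt M)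
    (x := D) (fun n => by
      simp only [mem_preimage, mem_closedBall_zero_iff]
      refine le_trans (le_of_eq ?_) (nF n)
      exact (InnerProductSpace.toDual ℝ (Lp ℝ 2 μ)).norm_map (F n))
  set Q : Lp ℝ 2 μ := (InnerProductSpace.toDual ℝ (Lp ℝ 2 μ)).symm (WeakDual.toStrongDual d)
  refine ⟨φ, hφ, Q, Lp.memLp Q, fun ψ hψ => ?_⟩
  have h := (WeakDual.eval_continuous (hψ.toLp ψ)).tendsto d |>.comp hd
  have e1 : ∀ n, ∫ x, q n x * ψ x ∂μ = D n (hψ.toLp ψ) := fun n => by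
    change _ = inner ℝ (F n) (hψ.toLp ψ)
    rw [inner_eq]
    refine integral_congr_ae ?_
    filter_upwards [(hq n).coeFn_toLp, hψ.coeFn_toLp] with x h1 h2
    rw [hF, h1, h2]
  have e2 : ∫ x, Q x * ψ x ∂μ = d (hψ.toLp ψ) := by
    have : inner ℝ Q (hψ.toLp ψ) = d (hψ.toLp ψ) := InnerProductSpace.toDual_symm_apply
    rw [← this, inner_eq]
    refine integral_congr_ae ?_
    filter_upwards [hψ.coeFn_toLp] with x h2
    rw [h2]
  simp only [e1, e2]
  exact h

/-- The truncated weight `1/√s` on `(r,1)`. -/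
noncomputable def invSqrtAbove (r : ℝ) : ℝ → ℝ := (Ioo r 1).indicator fun s => 1 / Real.sqrt s

theorem memLp_invSqrtAbove {r : ℝ} (hr : 0 < r) :
    MemLp (invSqrtAbove r) 2 (volume.restrict (Ioo 0 1)) := by
  refine MemLp.of_bound (C := 1 / Real.sqrt r) ?_ (Filter.Eventually.of_forall fun s => ?_)
  · refine AEMeasurable.aestronglyMeasurable (Measurable.aemeasurable ?_)
    exact (measurable_const.div Real.continuous_sqrt.measurable).indicator measurableSet_Ioo
  · unfold invSqrtAbove
    by_cases hs : s ∈ Ioo r 1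
    · rw [indicator_of_mem hs, Real.norm_of_nonneg (by positivity)]
      exact one_div_le_one_div_of_le (Real.sqrt_pos.2 hr) (Real.sqrt_le_sqrt hs.1.le)
    · rw [indicator_of_notMem hs, norm_zero]
      positivity

theorem mul_invSqrtAbove (q : ℝ → ℝ) (r : ℝ) :
    (fun s => q s * invSqrtAbove r s) = (Ioo r 1).indicator fun s => q s / Real.sqrt s := by
  ext s
  unfold invSqrtAbove
  by_cases hs : s ∈ Ioo r 1
  · rw [indicator_of_mem hs, indicator_of_mem hs]; ring
  · rw [indicator_of_notMem hs, indicator_of_notMem hs, mul_zero]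

theorem intervalIntegrable_div_sqrt {q : ℝ → ℝ} (hq : MemLp q 2 (volume.restrict (Ioo 0 1)))
    {r : ℝ} (hr : r ∈ Ioc (0 : ℝ) 1) :
    IntervalIntegrable (fun s => q s / Real.sqrt s) volume r 1 := by
  rw [intervalIntegrable_iff_integrableOn_Ioo_of_le hr.2]
  have h := hq.integrable_mul (memLp_invSqrtAbove hr.1)
  rw [show q * invSqrtAbove r = fun s => q s * invSqrtAbove r s from rfl, mul_invSqrtAbove,
    integrable_indicator_iff measurableSet_Ioo] at h
  have e : (volume.restrict (Ioo (0 : ℝ) 1)).restrict (Ioo r 1) = volume.restrict (Ioo r 1) := by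
    rw [Measure.restrict_restrict measurableSet_Ioo,
      inter_eq_left.2 (Ioo_subset_Ioo_left hr.1.le)]
  rwa [IntegrableOn, e] at h

theorem integral_div_sqrt (q : ℝ → ℝ) {r : ℝ} (hr : r ∈ Ioc (0 : ℝ) 1) :
    ∫ s in r..1, q s / Real.sqrt s = ∫ s in Ioo 0 1, q s * invSqrtAbove r s := by
  rw [mul_invSqrtAbove, setIntegral_indicator measurableSet_Ioo,
    inter_eq_right.2 (Ioo_subset_Ioo_left hr.1.le), intervalIntegral.integral_of_le hr.2,
    integral_Ioc_eq_integral_Ioo]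

/-- Primitives on `(0,1]` prescribed by their value at `1`. -/
theorem PrimitiveOn.of_terminal {f f' : ℝ → ℝ} (c : ℝ)
    (hi : ∀ r ∈ Ioc (0 : ℝ) 1, IntervalIntegrable f' volume r 1)
    (hf : ∀ r ∈ Ioc (0 : ℝ) 1, f r = c - ∫ s in r..1, f' s) : PrimitiveOn (Ioc 0 1) f f' := by
  intro a ha b hb
  refine ⟨(hi a ha).trans (hi b hb).symm, ?_⟩
  rw [hf a ha, hf b hb, ← intervalIntegral.integral_add_adjacent_intervals
    ((hi a ha).trans (hi b hb).symm) (hi b hb)]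
  ring

namespace EnergyBound

variable {E h : ℝ} {u k v p : ℝ → ℝ}

/-- The slope `w'` is bounded by the bending energy. -/
theorem v_sq_le (H : EnergyBound E h u k v p) {r : ℝ} (hr : r ∈ Ioc (0 : ℝ) 1) :
    v r ^ 2 ≤ 4 * (E / h ^ 2) := by
  have := H.prim_v.sq_le H.int_v H.int_p hr
  linarith [H.le_v, H.le_p]

/-- The displacement `u` is bounded by the energy, since `u'` is the sum of the strain, which is
bounded in the weighted `L²` norm, and of the bounded function `4r² - w'²`. -/
theorem u_sq_le (H : EnergyBound E h u k v p) {r : ℝ} (hr : r ∈ Ioc (0 : ℝ) 1) :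
    u r ^ 2 ≤ 2 * (E + (3 * E + (3 * (4 * (E / h ^ 2)) ^ 2 + 48))) := by
  set B := 4 * (E / h ^ 2)
  have i1 : IntegrableOn (fun _ : ℝ => 3 * B ^ 2 + 48) (Ioo 0 1) := by simp
  have i2 := (H.int_g.const_mul 3).add i1
  have pt : ∀ r ∈ Ioo (0 : ℝ) 1, r * k r ^ 2 ≤
      3 * (r * (k r + v r ^ 2 - 4 * r ^ 2) ^ 2) + (3 * B ^ 2 + 48) := fun r hr => by
    have hv := H.v_sq_le (Ioo_subset_Ioc_self hr)
    have h1 : k r ^ 2 ≤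
        3 * ((k r + v r ^ 2 - 4 * r ^ 2) ^ 2 + (v r ^ 2) ^ 2 + (4 * r ^ 2) ^ 2) := by
      nlinarith [sq_nonneg ((k r + v r ^ 2 - 4 * r ^ 2) + v r ^ 2),
        sq_nonneg ((k r + v r ^ 2 - 4 * r ^ 2) - 4 * r ^ 2), sq_nonneg (v r ^ 2 + 4 * r ^ 2)]
    have h2 : (v r ^ 2) ^ 2 ≤ B ^ 2 := by gcongr
    have h3 : (4 * r ^ 2) ^ 2 ≤ 16 := by
      have := pow_le_one₀ hr.1.le hr.2.le (n := 4)
      nlinarith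
    have h4 : r * ((v r ^ 2) ^ 2 + (4 * r ^ 2) ^ 2) ≤ 1 * (B ^ 2 + 16) :=
      mul_le_mul hr.2.le (by linarith) (by positivity) zero_le_one
    have h5 := mul_le_mul_of_nonneg_left h1 hr.1.le
    linarith
  have ik : IntegrableOn (fun r => r * k r ^ 2) (Ioo 0 1) := by
    refine i2.mono'
      (continuous_id.aestronglyMeasurable.mul (H.prim_u.aestronglyMeasurable_deriv.pow 2)) ?_
    filter_upwards [ae_restrict_mem measurableSet_Ioo] with r hr
    have := hr.1
    rw [Real.norm_of_nonneg (by positivity)]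
    exact pt r hr
  have h1 := setIntegral_mono_on ik i2 measurableSet_Ioo pt
  simp only [Pi.add_apply] at h1
  rw [integral_add (H.int_g.const_mul 3) i1, integral_const_mul] at h1
  have h2 : ∫ _ in Ioo (0 : ℝ) 1, (3 * B ^ 2 + 48) = 3 * B ^ 2 + 48 := by simp
  have h3 := H.prim_u.sq_le H.int_u ik hr
  linarith [H.le_u, H.le_g]

end EnergyBound

theorem memLp_sqrt_mul {f : ℝ → ℝ} (hf : AEStronglyMeasurable f (volume.restrict (Ioo 0 1)))
    (hi : IntegrableOn (fun r => r * f r ^ 2) (Ioo 0 1)) :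
    MemLp (fun r => Real.sqrt r * f r) 2 (volume.restrict (Ioo 0 1)) := by
  refine (memLp_two_iff_integrable_sq (Real.continuous_sqrt.aestronglyMeasurable.mul hf)).2 ?_
  refine hi.congr ?_
  filter_upwards [ae_restrict_mem measurableSet_Ioo] with r hr
  simp only [Pi.mul_apply, mul_pow, Real.sq_sqrt hr.1.le]

theorem integral_sqrt_mul_sq (f : ℝ → ℝ) :
    ∫ r in Ioo 0 1, (Real.sqrt r * f r) ^ 2 = ∫ r in Ioo 0 1, r * f r ^ 2 :=
  setIntegral_congr_fun measurableSet_Ioo fun r hr => by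
    simp only [mul_pow, Real.sq_sqrt hr.1.le]

theorem integral_sqrt_mul_div_sqrt (f : ℝ → ℝ) {r : ℝ} (hr : r ∈ Ioc (0 : ℝ) 1) :
    ∫ s in r..1, Real.sqrt s * f s / Real.sqrt s = ∫ s in r..1, f s := by
  refine intervalIntegral.integral_congr fun s hs => ?_
  rw [uIcc_of_le hr.2] at hs
  have : Real.sqrt s ≠ 0 := (Real.sqrt_pos.2 (hr.1.trans_le hs.1)).ne'
  field_simp

open Filter Topology in
/-- The lower semicontinuous half of the direct method: if the terms without derivatives converge
pointwise and the others weakly in `L²`, then the energy of the limit is at most the limit of the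
energies. -/
theorem lintegral_add_le_of_tendsto {A : ℕ → ℝ → ℝ} {a : ℝ → ℝ} {G P : ℕ → ℝ → ℝ} {g p : ℝ → ℝ}
    {h m : ℝ} {e : ℕ → ℝ} (he : Tendsto e atTop (𝓝 m))
    (hA0 : ∀ n, ∀ r ∈ Ioo (0 : ℝ) 1, 0 ≤ A n r)
    (hA : ∀ n, IntegrableOn (A n) (Ioo 0 1))
    (hAa : ∀ r ∈ Ioo (0 : ℝ) 1, Tendsto (fun n => A n r) atTop (𝓝 (a r)))
    (hG : ∀ n, MemLp (G n) 2 (volume.restrict (Ioo 0 1)))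
    (hP : ∀ n, MemLp (P n) 2 (volume.restrict (Ioo 0 1)))
    (hg : MemLp g 2 (volume.restrict (Ioo 0 1))) (hp : MemLp p 2 (volume.restrict (Ioo 0 1)))
    (hGg : Tendsto (fun n => ∫ r in Ioo 0 1, G n r * g r) atTop (𝓝 (∫ r in Ioo 0 1, g r * g r)))
    (hPp : Tendsto (fun n => ∫ r in Ioo 0 1, P n r * p r) atTop (𝓝 (∫ r in Ioo 0 1, p r * p r)))
    (hE : ∀ n, (∫ r in Ioo 0 1, A n r) + (∫ r in Ioo 0 1, G n r ^ 2)
      + h ^ 2 * ∫ r in Ioo 0 1, P n r ^ 2 = e n) :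
    ∫⁻ r in Ioo 0 1, ENNReal.ofReal (a r + g r ^ 2 + h ^ 2 * p r ^ 2) ≤ ENNReal.ofReal m := by
  -- `∫ q² ≥ 2 ∫ q Q - ∫ Q²` makes the squares of the weakly convergent terms affine
  have conv : ∀ {q Q : ℝ → ℝ}, MemLp q 2 (volume.restrict (Ioo 0 1)) →
      MemLp Q 2 (volume.restrict (Ioo 0 1)) →
      2 * (∫ r in Ioo 0 1, q r * Q r) - ∫ r in Ioo 0 1, Q r * Q r ≤ ∫ r in Ioo 0 1, q r ^ 2 := by
    intro q Q hq hQ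
    have i1 : IntegrableOn (fun r => q r * Q r) (Ioo 0 1) := hq.integrable_mul hQ
    have i2 : IntegrableOn (fun r => Q r * Q r) (Ioo 0 1) := hQ.integrable_mul hQ
    rw [← integral_const_mul, ← integral_sub (i1.const_mul 2) i2]
    refine integral_mono ((i1.const_mul 2).sub i2) hq.integrable_sq fun r => ?_
    nlinarith [sq_nonneg (q r - Q r)]
  set c := (∫ r in Ioo (0 : ℝ) 1, g r * g r) + h ^ 2 * ∫ r in Ioo (0 : ℝ) 1, p r * p r with hc
  set b : ℕ → ℝ := fun n => e n
    - (2 * (∫ r in Ioo 0 1, G n r * g r) - ∫ r in Ioo 0 1, g r * g r)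
    - h ^ 2 * (2 * (∫ r in Ioo 0 1, P n r * p r) - ∫ r in Ioo 0 1, p r * p r) with hb
  have ab : ∀ n, ∫ r in Ioo 0 1, A n r ≤ b n := fun n => by
    have h1 := conv (hG n) hg
    have h2 := mul_le_mul_of_nonneg_left (conv (hP n) hp) (sq_nonneg h)
    have := hE n
    simp only [hb]
    linarith
  have bl : Tendsto b atTop (𝓝 (m - c)) := by
    have := (he.sub ((hGg.const_mul 2).sub_const (∫ r in Ioo 0 1, g r * g r))).sub
      (((hPp.const_mul 2).sub_const (∫ r in Ioo 0 1, p r * p r)).const_mul (h ^ 2))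
    convert this using 2
    rw [hc]; ring
  have b0 : 0 ≤ m - c := ge_of_tendsto' bl fun n =>
    (setIntegral_nonneg measurableSet_Ioo (hA0 n)).trans (ab n)
  have fatou : ∫⁻ r in Ioo 0 1, ENNReal.ofReal (a r) ≤ ENNReal.ofReal (m - c) := by
    have e1 : ∫⁻ r in Ioo 0 1, ENNReal.ofReal (a r) =
        ∫⁻ r in Ioo 0 1, liminf (fun n => ENNReal.ofReal (A n r)) atTop :=
      setLIntegral_congr_fun measurableSet_Ioo fun r hr =>
        ((ENNReal.continuous_ofReal.tendsto _).comp (hAa r hr)).liminf_eq.symm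
    rw [e1]
    refine (lintegral_liminf_le' fun n =>
      (hA n).aestronglyMeasurable.aemeasurable.ennreal_ofReal).trans ?_
    rw [← ((ENNReal.continuous_ofReal.tendsto _).comp bl).liminf_eq]
    refine liminf_le_liminf (Eventually.of_forall fun n => ?_)
    rw [← ofReal_integral_eq_lintegral_ofReal (hA n)]
    · exact ENNReal.ofReal_le_ofReal (ab n)
    · filter_upwards [ae_restrict_mem measurableSet_Ioo] with r hr using hA0 n r hr
  have ic : IntegrableOn (fun r => g r ^ 2 + h ^ 2 * p r ^ 2) (Ioo 0 1) :=
    hg.integrable_sq.add (hp.integrable_sq.const_mul _)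
  have ec : ∫ r in Ioo 0 1, (g r ^ 2 + h ^ 2 * p r ^ 2) = c := by
    rw [integral_add hg.integrable_sq (hp.integrable_sq.const_mul _), integral_const_mul, hc]
    simp only [sq]
  have c0 : 0 ≤ c := by
    rw [← ec]
    exact integral_nonneg fun r => by positivity
  calc ∫⁻ r in Ioo 0 1, ENNReal.ofReal (a r + g r ^ 2 + h ^ 2 * p r ^ 2)
      ≤ ∫⁻ r in Ioo 0 1, (ENNReal.ofReal (a r) + ENNReal.ofReal (g r ^ 2 + h ^ 2 * p r ^ 2)) :=
        lintegral_mono fun r => by rw [add_assoc]; exact ENNReal.ofReal_add_le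
    _ = (∫⁻ r in Ioo 0 1, ENNReal.ofReal (a r)) + ENNReal.ofReal c := by
        rw [lintegral_add_right' _ ic.aestronglyMeasurable.aemeasurable.ennreal_ofReal,
          ← ofReal_integral_eq_lintegral_ofReal ic, ec]
        exact Eventually.of_forall fun r => by positivity
    _ ≤ ENNReal.ofReal (m - c) + ENNReal.ofReal c := by gcongr
    _ = ENNReal.ofReal m := by rw [← ENNReal.ofReal_add b0 c0, sub_add_cancel]

open Filter Topology in
/-- Profiles with convergent energies have a limit profile of at most the limiting energy. The
functions `√r w''` and `√r (u' + w'² - 4r²)` are bounded in `L²` and converge weakly along a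
subsequence. Then `w'` converges pointwise and boundedly, so that the nonlinear term `∫ w'²`, hence
`u`, and the boundary condition pass to the limit. -/
theorem exists_limit_profile {h δ m : ℝ} (hh : 0 < h) {U K V P : ℕ → ℝ → ℝ}
    (hprof : ∀ n, Profile δ (U n) (K n) (V n) (P n))
    (hint : ∀ n, IntegrableOn (energyDensity h (U n) (K n) (V n) (P n)) (Ioo 0 1))
    (hlim : Tendsto (fun n => ∫ r in Ioo 0 1, energyDensity h (U n) (K n) (V n) (P n) r) atTop
      (𝓝 m)) :
    ∃ u k v p, Profile δ u k v p ∧ reducedEnergy h u k v p ≤ ENNReal.ofReal m := by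
  obtain ⟨M, hM⟩ := hlim.bddAbove_range
  have H : ∀ n, EnergyBound M h (U n) (K n) (V n) (P n) := fun n =>
    EnergyBound.of_integrable hh (hprof n).prim_u (hprof n).prim_v (hint n)
      (hM (mem_range_self n))
  set G : ℕ → ℝ → ℝ := fun n r => K n r + V n r ^ 2 - 4 * r ^ 2 with hG
  have mG : ∀ n, AEStronglyMeasurable (G n) (volume.restrict (Ioo 0 1)) := fun n =>
    ((hprof n).prim_u.aestronglyMeasurable_deriv.add
      ((hprof n).prim_v.aestronglyMeasurable.pow 2)).sub
      (by fun_prop : Continuous fun r : ℝ => 4 * r ^ 2).aestronglyMeasurable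
  have LG := fun n => memLp_sqrt_mul (mG n) (H n).int_g
  have LP := fun n => memLp_sqrt_mul (hprof n).prim_v.aestronglyMeasurable_deriv (H n).int_p
  have one_mem : (1 : ℝ) ∈ Ioc (0 : ℝ) 1 := ⟨one_pos, le_rfl⟩
  -- the boundary values of `w'` and `u` at `r = 1` converge along a further subsequence
  obtain ⟨φ₁, hφ₁, p, hp, hpw⟩ := exists_weakly_convergent_subseq LP
    (fun n => (integral_sqrt_mul_sq (P n)).trans_le (H n).le_p)
  obtain ⟨φ₂, hφ₂, g, hg, hgw⟩ := exists_weakly_convergent_subseq (fun n => LG (φ₁ n))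
    (fun n => (integral_sqrt_mul_sq (G (φ₁ n))).trans_le (H (φ₁ n)).le_g)
  obtain ⟨α, -, φ₃, hφ₃, hα⟩ := tendsto_subseq_of_bounded
    (x := fun n => V (φ₁ (φ₂ n)) 1) (Metric.isBounded_Icc _ _)
    (fun n => abs_le.1 (Real.abs_le_sqrt ((H (φ₁ (φ₂ n))).v_sq_le one_mem)))
  obtain ⟨β, -, φ₄, hφ₄, hβ⟩ := tendsto_subseq_of_bounded
    (x := fun n => U (φ₁ (φ₂ (φ₃ n))) 1) (Metric.isBounded_Icc _ _)
    (fun n => abs_le.1 (Real.abs_le_sqrt ((H (φ₁ (φ₂ (φ₃ n)))).u_sq_le one_mem)))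
  set φ : ℕ → ℕ := fun n => φ₁ (φ₂ (φ₃ (φ₄ n))) with hφ
  have t₄ := hφ₄.tendsto_atTop
  have t₃ := hφ₃.tendsto_atTop.comp t₄
  have t₂ := hφ₂.tendsto_atTop.comp t₃
  have tφ : Tendsto φ atTop atTop := hφ₁.tendsto_atTop.comp t₂
  have hpw : ∀ ψ : ℝ → ℝ, MemLp ψ 2 (volume.restrict (Ioo 0 1)) →
      Tendsto (fun n => ∫ r in Ioo 0 1, Real.sqrt r * P (φ n) r * ψ r) atTop
        (𝓝 (∫ r in Ioo 0 1, p r * ψ r)) := fun ψ hψ => (hpw ψ hψ).comp t₂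
  have hgw : ∀ ψ : ℝ → ℝ, MemLp ψ 2 (volume.restrict (Ioo 0 1)) →
      Tendsto (fun n => ∫ r in Ioo 0 1, Real.sqrt r * G (φ n) r * ψ r) atTop
        (𝓝 (∫ r in Ioo 0 1, g r * ψ r)) := fun ψ hψ => (hgw ψ hψ).comp t₃
  have hα : Tendsto (fun n => V (φ n) 1) atTop (𝓝 α) := hα.comp t₄
  have hβ : Tendsto (fun n => U (φ n) 1) atTop (𝓝 β) := hβ
  -- the limit of `w'`
  set v : ℝ → ℝ := fun r => α - ∫ s in r..1, p s / Real.sqrt s with hv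
  have prim_v : PrimitiveOn (Ioc 0 1) v fun s => p s / Real.sqrt s :=
    PrimitiveOn.of_terminal α (fun r hr => intervalIntegrable_div_sqrt hp hr) fun _ _ => rfl
  have limV : ∀ r ∈ Ioc (0 : ℝ) 1, Tendsto (fun n => V (φ n) r) atTop (𝓝 (v r)) := fun r hr => by
    have h1 := hα.sub (hpw _ (memLp_invSqrtAbove hr.1))
    rw [← integral_div_sqrt p hr] at h1
    refine h1.congr fun n => ?_
    rw [← integral_div_sqrt (fun r => Real.sqrt r * P (φ n) r) hr,
      integral_sqrt_mul_div_sqrt _ hr, (hprof (φ n)).prim_v.integral_eq hr one_mem]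
    ring
  set B := 4 * (M / h ^ 2)
  have bV : ∀ n, ∀ r ∈ Ioc (0 : ℝ) 1, V n r ^ 2 ≤ B := fun n r hr => (H n).v_sq_le hr
  have bv : ∀ r ∈ Ioc (0 : ℝ) 1, v r ^ 2 ≤ B := fun r hr =>
    le_of_tendsto' ((limV r hr).pow 2) fun n => bV (φ n) r hr
  have mV : ∀ {f f' : ℝ → ℝ}, PrimitiveOn (Ioc 0 1) f f' →
      AEStronglyMeasurable f (volume.restrict (uIoc 0 1)) := fun hf => by
    rw [uIoc_of_le zero_le_one]
    exact hf.continuousOn_Ioc.aestronglyMeasurable measurableSet_Ioc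
  have int_v : IntervalIntegrable v volume 0 1 := by
    refine (intervalIntegrable_const (c := Real.sqrt B)).mono_fun' (mV prim_v) ?_
    filter_upwards [ae_restrict_mem measurableSet_uIoc] with r hr
    rw [uIoc_of_le zero_le_one] at hr
    exact Real.abs_le_sqrt (bv r hr)
  have integral_v : ∫ r in (0 : ℝ)..1, v r = 1 - δ := by
    have h1 : Tendsto (fun n => ∫ r in (0 : ℝ)..1, V (φ n) r) atTop
        (𝓝 (∫ r in (0 : ℝ)..1, v r)) := by
      refine intervalIntegral.tendsto_integral_filter_of_dominated_convergence
        (fun _ => Real.sqrt B) (Eventually.of_forall fun n => mV (hprof (φ n)).prim_v)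
        (Eventually.of_forall fun n => ae_of_all _ fun r hr => ?_) (by simp)
        (ae_of_all _ fun r hr => ?_) <;> rw [uIoc_of_le zero_le_one] at hr
      · exact Real.abs_le_sqrt (bV _ r hr)
      · exact limV r hr
    simp only [(hprof _).integral_v] at h1
    exact tendsto_nhds_unique h1 tendsto_const_nhds
  -- the limit of `u`
  set k : ℝ → ℝ := fun s => g s / Real.sqrt s - v s ^ 2 + 4 * s ^ 2 with hk
  set u : ℝ → ℝ := fun r => β - ∫ s in r..1, k s with hu
  have isq : ∀ {f f' : ℝ → ℝ}, PrimitiveOn (Ioc 0 1) f f' → ∀ r ∈ Ioc (0 : ℝ) 1,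
      IntervalIntegrable (fun s => f s ^ 2) volume r 1 := fun hf r hr =>
    ((hf.continuousOn_uIcc ordConnected_Ioc hr one_mem).pow 2).intervalIntegrable
  have i4 : ∀ r : ℝ, IntervalIntegrable (fun s : ℝ => 4 * s ^ 2) volume r 1 := fun r =>
    Continuous.intervalIntegrable (by fun_prop) _ _
  have prim_u : PrimitiveOn (Ioc 0 1) u k :=
    PrimitiveOn.of_terminal β (fun r hr =>
      ((intervalIntegrable_div_sqrt hg hr).sub (isq prim_v r hr)).add (i4 r)) fun _ _ => rfl
  have limV2 : ∀ r ∈ Ioc (0 : ℝ) 1, Tendsto (fun n => ∫ s in r..1, V (φ n) s ^ 2) atTop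
      (𝓝 (∫ s in r..1, v s ^ 2)) := fun r hr => by
    have hsub : ∀ s ∈ uIoc r 1, s ∈ Ioc (0 : ℝ) 1 := fun s hs => by
      rw [uIoc_of_le hr.2] at hs
      exact ⟨hr.1.trans hs.1, hs.2⟩
    refine intervalIntegral.tendsto_integral_filter_of_dominated_convergence (fun _ => B)
      (Eventually.of_forall fun n => (isq (hprof (φ n)).prim_v r hr).def'.aestronglyMeasurable)
      (Eventually.of_forall fun n => ae_of_all _ fun s hs => ?_) (by simp)
      (ae_of_all _ fun s hs => (limV s (hsub s hs)).pow 2)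
    rw [Real.norm_of_nonneg (sq_nonneg _)]
    exact bV _ s (hsub s hs)
  have limU : ∀ r ∈ Ioc (0 : ℝ) 1, Tendsto (fun n => U (φ n) r) atTop (𝓝 (u r)) := fun r hr => by
    have h1 := hβ.sub (((hgw _ (memLp_invSqrtAbove hr.1)).sub (limV2 r hr)).add_const
      (∫ s in r..1, 4 * s ^ 2))
    rw [← integral_div_sqrt g hr] at h1
    have h2 : u r = β - ((∫ s in r..1, g s / Real.sqrt s) - (∫ s in r..1, v s ^ 2)
        + ∫ s in r..1, 4 * s ^ 2) := by
      simp only [hu, hk]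
      rw [intervalIntegral.integral_add ((intervalIntegrable_div_sqrt hg hr).sub (isq prim_v r hr))
        (i4 r), intervalIntegral.integral_sub (intervalIntegrable_div_sqrt hg hr) (isq prim_v r hr)]
    rw [h2]
    refine h1.congr fun n => ?_
    have iK := (hprof (φ n)).prim_u.intervalIntegrable hr one_mem
    have iV := isq (hprof (φ n)).prim_v r hr
    rw [← integral_div_sqrt (fun r => Real.sqrt r * G (φ n) r) hr,
      integral_sqrt_mul_div_sqrt _ hr]
    simp only [hG]
    rw [intervalIntegral.integral_sub (iK.add iV) (i4 r), intervalIntegral.integral_add iK iV,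
      (hprof (φ n)).prim_u.integral_eq hr one_mem]
    ring
  refine ⟨u, k, v, fun s => p s / Real.sqrt s, ⟨prim_u, prim_v, int_v, integral_v⟩, ?_⟩
  have key := lintegral_add_le_of_tendsto (h := h) (hlim.comp tφ)
    (A := fun n r => U (φ n) r ^ 2 / r + h ^ 2 * (V (φ n) r ^ 2 / r))
    (a := fun r => u r ^ 2 / r + h ^ 2 * (v r ^ 2 / r))
    (fun n r hr => by have := hr.1; positivity)
    (fun n => (H (φ n)).int_u.add ((H (φ n)).int_v.const_mul _))
    (fun r hr => (((limU r (Ioo_subset_Ioc_self hr)).pow 2).div_const r).add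
      ((((limV r (Ioo_subset_Ioc_self hr)).pow 2).div_const r).const_mul _))
    (fun n => LG (φ n)) (fun n => LP (φ n)) hg hp (hgw g hg) (hpw p hp) (fun n => by
      have i1 : IntegrableOn (fun r => U (φ n) r ^ 2 / r + h ^ 2 * (V (φ n) r ^ 2 / r)) (Ioo 0 1) :=
        (H (φ n)).int_u.add ((H (φ n)).int_v.const_mul _)
      have i2 : IntegrableOn (fun r => r * G (φ n) r ^ 2) (Ioo 0 1) := (H (φ n)).int_g
      have i12 : IntegrableOn (fun r => U (φ n) r ^ 2 / r + h ^ 2 * (V (φ n) r ^ 2 / r)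
        + r * G (φ n) r ^ 2) (Ioo 0 1) := i1.add i2
      rw [integral_sqrt_mul_sq, integral_sqrt_mul_sq, ← integral_const_mul,
        ← integral_add i1 i2, ← integral_add i12 ((H (φ n)).int_p.const_mul _)]
      refine integral_congr_ae (Eventually.of_forall fun r => ?_)
      simp only [energyDensity, hG]
      ring)
  refine le_trans (le_of_eq (setLIntegral_congr_fun measurableSet_Ioo fun r hr => ?_)) key
  have hs2 := Real.sq_sqrt hr.1.le
  have hs : Real.sqrt r ≠ 0 := (Real.sqrt_pos.2 hr.1).ne'
  have e1 : r * (g r / Real.sqrt r) ^ 2 = g r ^ 2 := by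
    rw [div_pow, hs2]; field_simp [hr.1.ne']
  have e2 : r * (p r / Real.sqrt r) ^ 2 = p r ^ 2 := by
    rw [div_pow, hs2]; field_simp [hr.1.ne']
  simp only [energyDensity, hk]
  rw [show g r / Real.sqrt r - v r ^ 2 + 4 * r ^ 2 + v r ^ 2 - 4 * r ^ 2 = g r / Real.sqrt r by
    ring, e1, e2]
  congr 1
  ring

open Filter Topology in
theorem exists_minimizing_profile {h δ : ℝ} (hh : 0 < h)
    (hne : ∃ u k v p, Profile δ u k v p ∧ IntegrableOn (energyDensity h u k v p) (Ioo 0 1)) :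
    ∃ u k v p, Profile δ u k v p ∧ IntegrableOn (energyDensity h u k v p) (Ioo 0 1) ∧
      ∀ u' k' v' p', Profile δ u' k' v' p' →
        IntegrableOn (energyDensity h u' k' v' p') (Ioo 0 1) →
        ∫ r in Ioo 0 1, energyDensity h u k v p r ≤
          ∫ r in Ioo 0 1, energyDensity h u' k' v' p' r := by
  set S : Set ℝ := {e | ∃ u k v p, Profile δ u k v p ∧
    IntegrableOn (energyDensity h u k v p) (Ioo 0 1) ∧
    ∫ r in Ioo 0 1, energyDensity h u k v p r = e} with hS
  have nonneg : ∀ u k v p : ℝ → ℝ, 0 ≤ ∫ r in Ioo (0 : ℝ) 1, energyDensity h u k v p r :=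
    fun u k v p => setIntegral_nonneg measurableSet_Ioo fun r hr =>
      energyDensity_nonneg h u k v p hr.1
  have hbdd : BddBelow S := ⟨0, by
    rintro e ⟨u, k, v, p, -, -, rfl⟩
    exact nonneg u k v p⟩
  have hSne : S.Nonempty := by
    obtain ⟨u, k, v, p, h1, h2⟩ := hne
    exact ⟨_, u, k, v, p, h1, h2, rfl⟩
  obtain ⟨e, -, he, heS⟩ := exists_seq_tendsto_sInf hSne hbdd
  choose U K V P hprof hint hval using heS
  have hm0 : 0 ≤ sInf S := Real.sInf_nonneg (by
    rintro e ⟨u, k, v, p, -, -, rfl⟩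
    exact nonneg u k v p)
  obtain ⟨u, k, v, p, hp, hle⟩ := exists_limit_profile hh hprof hint (by simpa only [hval] using he)
  have hi := integrableOn_energyDensity hp.prim_u hp.prim_v
    (hle.trans_lt ENNReal.ofReal_lt_top).ne
  rw [reducedEnergy_eq_ofReal hi, ENNReal.ofReal_le_ofReal_iff hm0] at hle
  exact ⟨u, k, v, p, hp, hi, fun u' k' v' p' h1 h2 =>
    hle.trans (csInf_le hbdd ⟨u', k', v', p', h1, h2, rfl⟩)⟩

/-! ### The energy scaling law -/

theorem mainTheorem3 :
    ∃ C : ℝ, 0 < C ∧ ∀ h δ : ℝ, 0 < h → h ≤ 1 / 2 → 0 ≤ δ → δ ≤ 1 →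
      ∃ m : ℝ, IsLeast (energy h '' admissible δ) (ENNReal.ofReal m) ∧
        1 / C * (h ^ 2 + δ ^ (3 / 2 : ℝ) * h ^ (3 / 2 : ℝ)) ≤ m ∧
        m ≤ C * (h ^ 2 + δ ^ (3 / 2 : ℝ) * h ^ (3 / 2 : ℝ)) := by
  refine ⟨10 ^ 8, by norm_num, fun h δ hh hh2 hδ hδ1 => ?_⟩
  obtain ⟨l, hl, rfl⟩ : ∃ l, 0 < l ∧ h = l ^ 2 :=
    ⟨Real.sqrt h, Real.sqrt_pos.2 hh, (Real.sq_sqrt hh.le).symm⟩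
  obtain ⟨x, hx, rfl⟩ : ∃ x, 0 ≤ x ∧ δ = x ^ 2 :=
    ⟨Real.sqrt δ, Real.sqrt_nonneg δ, (Real.sq_sqrt hδ).symm⟩
  have hx1 : x ≤ 1 := by nlinarith
  have hl1 : l ≤ 1 := by nlinarith
  have pow32 : ∀ y : ℝ, 0 ≤ y → (y ^ 2) ^ (3 / 2 : ℝ) = y ^ 3 := fun y hy => by
    rw [← Real.rpow_natCast_mul hy, ← Real.rpow_natCast]
    norm_num
  rw [pow32 x hx, pow32 l hl.le, ← pow_mul]
  obtain ⟨u₀, k₀, v₀, p₀, hP₀, hi₀, hle₀⟩ := exists_profile_energy_le hl hl1 hx hx1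
  obtain ⟨u, k, v, p, hP, hi, hmin⟩ := exists_minimizing_profile hh ⟨u₀, k₀, v₀, p₀, hP₀, hi₀⟩
  set m := ∫ r in Ioo 0 1, energyDensity (l ^ 2) u k v p r with hm
  have hred : reducedEnergy (l ^ 2) u k v p = ENNReal.ofReal m := reducedEnergy_eq_ofReal hi
  have hm0 : 0 ≤ m := setIntegral_nonneg measurableSet_Ioo fun r hr =>
    energyDensity_nonneg _ _ _ _ _ hr.1
  refine ⟨m, ⟨?_, ?_⟩, ?_, ?_⟩
  · obtain ⟨h1, h2⟩ := hP.admissible hh (hred ▸ ENNReal.ofReal_ne_top)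
    exact ⟨_, h1, h2.trans hred⟩
  · rintro _ ⟨q, hq, rfl⟩
    by_cases hE : energy (l ^ 2) q = ⊤
    · rw [hE]; exact le_top
    obtain ⟨u', k', v', p', hP', hE'⟩ := exists_profile_of_admissible hh hq hE
    have hi' := integrableOn_energyDensity hP'.prim_u hP'.prim_v (hE' ▸ hE)
    rw [← hE', reducedEnergy_eq_ofReal hi']
    exact ENNReal.ofReal_le_ofReal (hmin u' k' v' p' hP' hi')
  · -- the lower bound holds for every positive upper bound of `m`
    have key : ∀ ε > 0, l ^ 4 + x ^ 3 * l ^ 3 ≤ 10 ^ 8 * (m + ε) := fun ε hε =>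
      (EnergyBound.of_integrable hh hP.prim_u hP.prim_v hi
        (by linarith : _ ≤ m + ε)).lower_bound (by linarith) hl hh2 hx hx1 hP.integral_v
    have : l ^ 4 + x ^ 3 * l ^ 3 ≤ 10 ^ 8 * m :=
      le_of_forall_pos_le_add fun ε hε => by
        have := key (ε / 10 ^ 8) (by positivity)
        linarith
    norm_num at this ⊢
    linarith
  · have h1 := hmin u₀ k₀ v₀ p₀ hP₀ hi₀
    have h2 : 0 ≤ l ^ 4 + x ^ 3 * l ^ 3 := by positivity
    norm_num at h2 hle₀ ⊢
    linarith
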